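/- Let $M$ be a smooth finite-dimensional (Hausdorff, second countable) manifold. All line bundles and vector bundles are smooth, complex, hermitian and of finite locally constant rank (rank $0$ is allowed); isomorphisms of vector bundles are smooth and linear. **Definitions.** A *bundle gerbe* $(L,Y)$ over $M$ is a smooth map $\pi\colon Y\to M$ of a smooth space $Y$ that admits local smooth sections, a hermitian line bundle $L\to Y^{[2]}=Y\times_MY$, and a smooth associative hermitian product $L_{(y_1,y_2)}\otimes L_{(y_2,y_3)}\to L_{(y_1,y_3)}$. Here $Y$ may be any diffeological space (for instance a finite- or infinite-dimensional manifold), with fibre products again diffeological spaces. Bundle gerbes have duals $(L^*,Y)$, products $(L\otimes J,\,Y\times_MZ)$ and pull-backs $(f^{-1}L,f^{-1}Y)$. The *Dixmier–Douady class* $d(L)\in H^3(M,\mathbb Z)$ (Čech cohomology) is the class of the integral cocycle $\delta\zeta$, where, for a suitable open cover $(U_a)$, local sections $s_a$ of $\pi$ and smooth unit sections $\sigma_{ab}$ of $(s_a,s_b)^{-1}L$ over $U_a\cap U_b$, one has $\sigma_{ab}\sigma_{bc}=e^{2\pi i\zeta_{abc}}\sigma_{ac}$ with smooth real $\zeta_{abc}$.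 A *trivialisation* of $(L,Y)$ is a hermitian line bundle $T\to Y$ with a hermitian isomorphism $\delta(T)_{(y_1,y_2)}=T_{y_2}\otimes T_{y_1}^*\cong L_{(y_1,y_2)}$ compatible with the products; $(L,Y)$ is *trivial* if it has one. A *stable isomorphism* from $(L,Y)$ to $(J,Z)$ is a trivialisation $K\to Y\times_MZ$ of $L^*\otimes J$. A *bundle gerbe module* for $(L,Y)$ is a hermitian bundle $E\to Y$ with a smooth hermitian action $L_{(y_1,y_2)}\otimes E_{y_2}\to E_{y_1}$ compatible with the product of $L$; isomorphisms of modules are bundle isomorphisms commuting with the actions. $\mathrm{Mod}(L)$ is the monoid of isomorphism classes of modules under $\oplus$, and $K_{bg}(L)$ is its Grothendieck group, with $[E]$ the class of $E$. $K(M)$ is the Grothendieck ring of vector bundles on $M$ under $\oplus$ and $\otimes$. A stable isomorphism $K$ from $L$ to $J$ is said to *induce* an isomorphism $\varphi\colon K_{bg}(L)\to K_{bg}(J)$ if $\varphi[E]=[F]$ whenever $E$ is an $L$-module and $F$ the $J$-module to which the bundle $K^*\otimes E$ on $Y\times_MZ$, with fibres $K^*_{(y,z)}\otimes E_y$, descends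 (so $K^*_{(y,z)}\otimes E_y\cong F_z$, compatibly with the actions of $L$ and $J$). For $[H]\in H^3(M,\mathbb Z)$, $K_{bg}(M,[H])$ denotes $K_{bg}(L)$ for any bundle gerbe $L$ with $d(L)=[H]$, the groups for two such gerbes being identified through stable isomorphisms. **Proposition.** (1) If $(L,Y)$ is a trivial bundle gerbe then $K_{bg}(L)\cong K(M)$. More precisely, every trivialisation $T$ of $(L,Y)$ gives an isomorphism of groups $K_{bg}(L)\to K(M)$ that maps $[E]$ to $[F]$, where $F$ is the bundle on $M$ to which $T\otimes E$ descends (so $T\otimes E\cong\pi^{-1}F$, compatibly with the descent data given by $L_{(y_1,y_2)}\cong T_{y_2}\otimes T_{y_1}^*$ and the action of $L$ on $E$). (2) For every bundle gerbe $(L,Y)$, $K_{bg}(L)$ is a module over the ring $K(M)$, with $[F]\cdot[E]=[\pi^{-1}(F)\otimes E]$ for each vector bundle $F$ on $M$ and each $L$-module $E$. (3) For $[H],[H']\in H^3(M,\mathbb Z)$ there is a homomorphism $$K_{bg}(M,[H])\otimes K_{bg}(M,[H'])\to K_{bg}(M,[H]+[H'])$$ given by $[E]\otimes[F]\mapsto[E\otimes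 F]$. Precisely: let $(L,Y)$, $(J,Z)$ be bundle gerbes over $M$ with $d(L)=[H]$ and $d(J)=[H']$. Then $d(L\otimes J)=[H]+[H']$, and for every bundle gerbe $P$ over $M$ with $d(P)=[H]+[H']$ the gerbes $L\otimes J$ and $P$ are stably isomorphic; each stable isomorphism $\alpha$ from $L\otimes J$ to $P$ induces an isomorphism $\varphi_\alpha\colon K_{bg}(L\otimes J)\to K_{bg}(P)$, and there is a homomorphism $K_{bg}(L)\otimes_{\mathbb Z}K_{bg}(J)\to K_{bg}(P)$ with $[E]\otimes[F]\mapsto\varphi_\alpha[E\otimes F]$, where $E\otimes F$ is the bundle on $Y\times_MZ$ with fibres $E_y\otimes F_z$, a module for $L\otimes J$. (4) For $[H]\in H^3(M,\mathbb Z)$ and a smooth map $f\colon N\to M$ from a smooth manifold $N$ (finite-dimensional, Hausdorff, second countable) there is a homomorphism $$K_{bg}(M,[H])\to K_{bg}(N,f^*[H])$$ given by pull-back of modules. Precisely: let $L$ be a bundle gerbe over $M$ with $d(L)=[H]$. Then $d(f^{-1}L)=f^*[H]$, and for every bundle gerbe $J$ over $N$ with $d(J)=f^*[H]$ the gerbes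 $f^{-1}L$ and $J$ are stably isomorphic; each stable isomorphism $\alpha$ from $f^{-1}L$ to $J$ induces an isomorphism $\varphi_\alpha\colon K_{bg}(f^{-1}L)\to K_{bg}(J)$, and there is a homomorphism $K_{bg}(L)\to K_{bg}(J)$ with $[E]\mapsto\varphi_\alpha[f^{-1}E]$. -/

import Mathlib

open Diffeology
open scoped ContDiff Manifold InnerProductSpace Topology TensorProduct
universe u v w u' v'

noncomputable section
namespace BundleGerbeK

section Spaces
variable {X Y Z : Type*} [DiffeologicalSpace X] [DiffeologicalSpace Y] [DiffeologicalSpace Z]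

/-- The product diffeology: a plot is a pair of plots. -/
instance instDiffeologyProd : DiffeologicalSpace (X × Y) where
  plots n := {p | IsPlot (fun t => (p t).1) ∧ IsPlot (fun t => (p t).2)}
  constant_plots x := ⟨isPlot_const, isPlot_const⟩
  plot_reparam hp hf := ⟨isPlot_reparam hp.1 hf, isPlot_reparam hp.2 hf⟩
  locality hp := by
    refine ⟨DiffeologicalSpace.locality fun x => ?_, DiffeologicalSpace.locality fun x => ?_⟩
    · obtain ⟨u, hu, hx, h⟩ := hp x
      exact ⟨u, hu, hx, fun hf hf' => (h hf hf').1⟩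
    · obtain ⟨u, hu, hx, h⟩ := hp x
      exact ⟨u, hu, hx, fun hf hf' => (h hf hf').2⟩

/-- The subspace diffeology: a plot is a plot of the ambient space with values in the subspace. -/
instance instDiffeologySubtype {P : X → Prop} : DiffeologicalSpace {x // P x} where
  plots n := {p | IsPlot (fun t => (p t : X))}
  constant_plots x := isPlot_const
  plot_reparam {_ _ p _} hp hf := isPlot_reparam (p := fun t => (p t : X)) hp hf
  locality hp := by
    refine DiffeologicalSpace.locality fun x => ?_
    obtain ⟨u, hu, hx, h⟩ := hp x
    exact ⟨u, hu, hx, fun hf hf' => h hf hf'⟩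

theorem dSmooth_fst : DSmooth (Prod.fst : X × Y → X) := fun _ _ hp => hp.1
theorem dSmooth_snd : DSmooth (Prod.snd : X × Y → Y) := fun _ _ hp => hp.2
theorem dSmooth_val {P : X → Prop} : DSmooth (Subtype.val : {x // P x} → X) := fun _ _ hp => hp
theorem dSmooth_prodMk {f : Z → X} {g : Z → Y} (hf : DSmooth f) (hg : DSmooth g) :
    DSmooth fun z => (f z, g z) := fun _ _ hp => ⟨hf _ _ hp, hg _ _ hp⟩
theorem dSmooth_mk {P : X → Prop} {f : Z → X} (hf : DSmooth f) (h : ∀ z, P (f z)) :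
    DSmooth fun z => (⟨f z, h z⟩ : {x // P x}) := fun _ _ hp => hf _ _ hp

/-- Smoothness on an open set of a function with values in a normed space. -/
def SmoothFunOn {V : Type*} [NormedAddCommGroup V] [NormedSpace ℝ V] (f : X → V) (U : Set X) :
    Prop :=
  ∀ (n : ℕ) (p : EuclideanSpace ℝ (Fin n) → X), IsPlot p → ContDiffOn ℝ ∞ (f ∘ p) (p ⁻¹' U)

theorem isOpen_preimage {f : X → Y} (hf : DSmooth f) {U : Set Y} (hU : IsOpen[dTopology] U) :
    IsOpen[dTopology] (f ⁻¹' U) :=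
  isOpen_iff_preimages_plots.2 fun n p hp => isOpen_iff_preimages_plots.1 hU n _ (hf n p hp)

theorem SmoothFunOn.comp {V : Type*} [NormedAddCommGroup V] [NormedSpace ℝ V] {f : Y → V}
    {U : Set Y} (hf : SmoothFunOn f U) {g : X → Y} (hg : DSmooth g) :
    SmoothFunOn (fun x => f (g x)) (g ⁻¹' U) :=
  fun n p hp => hf n (g ∘ p) (hg n p hp)

theorem SmoothFunOn.mono {V : Type*} [NormedAddCommGroup V] [NormedSpace ℝ V] {f : X → V}
    {U W : Set X} (hf : SmoothFunOn f U) (h : W ⊆ U) : SmoothFunOn f W :=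
  fun n p hp => (hf n p hp).mono (Set.preimage_mono h)

theorem SmoothFunOn.congr {V : Type*} [NormedAddCommGroup V] [NormedSpace ℝ V] {f g : X → V}
    {U : Set X} (hf : SmoothFunOn f U) (h : ∀ x ∈ U, g x = f x) : SmoothFunOn g U :=
  fun n p hp => (hf n p hp).congr fun _ ht => h _ ht

theorem SmoothFunOn.mul {f g : X → ℂ} {U : Set X} (hf : SmoothFunOn f U) (hg : SmoothFunOn g U) :
    SmoothFunOn (fun x => f x * g x) U :=
  fun n p hp => (hf n p hp).mul (hg n p hp)

theorem SmoothFunOn.sum {ι : Type*} (s : Finset ι) {f : ι → X → ℂ} {U : Set X}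
    (hf : ∀ i ∈ s, SmoothFunOn (f i) U) : SmoothFunOn (fun x => ∑ i ∈ s, f i x) U :=
  fun n p hp => by
    have := ContDiffOn.sum (fun i hi => hf i hi n p hp)
    refine this.congr fun _ _ => by simp

theorem smoothFunOn_const {V : Type*} [NormedAddCommGroup V] [NormedSpace ℝ V] (c : V)
    (U : Set X) : SmoothFunOn (fun _ => c) U :=
  fun _ _ _ => contDiffOn_const

theorem SmoothFunOn.star {f : X → ℂ} {U : Set X} (hf : SmoothFunOn f U) :
    SmoothFunOn (fun x => (starRingEnd ℂ) (f x)) U :=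
  fun n p hp => Complex.conjCLE.contDiff.comp_contDiffOn (hf n p hp)

theorem smoothFunOn_of_local {V : Type*} [NormedAddCommGroup V] [NormedSpace ℝ V] {f : X → V}
    {U : Set X} (h : ∀ x ∈ U, ∃ W, IsOpen[dTopology] W ∧ x ∈ W ∧ SmoothFunOn f (U ∩ W)) :
    SmoothFunOn f U := by
  intro n p hp t ht
  obtain ⟨W, hW, hx, hf⟩ := h (p t) ht
  refine ((hf n p hp) t ⟨ht, hx⟩).mono_of_mem_nhdsWithin ?_
  exact Filter.inter_mem self_mem_nhdsWithin
    (mem_nhdsWithin_of_mem_nhds ((isOpen_iff_preimages_plots.1 hW n p hp).mem_nhds hx))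

end Spaces

section ManifoldDiffeology
variable (m : ℕ) (M : Type*) [TopologicalSpace M] [ChartedSpace (EuclideanSpace ℝ (Fin m)) M]

/-- The diffeology of a smooth manifold: its plots are the `C^∞` maps `ℝⁿ → M`. -/
class IsManifoldDiffeology [DiffeologicalSpace M] : Prop where
  isPlot_iff {n : ℕ} {p : EuclideanSpace ℝ (Fin n) → M} : IsPlot p ↔ ContMDiff (𝓡 n) (𝓡 m) ∞ p

/-- The standard diffeology of a manifold; its D-topology is the manifold topology. -/
@[reducible]
def manifoldDiffeology [IsManifold (𝓡 m) ∞ M] : DiffeologicalSpace M where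
  plots n := {p | ContMDiff (𝓡 n) (𝓡 m) ∞ p}
  constant_plots x := contMDiff_const
  plot_reparam hp hf := ContMDiff.comp hp hf.contMDiff
  locality := by
    intro n p hp x
    obtain ⟨u, hu, hx, h⟩ := hp x
    obtain ⟨r, hr, hru⟩ := Metric.isOpen_iff.1 hu x hx
    set b := OpenPartialHomeomorph.univBall x r with hb
    have h1 := h (f := b) (fun y => hru (by
      have := b.map_source (x := y) (by simp [hb])
      rwa [hb, OpenPartialHomeomorph.univBall_target x hr] at this))
      OpenPartialHomeomorph.contDiff_univBall
    have h2 : ContMDiffAt (𝓡 n) (𝓡 n) ∞ b.symm x :=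
      ((OpenPartialHomeomorph.contDiffOn_univBall_symm (c := x) (r := r)).contDiffAt
        (Metric.ball_mem_nhds x hr)).contMDiffAt
    have h3 : ContMDiffAt (𝓡 n) (𝓡 m) ∞ ((p ∘ b) ∘ b.symm) x :=
      ContMDiffAt.comp x (ContMDiff.contMDiffAt h1) h2
    refine h3.congr_of_eventuallyEq ?_
    filter_upwards [Metric.ball_mem_nhds x hr] with y hy
    have : b (b.symm y) = y := b.right_inv (by
      rwa [hb, OpenPartialHomeomorph.univBall_target x hr])
    simp [this]
  dTopology := inferInstance
  isOpen_iff_preimages_plots := by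
    intro u
    refine ⟨fun hu n p hp => IsOpen.preimage (ContMDiff.continuous hp) hu, fun h => ?_⟩
    refine isOpen_iff_mem_nhds.2 fun x hx => ?_
    set φ := chartAt (EuclideanSpace ℝ (Fin m)) x with hφ
    obtain ⟨r, hr, hrt⟩ := Metric.isOpen_iff.1 φ.open_target (φ x) (mem_chart_target _ x)
    set b := OpenPartialHomeomorph.univBall (φ x) r with hb
    have hbt : b.target = Metric.ball (φ x) r := OpenPartialHomeomorph.univBall_target _ hr
    have hbs : ∀ y, b y ∈ φ.target := fun y => hrt (by
      rw [← hbt]; exact b.map_source (by simp [hb]))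
    have hp : ContMDiff (𝓡 m) (𝓡 m) ∞ (φ.symm ∘ b) := by
      have h1 : ContMDiffOn (𝓡 m) (𝓡 m) ∞ φ.symm φ.target := contMDiffOn_chart_symm
      have h2 : ContMDiff (𝓡 m) (𝓡 m) ∞ b := 
        (OpenPartialHomeomorph.contDiff_univBall (n := (⊤ : ℕ∞)) (c := φ x) (r := r)).contMDiff
      exact h1.comp_contMDiff h2 hbs
    have ho := h _ hp
    have hc : ContinuousAt (b.symm ∘ φ) x := by
      refine ContinuousAt.comp ?_ (φ.continuousAt (mem_chart_source _ x))
      exact b.symm.continuousAt (by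
        rw [OpenPartialHomeomorph.symm_source, hbt]; exact Metric.mem_ball_self hr)
    have hr1 : φ.symm (b (b.symm (φ x))) = x := by
      rw [b.right_inv (by rw [hbt]; exact Metric.mem_ball_self hr),
        φ.left_inv (mem_chart_source _ x)]
    have hmem : (b.symm ∘ φ) x ∈ (φ.symm ∘ b) ⁻¹' u := by
      simp only [Set.mem_preimage, Function.comp_apply, hr1, hx]
    have hev := hc.preimage_mem_nhds (ho.mem_nhds hmem)
    have hball : φ ⁻¹' Metric.ball (φ x) r ∈ 𝓝 x :=
      (φ.continuousAt (mem_chart_source _ x)).preimage_mem_nhds (Metric.ball_mem_nhds _ hr)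
    filter_upwards [hev, hball, φ.open_source.mem_nhds (mem_chart_source _ x)] with y h1 h2 h3
    simp only [Set.mem_preimage, Function.comp_apply] at h1
    rwa [b.right_inv (by rw [hbt]; exact h2), φ.left_inv h3] at h1

theorem isManifoldDiffeology_manifoldDiffeology [IsManifold (𝓡 m) ∞ M] :
    @IsManifoldDiffeology m M _ _ (manifoldDiffeology m M) :=
  letI := manifoldDiffeology m M
  ⟨Iff.rfl⟩

theorem dTopology_eq [IsManifold (𝓡 m) ∞ M] [d : DiffeologicalSpace M]
    [h : IsManifoldDiffeology m M] : (dTopology : TopologicalSpace M) = ‹TopologicalSpace M› := by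
  have : d = manifoldDiffeology m M := by
    ext n p
    exact h.isPlot_iff
  subst this
  rfl

variable {m M} in
theorem dSmooth_of_contMDiff {n : ℕ} {N : Type*} [TopologicalSpace N]
    [ChartedSpace (EuclideanSpace ℝ (Fin n)) N] [DiffeologicalSpace M] [DiffeologicalSpace N]
    [hM : IsManifoldDiffeology m M] [hN : IsManifoldDiffeology n N] {f : N → M}
    (hf : ContMDiff (𝓡 n) (𝓡 m) ∞ f) : DSmooth f :=
  fun _ _ hp => hM.isPlot_iff.2 (hf.comp (hN.isPlot_iff.1 hp))

end ManifoldDiffeology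

section Bundles
variable {X Z : Type*} [DiffeologicalSpace X] [DiffeologicalSpace Z]

/-- An orthonormal local frame of a family of complex inner product spaces, over an open set
`dom`; the values of `vec` outside `dom` are irrelevant. -/
structure Frame (V : X → Type) [∀ x, NormedAddCommGroup (V x)]
    [∀ x, InnerProductSpace ℂ (V x)] where
  ι : Type
  [fintype : Fintype ι]
  dom : Set X
  isOpen_dom : IsOpen[dTopology] dom
  vec : ι → ∀ x, V x
  orthonormal : ∀ x ∈ dom, Orthonormal ℂ fun i => vec i x
  span : ∀ x ∈ dom, ⊤ ≤ Submodule.span ℂ (Set.range fun i => vec i x)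

attribute [instance] Frame.fintype

/-- A smooth hermitian vector bundle of finite (locally constant) rank: a family of inner product
spaces with an atlas of orthonormal local frames whose transition matrices are smooth. -/
structure HermBundle (X : Type*) [DiffeologicalSpace X] where
  fiber : X → Type
  [normed : ∀ x, NormedAddCommGroup (fiber x)]
  [innerProd : ∀ x, InnerProductSpace ℂ (fiber x)]
  atlas : Set (Frame fiber)
  cover : ∀ x, ∃ e ∈ atlas, x ∈ e.dom
  smooth : ∀ e ∈ atlas, ∀ f ∈ atlas, ∀ i j,
    SmoothFunOn (fun x => ⟪e.vec i x, f.vec j x⟫_ℂ) (e.dom ∩ f.dom)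

attribute [instance] HermBundle.normed HermBundle.innerProd

/-- The orthonormal basis of a fibre given by a frame. -/
def Frame.basis {V : X → Type} [∀ x, NormedAddCommGroup (V x)] [∀ x, InnerProductSpace ℂ (V x)]
    (e : Frame V) {x : X} (hx : x ∈ e.dom) : OrthonormalBasis e.ι ℂ (V x) :=
  OrthonormalBasis.mk (e.orthonormal x hx) (e.span x hx)

@[simp] theorem Frame.basis_apply {V : X → Type} [∀ x, NormedAddCommGroup (V x)]
    [∀ x, InnerProductSpace ℂ (V x)] (e : Frame V) {x : X} (hx : x ∈ e.dom) (i : e.ι) :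
    e.basis hx i = e.vec i x := by
  simp [Frame.basis]

theorem HermBundle.finiteDimensional (E : HermBundle X) (x : X) :
    FiniteDimensional ℂ (E.fiber x) := by
  obtain ⟨e, -, hx⟩ := E.cover x
  exact (e.basis hx).toBasis.finiteDimensional_of_finite

attribute [instance] HermBundle.finiteDimensional

/-- Smoothness of a fibrewise linear map, through its matrices in local frames. -/
def IsSmoothHom (E F : HermBundle X) (φ : ∀ x, E.fiber x →ₗ[ℂ] F.fiber x) : Prop :=
  ∀ e ∈ E.atlas, ∀ f ∈ F.atlas, ∀ i j,
    SmoothFunOn (fun x => ⟪f.vec j x, φ x (e.vec i x)⟫_ℂ) (e.dom ∩ f.dom)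

/-- Smoothness of a fibrewise bilinear map, through its coefficients in local frames. -/
def IsSmoothBilin (E F G : HermBundle X) (β : ∀ x, E.fiber x →ₗ[ℂ] F.fiber x →ₗ[ℂ] G.fiber x) :
    Prop :=
  ∀ e ∈ E.atlas, ∀ f ∈ F.atlas, ∀ g ∈ G.atlas, ∀ i j k,
    SmoothFunOn (fun x => ⟪g.vec k x, β x (e.vec i x) (f.vec j x)⟫_ℂ) (e.dom ∩ f.dom ∩ g.dom)

/-- A smooth section of `E` along a plot of the base. -/
def IsSmoothAlong (E : HermBundle X) {n : ℕ} (p : EuclideanSpace ℝ (Fin n) → X)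
    (s : ∀ t, E.fiber (p t)) : Prop :=
  ∀ e ∈ E.atlas, ∀ i, ContDiffOn ℝ ∞ (fun t => ⟪e.vec i (p t), s t⟫_ℂ) (p ⁻¹' e.dom)

/-- An isomorphism of smooth vector bundles (not necessarily isometric). -/
structure BundleIso (E F : HermBundle X) where
  equiv : ∀ x, E.fiber x ≃ₗ[ℂ] F.fiber x
  smooth : IsSmoothHom E F fun x => (equiv x).toLinearMap
  smooth_symm : IsSmoothHom F E fun x => (equiv x).symm.toLinearMap

theorem IsSmoothHom.id (E : HermBundle X) : IsSmoothHom E E fun _ => LinearMap.id :=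
  fun e he f hf i j => (E.smooth f hf e he j i).mono (Set.inter_comm _ _).subset

theorem IsSmoothHom.comp {E F G : HermBundle X} {φ : ∀ x, E.fiber x →ₗ[ℂ] F.fiber x}
    {ψ : ∀ x, F.fiber x →ₗ[ℂ] G.fiber x} (hψ : IsSmoothHom F G ψ) (hφ : IsSmoothHom E F φ) :
    IsSmoothHom E G fun x => ψ x ∘ₗ φ x := by
  intro e he g hg i k
  refine smoothFunOn_of_local fun x _ => ?_
  obtain ⟨f, hf, hxf⟩ := F.cover x
  refine ⟨f.dom, f.isOpen_dom, hxf, ?_⟩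
  refine SmoothFunOn.congr (f := fun x => ∑ j, ⟪f.vec j x, φ x (e.vec i x)⟫_ℂ *
    ⟪g.vec k x, ψ x (f.vec j x)⟫_ℂ) ?_ ?_
  · exact SmoothFunOn.sum _ fun j _ =>
      ((hφ e he f hf i j).mono fun x hx => ⟨hx.1.1, hx.2⟩).mul
        ((hψ f hf g hg j k).mono fun x hx => ⟨hx.2, hx.1.2⟩)
  · intro x hx
    have h := (f.basis hx.2).sum_repr' (φ x (e.vec i x))
    simp only [Frame.basis_apply] at h
    simp only [LinearMap.comp_apply]
    conv_lhs => rw [← h]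
    rw [map_sum, inner_sum]
    exact Finset.sum_congr rfl fun j _ => by rw [map_smul, inner_smul_right]

def BundleIso.refl (E : HermBundle X) : BundleIso E E where
  equiv _ := LinearEquiv.refl ℂ _
  smooth := IsSmoothHom.id E
  smooth_symm := IsSmoothHom.id E

def BundleIso.symm {E F : HermBundle X} (φ : BundleIso E F) : BundleIso F E where
  equiv x := (φ.equiv x).symm
  smooth := φ.smooth_symm
  smooth_symm := φ.smooth

def BundleIso.trans {E F G : HermBundle X} (φ : BundleIso E F) (ψ : BundleIso F G) :
    BundleIso E G where
  equiv x := (φ.equiv x).trans (ψ.equiv x)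
  smooth := ψ.smooth.comp φ.smooth
  smooth_symm := φ.smooth_symm.comp ψ.smooth_symm

/-! ### Operations on bundles -/

/-- The pull-back of a local frame. -/
@[reducible]
def Frame.pullback {V : X → Type} [∀ x, NormedAddCommGroup (V x)]
    [∀ x, InnerProductSpace ℂ (V x)] (e : Frame V) (g : Z → X) (hg : DSmooth g) :
    Frame fun z => V (g z) where
  ι := e.ι
  dom := g ⁻¹' e.dom
  isOpen_dom := isOpen_preimage hg e.isOpen_dom
  vec i z := e.vec i (g z)
  orthonormal z hz := e.orthonormal (g z) hz
  span z hz := e.span (g z) hz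

/-- The pull-back bundle `g⁻¹(E)`. -/
@[reducible]
def HermBundle.pullback (E : HermBundle X) (g : Z → X) (hg : DSmooth g) : HermBundle Z where
  fiber z := E.fiber (g z)
  atlas := (fun e => e.pullback g hg) '' E.atlas
  cover z := by
    obtain ⟨e, he, h⟩ := E.cover (g z)
    exact ⟨_, ⟨e, he, rfl⟩, h⟩
  smooth := by
    rintro _ ⟨e, he, rfl⟩ _ ⟨f, hf, rfl⟩ i j
    exact (E.smooth e he f hf i j).comp hg

/-- The tensor product of local frames. -/
@[reducible]
def Frame.tensor {V W : X → Type} [∀ x, NormedAddCommGroup (V x)]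
    [∀ x, InnerProductSpace ℂ (V x)] [∀ x, NormedAddCommGroup (W x)]
    [∀ x, InnerProductSpace ℂ (W x)] (e : Frame V) (f : Frame W) :
    Frame fun x => V x ⊗[ℂ] W x where
  ι := e.ι × f.ι
  dom := e.dom ∩ f.dom
  isOpen_dom := @IsOpen.inter _ dTopology _ _ e.isOpen_dom f.isOpen_dom
  vec i x := e.vec i.1 x ⊗ₜ f.vec i.2 x
  orthonormal x hx := by
    convert ((e.basis hx.1).tensorProduct (f.basis hx.2)).orthonormal using 2 with i
    simp [OrthonormalBasis.tensorProduct_apply']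
  span x hx := by
    have h : (fun i : e.ι × f.ι => e.vec i.1 x ⊗ₜ[ℂ] f.vec i.2 x) =
        ((e.basis hx.1).tensorProduct (f.basis hx.2)).toBasis := by
      funext i
      simp [Module.Basis.tensorProduct_apply']
    rw [h]
    exact ((e.basis hx.1).tensorProduct (f.basis hx.2)).toBasis.span_eq.ge

/-- The tensor product `E ⊗ F`. -/
@[reducible]
def HermBundle.tensor (E F : HermBundle X) : HermBundle X where
  fiber x := E.fiber x ⊗[ℂ] F.fiber x
  atlas := Set.image2 (fun e f => e.tensor f) E.atlas F.atlas
  cover x := by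
    obtain ⟨e, he, h⟩ := E.cover x
    obtain ⟨f, hf, h'⟩ := F.cover x
    exact ⟨_, ⟨e, he, f, hf, rfl⟩, h, h'⟩
  smooth := by
    rintro _ ⟨e, he, f, hf, rfl⟩ _ ⟨e', he', f', hf', rfl⟩ i j
    simp only [TensorProduct.inner_tmul]
    exact ((E.smooth e he e' he' i.1 j.1).mono fun x hx => ⟨hx.1.1, hx.2.1⟩).mul
      ((F.smooth f hf f' hf' i.2 j.2).mono fun x hx => ⟨hx.1.2, hx.2.2⟩)

/-- The direct sum of local frames. -/
@[reducible]
def Frame.sum {V W : X → Type} [∀ x, NormedAddCommGroup (V x)]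
    [∀ x, InnerProductSpace ℂ (V x)] [∀ x, NormedAddCommGroup (W x)]
    [∀ x, InnerProductSpace ℂ (W x)] (e : Frame V) (f : Frame W) :
    Frame fun x => WithLp 2 (V x × W x) where
  ι := e.ι ⊕ f.ι
  dom := e.dom ∩ f.dom
  isOpen_dom := @IsOpen.inter _ dTopology _ _ e.isOpen_dom f.isOpen_dom
  vec i x := i.elim (fun i => WithLp.toLp 2 (e.vec i x, 0)) fun j => WithLp.toLp 2 (0, f.vec j x)
  orthonormal x hx := by
    convert ((e.basis hx.1).prod (f.basis hx.2)).orthonormal using 2 with i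
    rcases i with i | i <;> simp
  span x hx := by
    have h : (fun i : e.ι ⊕ f.ι => i.elim (fun i => WithLp.toLp 2 (e.vec i x, (0 : W x)))
        fun j => WithLp.toLp 2 ((0 : V x), f.vec j x)) =
        ((e.basis hx.1).prod (f.basis hx.2)).toBasis := by
      funext i
      rcases i with i | i <;> simp
    rw [h]
    exact ((e.basis hx.1).prod (f.basis hx.2)).toBasis.span_eq.ge

/-- The direct sum `E ⊕ F`. -/
@[reducible]
def HermBundle.sum (E F : HermBundle X) : HermBundle X where
  fiber x := WithLp 2 (E.fiber x × F.fiber x)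
  atlas := Set.image2 (fun e f => e.sum f) E.atlas F.atlas
  cover x := by
    obtain ⟨e, he, h⟩ := E.cover x
    obtain ⟨f, hf, h'⟩ := F.cover x
    exact ⟨_, ⟨e, he, f, hf, rfl⟩, h, h'⟩
  smooth := by
    rintro _ ⟨e, he, f, hf, rfl⟩ _ ⟨e', he', f', hf', rfl⟩ (i | i) (j | j)
    · simpa using (E.smooth e he e' he' i j).mono fun x hx => ⟨hx.1.1, hx.2.1⟩
    · simpa using smoothFunOn_const (0 : ℂ) _
    · simpa using smoothFunOn_const (0 : ℂ) _
    · simpa using (F.smooth f hf f' hf' i j).mono fun x hx => ⟨hx.1.2, hx.2.2⟩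

/-- The inner product on the dual of a complete inner product space, for which the
(conjugate-linear) Riesz map is isometric. -/
@[reducible]
def dualInnerProductSpace (V : Type) [NormedAddCommGroup V] [InnerProductSpace ℂ V]
    [CompleteSpace V] : InnerProductSpace ℂ (StrongDual ℂ V) where
  inner f g := ⟪(InnerProductSpace.toDual ℂ V).symm g, (InnerProductSpace.toDual ℂ V).symm f⟫_ℂ
  norm_sq_eq_re_inner f := by
    rw [← (InnerProductSpace.toDual ℂ V).symm.norm_map f]
    exact norm_sq_eq_re_inner (𝕜 := ℂ) _
  conj_inner_symm f g := inner_conj_symm _ _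
  add_left f g h := by rw [map_add, inner_add_right]
  smul_left f g r := by rw [map_smulₛₗ, inner_smul_right]

instance (E : HermBundle X) (x : X) : CompleteSpace (E.fiber x) := FiniteDimensional.complete ℂ _

instance (E : HermBundle X) (x : X) : InnerProductSpace ℂ (StrongDual ℂ (E.fiber x)) :=
  dualInnerProductSpace _

theorem dual_inner (E : HermBundle X) (x : X) (f g : StrongDual ℂ (E.fiber x)) :
    ⟪f, g⟫_ℂ =
      ⟪(InnerProductSpace.toDual ℂ _).symm g, (InnerProductSpace.toDual ℂ _).symm f⟫_ℂ := rfl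

theorem dual_inner_toDual (E : HermBundle X) (x : X) (a b : E.fiber x) :
    ⟪InnerProductSpace.toDual ℂ _ a, InnerProductSpace.toDual ℂ _ b⟫_ℂ = ⟪b, a⟫_ℂ := by
  simp [dual_inner]

/-- The dual of an orthonormal frame. -/
@[reducible]
def HermBundle.dualFrame (E : HermBundle X) (e : Frame E.fiber) :
    Frame fun x => StrongDual ℂ (E.fiber x) where
  ι := e.ι
  dom := e.dom
  isOpen_dom := e.isOpen_dom
  vec i x := InnerProductSpace.toDual ℂ _ (e.vec i x)
  orthonormal x hx := by
    classical
    rw [orthonormal_iff_ite]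
    intro i j
    rw [dual_inner_toDual, orthonormal_iff_ite.1 (e.orthonormal x hx) j i]
    simp [eq_comm]
  span x hx := by
    intro f _
    have h := (e.basis hx).sum_repr' ((InnerProductSpace.toDual ℂ _).symm f)
    have h' := congrArg (InnerProductSpace.toDual ℂ _) h
    rw [LinearIsometryEquiv.apply_symm_apply, map_sum] at h'
    rw [← h']
    refine Submodule.sum_mem _ fun i _ => ?_
    rw [map_smulₛₗ, Frame.basis_apply]
    exact Submodule.smul_mem _ _ (Submodule.subset_span ⟨i, rfl⟩)

/-- The dual bundle `E*`. -/
@[reducible]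
def HermBundle.dual (E : HermBundle X) : HermBundle X where
  fiber x := StrongDual ℂ (E.fiber x)
  atlas := E.dualFrame '' E.atlas
  cover x := by
    obtain ⟨e, he, h⟩ := E.cover x
    exact ⟨_, ⟨e, he, rfl⟩, h⟩
  smooth := by
    rintro _ ⟨e, he, rfl⟩ _ ⟨f, hf, rfl⟩ i j
    simp only [dual_inner_toDual]
    exact (E.smooth f hf e he j i).mono (Set.inter_comm _ _).subset

/-- The constant frame given by an orthonormal basis of a fixed vector space. -/
@[reducible]
def Frame.const (X : Type*) [DiffeologicalSpace X] {V : Type} [NormedAddCommGroup V]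
    [InnerProductSpace ℂ V] {ι : Type} [Fintype ι] (b : OrthonormalBasis ι ℂ V) :
    Frame fun _ : X => V where
  ι := ι
  dom := Set.univ
  isOpen_dom := @isOpen_univ _ dTopology
  vec i _ := b i
  orthonormal _ _ := b.orthonormal
  span _ _ := by
    have := b.toBasis.span_eq.ge
    rwa [OrthonormalBasis.coe_toBasis] at this

/-- The trivial bundle with a fixed fibre. -/
@[reducible]
def HermBundle.const (X : Type*) [DiffeologicalSpace X] {V : Type} [NormedAddCommGroup V]
    [InnerProductSpace ℂ V] {ι : Type} [Fintype ι] (b : OrthonormalBasis ι ℂ V) :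
    HermBundle X where
  fiber _ := V
  atlas := {Frame.const X b}
  cover x := ⟨_, rfl, Set.mem_univ x⟩
  smooth := by
    rintro _ rfl _ rfl i j
    exact smoothFunOn_const (X := X) (V := ℂ) ⟪b i, b j⟫_ℂ _

/-- The trivial line bundle. -/
@[reducible]
def HermBundle.one (X : Type*) [DiffeologicalSpace X] : HermBundle X :=
  HermBundle.const X (OrthonormalBasis.singleton Unit ℂ)

/-- The zero bundle. -/
@[reducible]
def HermBundle.zero (X : Type*) [DiffeologicalSpace X] : HermBundle X :=
  HermBundle.const X (EuclideanSpace.basisFun (Fin 0) ℂ)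

end Bundles

section BundleIsos
variable {X Z : Type*} [DiffeologicalSpace X] [DiffeologicalSpace Z]

/-- Fibrewise rearrangement of `WithLp 2 (V × W)`. -/
@[reducible]
def sumLin (V W : Type) [NormedAddCommGroup V] [InnerProductSpace ℂ V] [NormedAddCommGroup W]
    [InnerProductSpace ℂ W] : WithLp 2 (V × W) ≃ₗ[ℂ] V × W :=
  WithLp.linearEquiv 2 ℂ (V × W)

theorem prodAssoc_symm_mk {U V W : Type} [AddCommGroup U] [Module ℂ U] [AddCommGroup V]
    [Module ℂ V] [AddCommGroup W] [Module ℂ W] (u : U) (v : V) (w : W) :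
    (LinearEquiv.prodAssoc ℂ U V W).symm (u, v, w) = ((u, v), w) := rfl

theorem prodAssoc_symm_zero {U V W : Type} [AddCommGroup U] [Module ℂ U] [AddCommGroup V]
    [Module ℂ V] [AddCommGroup W] [Module ℂ W] (u : U) :
    (LinearEquiv.prodAssoc ℂ U V W).symm (u, 0) = ((u, 0), 0) := rfl

theorem prodRight_symm_left {U V W : Type} [AddCommGroup U] [Module ℂ U] [AddCommGroup V]
    [Module ℂ V] [AddCommGroup W] [Module ℂ W] (u : U) (v : V) :
    (TensorProduct.prodRight ℂ ℂ U V W).symm (u ⊗ₜ v, 0) = u ⊗ₜ (v, 0) := by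
  rw [LinearEquiv.symm_apply_eq]; simp

theorem prodRight_symm_right {U V W : Type} [AddCommGroup U] [Module ℂ U] [AddCommGroup V]
    [Module ℂ V] [AddCommGroup W] [Module ℂ W] (u : U) (w : W) :
    (TensorProduct.prodRight ℂ ℂ U V W).symm (0, u ⊗ₜ w) = u ⊗ₜ (0, w) := by
  rw [LinearEquiv.symm_apply_eq]; simp

def BundleIso.tensorCongr {E E' F F' : HermBundle X} (φ : BundleIso E E') (ψ : BundleIso F F') :
    BundleIso (E.tensor F) (E'.tensor F') where
  equiv x := TensorProduct.congr (φ.equiv x) (ψ.equiv x)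
  smooth := by
    rintro _ ⟨e, he, f, hf, rfl⟩ _ ⟨e', he', f', hf', rfl⟩ i j
    refine SmoothFunOn.congr (((φ.smooth e he e' he' i.1 j.1).mono ?_).mul
      ((ψ.smooth f hf f' hf' i.2 j.2).mono ?_)) ?_
    · exact fun x hx => ⟨hx.1.1, hx.2.1⟩
    · exact fun x hx => ⟨hx.1.2, hx.2.2⟩
    · intro x _
      simp
  smooth_symm := by
    rintro _ ⟨e, he, f, hf, rfl⟩ _ ⟨e', he', f', hf', rfl⟩ i j
    refine SmoothFunOn.congr (((φ.smooth_symm e he e' he' i.1 j.1).mono ?_).mul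
      ((ψ.smooth_symm f hf f' hf' i.2 j.2).mono ?_)) ?_
    · exact fun x hx => ⟨hx.1.1, hx.2.1⟩
    · exact fun x hx => ⟨hx.1.2, hx.2.2⟩
    · intro x _
      simp

def BundleIso.tensorComm (E F : HermBundle X) : BundleIso (E.tensor F) (F.tensor E) where
  equiv x := TensorProduct.comm ℂ _ _
  smooth := by
    rintro _ ⟨e, he, f, hf, rfl⟩ _ ⟨f', hf', e', he', rfl⟩ i j
    refine SmoothFunOn.congr (((F.smooth f' hf' f hf j.1 i.2).mono ?_).mul
      ((E.smooth e' he' e he j.2 i.1).mono ?_)) ?_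
    · exact fun x hx => ⟨hx.2.1, hx.1.2⟩
    · exact fun x hx => ⟨hx.2.2, hx.1.1⟩
    · intro x _
      simp
  smooth_symm := by
    rintro _ ⟨f', hf', e', he', rfl⟩ _ ⟨e, he, f, hf, rfl⟩ i j
    refine SmoothFunOn.congr (((E.smooth e he e' he' j.1 i.2).mono ?_).mul
      ((F.smooth f hf f' hf' j.2 i.1).mono ?_)) ?_
    · exact fun x hx => ⟨hx.2.1, hx.1.2⟩
    · exact fun x hx => ⟨hx.2.2, hx.1.1⟩
    · intro x _
      simp

def BundleIso.tensorAssoc (E F G : HermBundle X) :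
    BundleIso ((E.tensor F).tensor G) (E.tensor (F.tensor G)) where
  equiv x := TensorProduct.assoc ℂ _ _ _
  smooth := by
    rintro _ ⟨_, ⟨e, he, f, hf, rfl⟩, g, hg, rfl⟩ _ ⟨e', he', _, ⟨f', hf', g', hg', rfl⟩, rfl⟩ i j
    refine SmoothFunOn.congr (((E.smooth e' he' e he j.1 i.1.1).mono ?_).mul
      (((F.smooth f' hf' f hf j.2.1 i.1.2).mono ?_).mul
      ((G.smooth g' hg' g hg j.2.2 i.2).mono ?_))) ?_
    · exact fun x hx => ⟨hx.2.1, hx.1.1.1⟩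
    · exact fun x hx => ⟨hx.2.2.1, hx.1.1.2⟩
    · exact fun x hx => ⟨hx.2.2.2, hx.1.2⟩
    · intro x _
      simp
  smooth_symm := by
    rintro _ ⟨e', he', _, ⟨f', hf', g', hg', rfl⟩, rfl⟩ _ ⟨_, ⟨e, he, f, hf, rfl⟩, g, hg, rfl⟩ j i
    refine SmoothFunOn.congr ((((E.smooth e he e' he' i.1.1 j.1).mono ?_).mul
      ((F.smooth f hf f' hf' i.1.2 j.2.1).mono ?_)).mul
      ((G.smooth g hg g' hg' i.2 j.2.2).mono ?_)) ?_
    · exact fun x hx => ⟨hx.2.1.1, hx.1.1⟩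
    · exact fun x hx => ⟨hx.2.1.2, hx.1.2.1⟩
    · exact fun x hx => ⟨hx.2.2, hx.1.2.2⟩
    · intro x _
      simp

def BundleIso.oneTensor (E : HermBundle X) : BundleIso ((HermBundle.one X).tensor E) E where
  equiv x := TensorProduct.lid ℂ _
  smooth := by
    rintro _ ⟨_, rfl, e, he, rfl⟩ e' he' i j
    refine SmoothFunOn.congr ((E.smooth e' he' e he j i.2).mono ?_) ?_
    · exact fun x hx => ⟨hx.2, hx.1.2⟩
    · intro x _
      simp
  smooth_symm := by
    rintro e' he' _ ⟨_, rfl, e, he, rfl⟩ j i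
    refine SmoothFunOn.congr ((E.smooth e he e' he' i.2 j).mono ?_) ?_
    · exact fun x hx => ⟨hx.2.2, hx.1⟩
    · intro x _
      simp

def BundleIso.zeroTensor (E : HermBundle X) :
    BundleIso ((HermBundle.zero X).tensor E) (HermBundle.zero X) where
  equiv x :=
    haveI : Subsingleton (EuclideanSpace ℂ (Fin 0) ⊗[ℂ] E.fiber x) :=
      ⟨fun a b => by
        have h : ∀ a : EuclideanSpace ℂ (Fin 0) ⊗[ℂ] E.fiber x, a = 0 := fun a => by
          induction a with
          | zero => rfl
          | tmul u v => rw [Subsingleton.elim u 0, TensorProduct.zero_tmul]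
          | add u v hu hv => rw [hu, hv, add_zero]
        rw [h a, h b]⟩
    { (0 : EuclideanSpace ℂ (Fin 0) ⊗[ℂ] E.fiber x →ₗ[ℂ] EuclideanSpace ℂ (Fin 0)) with
      invFun := 0
      left_inv := fun _ => Subsingleton.elim _ _
      right_inv := fun _ => Subsingleton.elim _ _ }
  smooth := by
    rintro _ ⟨_, rfl, e, he, rfl⟩ _ rfl i j
    exact j.elim0
  smooth_symm := by
    rintro _ rfl _ ⟨_, rfl, e, he, rfl⟩ j i
    exact j.elim0

def BundleIso.sumCongr {E E' F F' : HermBundle X} (φ : BundleIso E E') (ψ : BundleIso F F') :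
    BundleIso (E.sum F) (E'.sum F') where
  equiv x := (sumLin _ _).trans (((φ.equiv x).prodCongr (ψ.equiv x)).trans (sumLin _ _).symm)
  smooth := by
    rintro _ ⟨e, he, f, hf, rfl⟩ _ ⟨e', he', f', hf', rfl⟩ (i | i) (j | j)
    · simpa using (φ.smooth e he e' he' i j).mono fun x hx => ⟨hx.1.1, hx.2.1⟩
    · simpa using smoothFunOn_const (0 : ℂ) _
    · simpa using smoothFunOn_const (0 : ℂ) _
    · simpa using (ψ.smooth f hf f' hf' i j).mono fun x hx => ⟨hx.1.2, hx.2.2⟩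
  smooth_symm := by
    rintro _ ⟨e, he, f, hf, rfl⟩ _ ⟨e', he', f', hf', rfl⟩ (i | i) (j | j)
    · simpa using (φ.smooth_symm e he e' he' i j).mono fun x hx => ⟨hx.1.1, hx.2.1⟩
    · simpa using smoothFunOn_const (0 : ℂ) _
    · simpa using smoothFunOn_const (0 : ℂ) _
    · simpa using (ψ.smooth_symm f hf f' hf' i j).mono fun x hx => ⟨hx.1.2, hx.2.2⟩

def BundleIso.sumComm (E F : HermBundle X) : BundleIso (E.sum F) (F.sum E) where
  equiv x := (sumLin _ _).trans ((LinearEquiv.prodComm ℂ _ _).trans (sumLin _ _).symm)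
  smooth := by
    rintro _ ⟨e, he, f, hf, rfl⟩ _ ⟨f', hf', e', he', rfl⟩ (i | i) (j | j)
    · simpa using smoothFunOn_const (0 : ℂ) _
    · simpa using (E.smooth e' he' e he j i).mono fun x hx => ⟨hx.2.2, hx.1.1⟩
    · simpa using (F.smooth f' hf' f hf j i).mono fun x hx => ⟨hx.2.1, hx.1.2⟩
    · simpa using smoothFunOn_const (0 : ℂ) _
  smooth_symm := by
    rintro _ ⟨f, hf, e, he, rfl⟩ _ ⟨e', he', f', hf', rfl⟩ (i | i) (j | j)
    · simpa using smoothFunOn_const (0 : ℂ) _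
    · simpa using (F.smooth f' hf' f hf j i).mono fun x hx => ⟨hx.2.2, hx.1.1⟩
    · simpa using (E.smooth e' he' e he j i).mono fun x hx => ⟨hx.2.1, hx.1.2⟩
    · simpa using smoothFunOn_const (0 : ℂ) _

def BundleIso.sumAssoc (E F G : HermBundle X) :
    BundleIso ((E.sum F).sum G) (E.sum (F.sum G)) where
  equiv x := (sumLin _ _).trans (((sumLin _ _).prodCongr (LinearEquiv.refl ℂ _)).trans
    ((LinearEquiv.prodAssoc ℂ _ _ _).trans
      (((LinearEquiv.refl ℂ _).prodCongr (sumLin _ _).symm).trans (sumLin _ _).symm)))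
  smooth := by
    rintro _ ⟨_, ⟨e, he, f, hf, rfl⟩, g, hg, rfl⟩ _ ⟨e', he', _, ⟨f', hf', g', hg', rfl⟩, rfl⟩
      ((i | i) | i) (j | (j | j))
    · simpa using (E.smooth e' he' e he j i).mono fun x hx => ⟨hx.2.1, hx.1.1.1⟩
    · simpa using smoothFunOn_const (0 : ℂ) _
    · simpa using smoothFunOn_const (0 : ℂ) _
    · simpa using smoothFunOn_const (0 : ℂ) _
    · simpa using (F.smooth f' hf' f hf j i).mono fun x hx => ⟨hx.2.2.1, hx.1.1.2⟩
    · simpa using smoothFunOn_const (0 : ℂ) _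
    · simpa using smoothFunOn_const (0 : ℂ) _
    · simpa using smoothFunOn_const (0 : ℂ) _
    · simpa using (G.smooth g' hg' g hg j i).mono fun x hx => ⟨hx.2.2.2, hx.1.2⟩
  smooth_symm := by
    rintro _ ⟨e', he', _, ⟨f', hf', g', hg', rfl⟩, rfl⟩ _ ⟨_, ⟨e, he, f, hf, rfl⟩, g, hg, rfl⟩
      (j | (j | j)) ((i | i) | i)
    · simpa [prodAssoc_symm_mk, prodAssoc_symm_zero] using (E.smooth e he e' he' i j).mono fun x hx => ⟨hx.2.1.1, hx.1.1⟩
    · simpa [prodAssoc_symm_mk, prodAssoc_symm_zero] using smoothFunOn_const (0 : ℂ) _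
    · simpa [prodAssoc_symm_mk, prodAssoc_symm_zero] using smoothFunOn_const (0 : ℂ) _
    · simpa [prodAssoc_symm_mk, prodAssoc_symm_zero] using smoothFunOn_const (0 : ℂ) _
    · simpa [prodAssoc_symm_mk, prodAssoc_symm_zero] using (F.smooth f hf f' hf' i j).mono fun x hx => ⟨hx.2.1.2, hx.1.2.1⟩
    · simpa [prodAssoc_symm_mk, prodAssoc_symm_zero] using smoothFunOn_const (0 : ℂ) _
    · simpa [prodAssoc_symm_mk, prodAssoc_symm_zero] using smoothFunOn_const (0 : ℂ) _
    · simpa [prodAssoc_symm_mk, prodAssoc_symm_zero] using smoothFunOn_const (0 : ℂ) _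
    · simpa [prodAssoc_symm_mk, prodAssoc_symm_zero] using (G.smooth g hg g' hg' i j).mono fun x hx => ⟨hx.2.2, hx.1.2.2⟩

def BundleIso.zeroSum (E : HermBundle X) : BundleIso ((HermBundle.zero X).sum E) E where
  equiv x := (sumLin _ _).trans
    { LinearMap.snd ℂ (EuclideanSpace ℂ (Fin 0)) (E.fiber x) with
      invFun := fun v => (0, v)
      left_inv := fun v => Prod.ext (Subsingleton.elim _ _) rfl
      right_inv := fun _ => rfl }
  smooth := by
    rintro _ ⟨_, rfl, e, he, rfl⟩ e' he' (i | i) j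
    · exact i.elim0
    · exact (E.smooth e' he' e he j i).mono fun x hx => ⟨hx.2, hx.1.2⟩
  smooth_symm := by
    rintro e' he' _ ⟨_, rfl, e, he, rfl⟩ j (i | i)
    · exact i.elim0
    · refine SmoothFunOn.congr ((E.smooth e he e' he' i j).mono
        fun x hx => ⟨hx.2.2, hx.1⟩) fun x _ => ?_
      change ⟪WithLp.toLp 2 ((0 : EuclideanSpace ℂ (Fin 0)), e.vec i x),
        WithLp.toLp 2 ((0 : EuclideanSpace ℂ (Fin 0)), e'.vec j x)⟫_ℂ = _
      simp

def BundleIso.tensorSum (E F G : HermBundle X) :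
    BundleIso (E.tensor (F.sum G)) ((E.tensor F).sum (E.tensor G)) where
  equiv x := (TensorProduct.congr (LinearEquiv.refl ℂ _) (sumLin _ _)).trans
    ((TensorProduct.prodRight ℂ ℂ _ _ _).trans (sumLin _ _).symm)
  smooth := by
    rintro _ ⟨e, he, _, ⟨f, hf, g, hg, rfl⟩, rfl⟩
      _ ⟨_, ⟨e', he', f', hf', rfl⟩, _, ⟨e'', he'', g', hg', rfl⟩, rfl⟩ ⟨i, (j | j)⟩ (k | k)
    · refine SmoothFunOn.congr
        (((E.smooth e' he' e he k.1 i).mono fun x hx => ⟨hx.2.1.1, hx.1.1⟩).mul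
        ((F.smooth f' hf' f hf k.2 j).mono fun x hx => ⟨hx.2.1.2, hx.1.2.1⟩)) fun x _ => ?_
      simp
    · simpa using smoothFunOn_const (0 : ℂ) _
    · simpa using smoothFunOn_const (0 : ℂ) _
    · refine SmoothFunOn.congr
        (((E.smooth e'' he'' e he k.1 i).mono fun x hx => ⟨hx.2.2.1, hx.1.1⟩).mul
        ((G.smooth g' hg' g hg k.2 j).mono fun x hx => ⟨hx.2.2.2, hx.1.2.2⟩)) fun x _ => ?_
      simp
  smooth_symm := by
    rintro _ ⟨_, ⟨e', he', f', hf', rfl⟩, _, ⟨e'', he'', g', hg', rfl⟩, rfl⟩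
      _ ⟨e, he, _, ⟨f, hf, g, hg, rfl⟩, rfl⟩ (k | k) ⟨i, (j | j)⟩
    · refine SmoothFunOn.congr
        (((E.smooth e he e' he' i k.1).mono fun x hx => ⟨hx.2.1, hx.1.1.1⟩).mul
        ((F.smooth f hf f' hf' j k.2).mono fun x hx => ⟨hx.2.2.1, hx.1.1.2⟩)) fun x _ => ?_
      simp [prodRight_symm_left]
    · simpa [prodRight_symm_left] using smoothFunOn_const (0 : ℂ) _
    · simpa [prodRight_symm_right] using smoothFunOn_const (0 : ℂ) _
    · refine SmoothFunOn.congr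
        (((E.smooth e he e'' he'' i k.1).mono fun x hx => ⟨hx.2.1, hx.1.2.1⟩).mul
        ((G.smooth g hg g' hg' j k.2).mono fun x hx => ⟨hx.2.2.2, hx.1.2.2⟩)) fun x _ => ?_
      simp [prodRight_symm_right]

end BundleIsos

section GrothendieckRing
open Algebra (GrothendieckAddGroup)
open Algebra.GrothendieckAddGroup (of)

variable {R : Type*} [CommSemiring R]

theorem grothendieck_exists {A : Type*} [AddCommMonoid A] (x : GrothendieckAddGroup A) :
    ∃ a b : A, x = of a - of b := by
  induction x using AddLocalization.ind with
  | _ y =>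
    refine ⟨y.1, y.2, ?_⟩
    rw [AddLocalization.mk_eq_addMonoidOf_mk', sub_eq_add_neg, ← sub_eq_add_neg, eq_sub_iff_add_eq]
    exact (AddLocalization.addMonoidOf ⊤).mk'_spec _ _

theorem grothendieck_lift_of {A G : Type*} [AddCommMonoid A] [AddCommGroup G] (f : A →+ G)
    (a : A) : Algebra.GrothendieckAddGroup.lift f (of a) = f a :=
  DFunLike.congr_fun (Algebra.GrothendieckAddGroup.lift.symm_apply_apply f) a

theorem grothendieck_hom_ext {A G : Type*} [AddCommMonoid A] [AddCommGroup G]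
    {f g : GrothendieckAddGroup A →+ G} (h : ∀ a, f (of a) = g (of a)) : f = g :=
  Algebra.GrothendieckAddGroup.lift.symm.injective (AddMonoidHom.ext h)

/-- Multiplication on the Grothendieck group of a commutative semiring, extended biadditively. -/
def grothendieckMul :
    GrothendieckAddGroup R →+ GrothendieckAddGroup R →+ GrothendieckAddGroup R :=
  Algebra.GrothendieckAddGroup.lift
    { toFun := fun r =>
        Algebra.GrothendieckAddGroup.lift ((of (M := R)).comp (AddMonoidHom.mulLeft r))
      map_zero' := grothendieck_hom_ext fun s => by
        rw [grothendieck_lift_of]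
        simp only [AddMonoidHom.comp_apply, AddMonoidHom.coe_mulLeft, zero_mul,
          AddMonoidHom.zero_apply]
        exact map_zero of
      map_add' := fun r s => grothendieck_hom_ext fun t => by
        rw [AddMonoidHom.add_apply, grothendieck_lift_of, grothendieck_lift_of,
          grothendieck_lift_of]
        simp only [AddMonoidHom.comp_apply, AddMonoidHom.coe_mulLeft, add_mul]
        exact map_add of _ _ }

theorem grothendieckMul_of (r s : R) : grothendieckMul (of r) (of s) = of (r * s) := by
  rw [grothendieckMul, grothendieck_lift_of]
  exact grothendieck_lift_of _ s

/-- The Grothendieck ring of a commutative semiring. -/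
instance instGrothendieckCommRing : CommRing (GrothendieckAddGroup R) where
  __ := (inferInstance : AddCommGroup (GrothendieckAddGroup R))
  mul x y := grothendieckMul x y
  one := of 1
  zero_mul x := by
    change grothendieckMul 0 x = 0
    simp
  mul_zero x := by
    change grothendieckMul x 0 = 0
    simp
  left_distrib x y z := by
    change grothendieckMul x (y + z) = grothendieckMul x y + grothendieckMul x z
    simp
  right_distrib x y z := by
    change grothendieckMul (x + y) z = grothendieckMul x z + grothendieckMul y z
    simp
  one_mul x := by
    change grothendieckMul (of 1) x = x
    obtain ⟨a, b, rfl⟩ := grothendieck_exists x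
    simp only [map_sub, grothendieckMul_of, one_mul]
  mul_one x := by
    change grothendieckMul x (of 1) = x
    obtain ⟨a, b, rfl⟩ := grothendieck_exists x
    simp only [map_sub, AddMonoidHom.sub_apply, grothendieckMul_of, mul_one]
  mul_comm x y := by
    change grothendieckMul x y = grothendieckMul y x
    obtain ⟨a, b, rfl⟩ := grothendieck_exists x
    obtain ⟨c, d, rfl⟩ := grothendieck_exists y
    simp only [map_sub, AddMonoidHom.sub_apply, grothendieckMul_of, mul_comm]
    abel
  mul_assoc x y z := by
    change grothendieckMul (grothendieckMul x y) z = grothendieckMul x (grothendieckMul y z)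
    obtain ⟨a, b, rfl⟩ := grothendieck_exists x
    obtain ⟨c, d, rfl⟩ := grothendieck_exists y
    obtain ⟨e, f, rfl⟩ := grothendieck_exists z
    simp only [map_sub, AddMonoidHom.sub_apply, grothendieckMul_of, mul_assoc]

theorem of_mul_of (r s : R) : (of r * of s : GrothendieckAddGroup R) = of (r * s) :=
  grothendieckMul_of r s

end GrothendieckRing

section KTheory
variable (X : Type*) [DiffeologicalSpace X]

instance bundleSetoid : Setoid (HermBundle X) where
  r E F := Nonempty (BundleIso E F)
  iseqv := ⟨fun E => ⟨.refl E⟩, fun ⟨φ⟩ => ⟨φ.symm⟩, fun ⟨φ⟩ ⟨ψ⟩ => ⟨φ.trans ψ⟩⟩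

/-- Isomorphism classes of vector bundles. -/
def Bun := Quotient (bundleSetoid X)

instance : Zero (Bun X) := ⟨Quotient.mk _ (HermBundle.zero X)⟩
instance : One (Bun X) := ⟨Quotient.mk _ (HermBundle.one X)⟩
instance : Add (Bun X) :=
  ⟨Quotient.map₂ HermBundle.sum fun _ _ ⟨φ⟩ _ _ ⟨ψ⟩ => ⟨.sumCongr φ ψ⟩⟩
instance : Mul (Bun X) :=
  ⟨Quotient.map₂ HermBundle.tensor fun _ _ ⟨φ⟩ _ _ ⟨ψ⟩ => ⟨.tensorCongr φ ψ⟩⟩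

/-- `Bun(X)` is a semiring under direct sum and tensor product. -/
instance instBunCommSemiring : CommSemiring (Bun X) where
  nsmul := nsmulRec
  add_assoc := by
    rintro ⟨E⟩ ⟨F⟩ ⟨G⟩
    exact Quotient.sound ⟨.sumAssoc E F G⟩
  zero_add := by
    rintro ⟨E⟩
    exact Quotient.sound ⟨.zeroSum E⟩
  add_zero := by
    rintro ⟨E⟩
    exact Quotient.sound ⟨(BundleIso.sumComm E _).trans (.zeroSum E)⟩
  add_comm := by
    rintro ⟨E⟩ ⟨F⟩
    exact Quotient.sound ⟨.sumComm E F⟩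
  mul_assoc := by
    rintro ⟨E⟩ ⟨F⟩ ⟨G⟩
    exact Quotient.sound ⟨.tensorAssoc E F G⟩
  one_mul := by
    rintro ⟨E⟩
    exact Quotient.sound ⟨.oneTensor E⟩
  mul_one := by
    rintro ⟨E⟩
    exact Quotient.sound ⟨(BundleIso.tensorComm E _).trans (.oneTensor E)⟩
  mul_comm := by
    rintro ⟨E⟩ ⟨F⟩
    exact Quotient.sound ⟨.tensorComm E F⟩
  zero_mul := by
    rintro ⟨E⟩
    exact Quotient.sound ⟨.zeroTensor E⟩
  mul_zero := by
    rintro ⟨E⟩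
    exact Quotient.sound ⟨(BundleIso.tensorComm E _).trans (.zeroTensor E)⟩
  left_distrib := by
    rintro ⟨E⟩ ⟨F⟩ ⟨G⟩
    exact Quotient.sound ⟨.tensorSum E F G⟩
  right_distrib := by
    rintro ⟨E⟩ ⟨F⟩ ⟨G⟩
    exact Quotient.sound ⟨(BundleIso.tensorComm _ G).trans ((BundleIso.tensorSum G E F).trans
      (.sumCongr (.tensorComm G E) (.tensorComm G F)))⟩

/-- The ring `K(X)`: the Grothendieck ring of the semiring of vector bundles. -/
abbrev KBun := Algebra.GrothendieckAddGroup (Bun X)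

variable {X} in
/-- The class `[F] ∈ K(X)` of a vector bundle. -/
def HermBundle.toK (F : HermBundle X) : KBun X :=
  Algebra.GrothendieckAddGroup.of (Quotient.mk _ F : Bun X)

end KTheory

section TensorInner
variable {V V' V'' W W' W'' : Type}
  [NormedAddCommGroup V] [InnerProductSpace ℂ V] [NormedAddCommGroup V'] [InnerProductSpace ℂ V']
  [NormedAddCommGroup V''] [InnerProductSpace ℂ V'']
  [NormedAddCommGroup W] [InnerProductSpace ℂ W] [NormedAddCommGroup W'] [InnerProductSpace ℂ W']
  [NormedAddCommGroup W''] [InnerProductSpace ℂ W'']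

/-- A bilinear map that preserves inner products, i.e. whose linearisation `V ⊗ V' → V''` is
isometric. -/
def IsIsometricBilin (β : V →ₗ[ℂ] V' →ₗ[ℂ] V'') : Prop :=
  ∀ a b a' b', ⟪β a b, β a' b'⟫_ℂ = ⟪a, a'⟫_ℂ * ⟪b, b'⟫_ℂ

theorem IsIsometricBilin.map₂ {β : V →ₗ[ℂ] V' →ₗ[ℂ] V''} {γ : W →ₗ[ℂ] W' →ₗ[ℂ] W''}
    (hβ : IsIsometricBilin β) (hγ : IsIsometricBilin γ) :
    IsIsometricBilin (TensorProduct.map₂ β γ) := by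
  intro a b a' b'
  induction a with
  | zero => simp
  | add x y hx hy => simp only [map_add, LinearMap.add_apply, inner_add_left, hx, hy, add_mul]
  | tmul v w =>
  induction b with
  | zero => simp
  | add x y hx hy => simp only [map_add, inner_add_left, hx, hy, mul_add]
  | tmul v₁ w₁ =>
  induction a' with
  | zero => simp
  | add x y hx hy =>
    simp only [map_add, LinearMap.add_apply, inner_add_right, hx, hy, add_mul]
  | tmul v₂ w₂ =>
  induction b' with
  | zero => simp
  | add x y hx hy => simp only [map_add, inner_add_right, hx, hy, mul_add]
  | tmul v₃ w₃ =>
    simp only [TensorProduct.map₂_apply_tmul, TensorProduct.map_tmul, TensorProduct.inner_tmul, hβ v v₁ v₂ v₃,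
      hγ w w₁ w₂ w₃]
    ring

theorem map₂_assoc {V₁₂ V₂₃ V₃₄ V₁₃ V₂₄ V₁₄ W₁₂ W₂₃ W₃₄ W₁₃ W₂₄ W₁₄ : Type}
    [AddCommGroup V₁₂] [Module ℂ V₁₂] [AddCommGroup V₂₃] [Module ℂ V₂₃]
    [AddCommGroup V₃₄] [Module ℂ V₃₄] [AddCommGroup V₁₃] [Module ℂ V₁₃]
    [AddCommGroup V₂₄] [Module ℂ V₂₄] [AddCommGroup V₁₄] [Module ℂ V₁₄]
    [AddCommGroup W₁₂] [Module ℂ W₁₂] [AddCommGroup W₂₃] [Module ℂ W₂₃]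
    [AddCommGroup W₃₄] [Module ℂ W₃₄] [AddCommGroup W₁₃] [Module ℂ W₁₃]
    [AddCommGroup W₂₄] [Module ℂ W₂₄] [AddCommGroup W₁₄] [Module ℂ W₁₄]
    (β₁ : V₁₂ →ₗ[ℂ] V₂₃ →ₗ[ℂ] V₁₃) (β₂ : V₁₃ →ₗ[ℂ] V₃₄ →ₗ[ℂ] V₁₄)
    (β₃ : V₂₃ →ₗ[ℂ] V₃₄ →ₗ[ℂ] V₂₄) (β₄ : V₁₂ →ₗ[ℂ] V₂₄ →ₗ[ℂ] V₁₄)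
    (γ₁ : W₁₂ →ₗ[ℂ] W₂₃ →ₗ[ℂ] W₁₃) (γ₂ : W₁₃ →ₗ[ℂ] W₃₄ →ₗ[ℂ] W₁₄)
    (γ₃ : W₂₃ →ₗ[ℂ] W₃₄ →ₗ[ℂ] W₂₄) (γ₄ : W₁₂ →ₗ[ℂ] W₂₄ →ₗ[ℂ] W₁₄)
    (hβ : ∀ a b c, β₂ (β₁ a b) c = β₄ a (β₃ b c)) (hγ : ∀ a b c, γ₂ (γ₁ a b) c = γ₄ a (γ₃ b c))
    (a : V₁₂ ⊗[ℂ] W₁₂) (b : V₂₃ ⊗[ℂ] W₂₃) (c : V₃₄ ⊗[ℂ] W₃₄) :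
    TensorProduct.map₂ β₂ γ₂ (TensorProduct.map₂ β₁ γ₁ a b) c =
      TensorProduct.map₂ β₄ γ₄ a (TensorProduct.map₂ β₃ γ₃ b c) := by
  induction a with
  | zero => simp
  | add x y hx hy => simp only [map_add, LinearMap.add_apply, hx, hy]
  | tmul a a' =>
  induction b with
  | zero => simp
  | add x y hx hy => simp only [map_add, LinearMap.add_apply, hx, hy]
  | tmul b b' =>
  induction c with
  | zero => simp
  | add x y hx hy => simp only [map_add, hx, hy]
  | tmul c c' => simp only [TensorProduct.map₂_apply_tmul, TensorProduct.map_tmul, hβ, hγ]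

end TensorInner


section FibreProducts
variable {M Y Z : Type*} [DiffeologicalSpace Y] [DiffeologicalSpace Z]

/-- The fibre product `Y ×_M Z`. -/
abbrev FibProd (π : Y → M) (ρ : Z → M) := {q : Y × Z // π q.1 = ρ q.2}

/-- The fibre product `Y^{[2]}`. -/
abbrev Fib2 (π : Y → M) := FibProd π π

/-- The fibre product `Y^{[3]}`. -/
abbrev Fib3 (π : Y → M) := {q : Y × Y × Y // π q.1 = π q.2.1 ∧ π q.2.1 = π q.2.2}

/-- The point `(y₁, y₂)` of `Y^{[2]}`. -/
abbrev pair {π : Y → M} {y₁ y₂ : Y} (h : π y₁ = π y₂) : Fib2 π := ⟨(y₁, y₂), h⟩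

variable (π : Y → M) (ρ : Z → M)

abbrev FibProd.fst : FibProd π ρ → Y := fun q => q.1.1
abbrev FibProd.snd : FibProd π ρ → Z := fun q => q.1.2
abbrev Fib3.p₁₂ : Fib3 π → Fib2 π := fun q => pair q.2.1
abbrev Fib3.p₂₃ : Fib3 π → Fib2 π := fun q => pair q.2.2
abbrev Fib3.p₁₃ : Fib3 π → Fib2 π := fun q => pair (q.2.1.trans q.2.2)

theorem FibProd.dSmooth_fst : DSmooth (FibProd.fst π ρ) := fun _ _ hp => hp.1
theorem FibProd.dSmooth_snd : DSmooth (FibProd.snd π ρ) := fun _ _ hp => hp.2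
theorem Fib3.dSmooth_p₁₂ : DSmooth (Fib3.p₁₂ π) := fun _ _ hp => ⟨hp.1, hp.2.1⟩
theorem Fib3.dSmooth_p₂₃ : DSmooth (Fib3.p₂₃ π) := fun _ _ hp => ⟨hp.2.1, hp.2.2⟩
theorem Fib3.dSmooth_p₁₃ : DSmooth (Fib3.p₁₃ π) := fun _ _ hp => ⟨hp.1, hp.2.2⟩

/-- The two projections of `(Y ×_M Z)^{[2]}`. -/
abbrev FibProd.fst₂ : Fib2 (fun q : FibProd π ρ => π q.1.1) → Fib2 π :=
  fun q => pair (y₁ := q.1.1.1.1) (y₂ := q.1.2.1.1) q.2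
abbrev FibProd.snd₂ : Fib2 (fun q : FibProd π ρ => π q.1.1) → Fib2 ρ :=
  fun q => pair (q.1.1.2.symm.trans (q.2.trans q.1.2.2))

theorem FibProd.dSmooth_fst₂ : DSmooth (FibProd.fst₂ π ρ) := fun _ _ hp => ⟨hp.1.1, hp.2.1⟩
theorem FibProd.dSmooth_snd₂ : DSmooth (FibProd.snd₂ π ρ) := fun _ _ hp => ⟨hp.1.2, hp.2.2⟩

end FibreProducts

/-- A (hermitian) bundle gerbe over `M`: a smooth locally split map `π : Y → M` and a hermitian
line bundle `L → Y^{[2]}` with a smooth associative product, given by hermitian isomorphisms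
`L_{(y₁,y₂)} ⊗ L_{(y₂,y₃)} → L_{(y₁,y₃)}`.  (The fibres being lines, a bilinear map that
preserves inner products is the same as such an isomorphism.) -/
structure BundleGerbe (M : Type u) [DiffeologicalSpace M] where
  Y : Type v
  [diffeology : DiffeologicalSpace Y]
  π : Y → M
  smooth_π : DSmooth π
  locally_split : ∀ m, ∃ U : Set M, IsOpen[dTopology] U ∧ m ∈ U ∧
    ∃ s : U → Y, DSmooth s ∧ ∀ x, π (s x) = x
  L : HermBundle (Fib2 π)
  rank_one : ∀ q, Module.finrank ℂ (L.fiber q) = 1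
  mul : ∀ {y₁ y₂ y₃ : Y} (h : π y₁ = π y₂) (k : π y₂ = π y₃),
    L.fiber (pair h) →ₗ[ℂ] L.fiber (pair k) →ₗ[ℂ] L.fiber (pair (h.trans k))
  isometric_mul : ∀ {y₁ y₂ y₃ : Y} (h : π y₁ = π y₂) (k : π y₂ = π y₃),
    IsIsometricBilin (mul h k)
  smooth_mul : IsSmoothBilin (L.pullback (Fib3.p₁₂ π) (Fib3.dSmooth_p₁₂ π))
    (L.pullback (Fib3.p₂₃ π) (Fib3.dSmooth_p₂₃ π))
    (L.pullback (Fib3.p₁₃ π) (Fib3.dSmooth_p₁₃ π)) fun q => mul q.2.1 q.2.2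
  mul_assoc : ∀ {y₁ y₂ y₃ y₄ : Y} (h : π y₁ = π y₂) (k : π y₂ = π y₃) (l : π y₃ = π y₄)
    (a : L.fiber (pair h)) (b : L.fiber (pair k)) (c : L.fiber (pair l)),
    mul (h.trans k) l (mul h k a b) c = mul h (k.trans l) a (mul k l b c)

attribute [instance] BundleGerbe.diffeology

namespace BundleGerbe
variable {M : Type u} [DiffeologicalSpace M] {N : Type w} [DiffeologicalSpace N]

/-- The product induced on the duals of the fibres of `L`. -/
def dualMul (G : BundleGerbe.{u, v} M) {y₁ y₂ y₃ : G.Y} (h : G.π y₁ = G.π y₂)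
    (k : G.π y₂ = G.π y₃) :
    StrongDual ℂ (G.L.fiber (pair h)) →ₗ[ℂ] StrongDual ℂ (G.L.fiber (pair k)) →ₗ[ℂ]
      StrongDual ℂ (G.L.fiber (pair (h.trans k))) :=
  LinearMap.mk₂ ℂ
    (fun f g => InnerProductSpace.toDual ℂ _ (G.mul h k ((InnerProductSpace.toDual ℂ _).symm f)
      ((InnerProductSpace.toDual ℂ _).symm g)))
    (fun f f' g => by simp only [map_add, LinearMap.add_apply])
    (fun c f g => by
      rw [map_smulₛₗ, map_smul, LinearMap.smul_apply, map_smulₛₗ]; simp)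
    (fun f g g' => by simp only [map_add])
    (fun c f g => by
      rw [map_smulₛₗ, map_smul, map_smulₛₗ]; simp)

theorem dualMul_toDual (G : BundleGerbe.{u, v} M) {y₁ y₂ y₃ : G.Y} (h : G.π y₁ = G.π y₂)
    (k : G.π y₂ = G.π y₃) (a : G.L.fiber (pair h)) (b : G.L.fiber (pair k)) :
    G.dualMul h k (InnerProductSpace.toDual ℂ _ a) (InnerProductSpace.toDual ℂ _ b) =
      InnerProductSpace.toDual ℂ _ (G.mul h k a b) := by
  simp [dualMul]

/-- The product on `L*` is the one dual to the product on `L`. -/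
theorem dualMul_apply_mul (G : BundleGerbe.{u, v} M) {y₁ y₂ y₃ : G.Y} (h : G.π y₁ = G.π y₂)
    (k : G.π y₂ = G.π y₃) (f : StrongDual ℂ (G.L.fiber (pair h)))
    (g : StrongDual ℂ (G.L.fiber (pair k))) (a : G.L.fiber (pair h)) (b : G.L.fiber (pair k)) :
    G.dualMul h k f g (G.mul h k a b) = f a * g b := by
  obtain ⟨f, rfl⟩ := (InnerProductSpace.toDual ℂ _).surjective f
  obtain ⟨g, rfl⟩ := (InnerProductSpace.toDual ℂ _).surjective g
  rw [dualMul_toDual, InnerProductSpace.toDual_apply_apply, G.isometric_mul,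
    InnerProductSpace.toDual_apply_apply, InnerProductSpace.toDual_apply_apply]

/-- The dual bundle gerbe `(L*, Y)`. -/
@[reducible]
def dual (G : BundleGerbe.{u, v} M) : BundleGerbe.{u, v} M where
  Y := G.Y
  π := G.π
  smooth_π := G.smooth_π
  locally_split := G.locally_split
  L := G.L.dual
  rank_one q := by
    rw [← G.rank_one q]
    exact (LinearMap.toContinuousLinearMap (𝕜 := ℂ) (E := G.L.fiber q)
      (F' := ℂ)).finrank_eq.symm.trans Subspace.dual_finrank_eq
  mul h k := G.dualMul h k
  isometric_mul h k f g f' g' := by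
    obtain ⟨f, rfl⟩ := (InnerProductSpace.toDual ℂ _).surjective f
    obtain ⟨g, rfl⟩ := (InnerProductSpace.toDual ℂ _).surjective g
    obtain ⟨f', rfl⟩ := (InnerProductSpace.toDual ℂ _).surjective f'
    obtain ⟨g', rfl⟩ := (InnerProductSpace.toDual ℂ _).surjective g'
    simp only [dualMul_toDual, dual_inner_toDual]
    exact G.isometric_mul h k _ _ _ _
  smooth_mul := by
    rintro _ ⟨_, ⟨e, he, rfl⟩, rfl⟩ _ ⟨_, ⟨f, hf, rfl⟩, rfl⟩ _ ⟨_, ⟨g, hg, rfl⟩, rfl⟩ i j k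
    refine SmoothFunOn.congr (G.smooth_mul _ ⟨e, he, rfl⟩ _ ⟨f, hf, rfl⟩ _ ⟨g, hg, rfl⟩
      i j k).star fun q _ => ?_
    rw [dualMul_toDual, dual_inner_toDual, inner_conj_symm]
  mul_assoc h k l f g f' := by
    obtain ⟨f, rfl⟩ := (InnerProductSpace.toDual ℂ _).surjective f
    obtain ⟨g, rfl⟩ := (InnerProductSpace.toDual ℂ _).surjective g
    obtain ⟨f', rfl⟩ := (InnerProductSpace.toDual ℂ _).surjective f'
    simp only [dualMul_toDual, G.mul_assoc]

set_option maxHeartbeats 1000000 in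
/-- The product bundle gerbe `(L ⊗ J, Y ×_M Z)`. -/
@[reducible]
def tensor (G : BundleGerbe.{u, v} M) (H : BundleGerbe.{u, w} M) :
    BundleGerbe.{u, max v w} M where
  Y := FibProd G.π H.π
  π q := G.π q.1.1
  smooth_π := G.smooth_π.comp (FibProd.dSmooth_fst _ _)
  locally_split m := by
    obtain ⟨U, hU, hm, s, hs, hs'⟩ := G.locally_split m
    obtain ⟨V, hV, hm', t, ht, ht'⟩ := H.locally_split m
    refine ⟨U ∩ V, @IsOpen.inter _ dTopology _ _ hU hV, ⟨hm, hm'⟩,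
      fun x => ⟨(s ⟨x, x.2.1⟩, t ⟨x, x.2.2⟩), (hs' ⟨x, x.2.1⟩).trans (ht' ⟨x, x.2.2⟩).symm⟩, ?_,
      fun x => hs' ⟨x, x.2.1⟩⟩
    exact fun n p hp =>
      ⟨hs n (fun t => ⟨p t, (p t).2.1⟩) hp, ht n (fun t => ⟨p t, (p t).2.2⟩) hp⟩
  L := (G.L.pullback (FibProd.fst₂ G.π H.π) (FibProd.dSmooth_fst₂ _ _)).tensor
    (H.L.pullback (FibProd.snd₂ G.π H.π) (FibProd.dSmooth_snd₂ _ _))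
  rank_one q := by
    rw [Module.finrank_tensorProduct]
    exact (congrArg₂ (· * ·) (G.rank_one _) (H.rank_one _)).trans (mul_one 1)
  mul h k := TensorProduct.map₂ (G.mul h k) (H.mul _ _)
  isometric_mul h k := (G.isometric_mul h k).map₂ (H.isometric_mul _ _)
  smooth_mul := by
    rintro _ ⟨_, ⟨_, ⟨e, he, rfl⟩, _, ⟨e', he', rfl⟩, rfl⟩, rfl⟩
      _ ⟨_, ⟨_, ⟨f, hf, rfl⟩, _, ⟨f', hf', rfl⟩, rfl⟩, rfl⟩
      _ ⟨_, ⟨_, ⟨g, hg, rfl⟩, _, ⟨g', hg', rfl⟩, rfl⟩, rfl⟩ i j k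
    have h₁ := (G.smooth_mul _ ⟨e, he, rfl⟩ _ ⟨f, hf, rfl⟩ _ ⟨g, hg, rfl⟩ i.1 j.1 k.1).comp
      (X := Fib3 fun q : FibProd G.π H.π => G.π q.1.1)
      (g := fun q => ⟨(q.1.1.1.1, q.1.2.1.1.1, q.1.2.2.1.1), q.2.1, q.2.2⟩)
      (fun _ _ hp => ⟨hp.1.1, hp.2.1.1, hp.2.2.1⟩)
    have h₂ := (H.smooth_mul _ ⟨e', he', rfl⟩ _ ⟨f', hf', rfl⟩ _ ⟨g', hg', rfl⟩ i.2 j.2 k.2).comp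
      (X := Fib3 fun q : FibProd G.π H.π => G.π q.1.1)
      (g := fun q => ⟨(q.1.1.1.2, q.1.2.1.1.2, q.1.2.2.1.2),
        q.1.1.2.symm.trans (q.2.1.trans q.1.2.1.2), q.1.2.1.2.symm.trans (q.2.2.trans q.1.2.2.2)⟩)
      (fun _ _ hp => ⟨hp.1.2, hp.2.1.2, hp.2.2.2⟩)
    refine SmoothFunOn.congr ((h₁.mono ?_).mul (h₂.mono ?_)) fun q _ => ?_
    · exact fun q hq => ⟨⟨hq.1.1.1, hq.1.2.1⟩, hq.2.1⟩
    · exact fun q hq => ⟨⟨hq.1.1.2, hq.1.2.2⟩, hq.2.2⟩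
    · rw [TensorProduct.map₂_apply_tmul, TensorProduct.map_tmul, TensorProduct.inner_tmul]
  mul_assoc h k l := map₂_assoc (G.mul h k) (G.mul (h.trans k) l) (G.mul k l)
    (G.mul h (k.trans l)) (H.mul _ _) (H.mul _ _) (H.mul _ _) (H.mul _ _)
    (G.mul_assoc h k l) (H.mul_assoc _ _ _)

/-- The pull-back `(f⁻¹(L), f⁻¹(Y))` of a bundle gerbe along a map `f : N → M`. -/
@[reducible]
def pullback (G : BundleGerbe.{u, v} M) (f : N → M) (hf : DSmooth f) :
    BundleGerbe.{w, max w v} N where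
  Y := FibProd f G.π
  π q := q.1.1
  smooth_π := FibProd.dSmooth_fst _ _
  locally_split x := by
    obtain ⟨U, hU, hm, s, hs, hs'⟩ := G.locally_split (f x)
    refine ⟨f ⁻¹' U, isOpen_preimage hf hU, hm,
      fun x => ⟨(x, s ⟨f x, x.2⟩), (hs' ⟨f x, x.2⟩).symm⟩, ?_, fun x => rfl⟩
    exact fun n p hp => ⟨hp, hs n (fun t => ⟨f (p t), (p t).2⟩) (hf n _ hp)⟩
  L := G.L.pullback (fun q => pair (q.1.1.2.symm.trans ((congrArg f q.2).trans q.1.2.2)))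
    fun _ _ hp => ⟨hp.1.2, hp.2.2⟩
  rank_one q := G.rank_one _
  mul h k := G.mul _ _
  isometric_mul h k := G.isometric_mul _ _
  smooth_mul := by
    rintro _ ⟨_, ⟨e, he, rfl⟩, rfl⟩ _ ⟨_, ⟨e', he', rfl⟩, rfl⟩ _ ⟨_, ⟨g, hg, rfl⟩, rfl⟩ i j k
    exact (G.smooth_mul _ ⟨e, he, rfl⟩ _ ⟨e', he', rfl⟩ _ ⟨g, hg, rfl⟩ i j k).comp
      (X := Fib3 fun q : FibProd f G.π => q.1.1)
      (g := fun q => ⟨(q.1.1.1.2, q.1.2.1.1.2, q.1.2.2.1.2),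
        q.1.1.2.symm.trans ((congrArg f q.2.1).trans q.1.2.1.2),
        q.1.2.1.2.symm.trans ((congrArg f q.2.2).trans q.1.2.2.2)⟩)
      (fun _ _ hp => ⟨hp.1.2, hp.2.1.2, hp.2.2.2⟩)
  mul_assoc h k l a b c := G.mul_assoc _ _ _ a b c

end BundleGerbe

/-- Transport of a fibre along an equality of base points. -/
def HermBundle.cast {X : Type*} [DiffeologicalSpace X] (F : HermBundle X) {x y : X} (h : x = y) :
    F.fiber x ≃ₗᵢ[ℂ] F.fiber y :=
  h ▸ LinearIsometryEquiv.refl ℂ (F.fiber x)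

@[simp] theorem HermBundle.cast_rfl {X : Type*} [DiffeologicalSpace X] (F : HermBundle X) {x : X}
    (v : F.fiber x) : F.cast rfl v = v := rfl

theorem HermBundle.cast_vec {X : Type*} [DiffeologicalSpace X] (F : HermBundle X) {x y : X}
    (h : x = y) (e : Frame F.fiber) (i : e.ι) : F.cast h (e.vec i x) = e.vec i y := by
  subst h; rfl

theorem HermBundle.cast_cast {X : Type*} [DiffeologicalSpace X] (F : HermBundle X) {x y z : X}
    (h : x = y) (k : y = z) (v : F.fiber x) : F.cast k (F.cast h v) = F.cast (h.trans k) v := by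
  subst h; rfl

theorem BundleIso.cast_equiv {X : Type*} [DiffeologicalSpace X] {F F' : HermBundle X}
    (φ : BundleIso F F') {x y : X} (h : x = y) (v : F.fiber x) :
    F'.cast h (φ.equiv x v) = φ.equiv y (F.cast h v) := by
  subst h; rfl

/-- A module for the bundle gerbe `(L, Y)`: a hermitian vector bundle `E → Y` with a smooth
hermitian action `L_{(y₁,y₂)} ⊗ E_{y₂} → E_{y₁}` compatible with the product of `L`.  (Such an
isometric map is automatically an isomorphism, since `L_{(y₂,y₁)}` acts in the other direction.) -/
structure GerbeModule {M : Type u} [DiffeologicalSpace M] (G : BundleGerbe.{u, v} M) where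
  E : HermBundle G.Y
  act : ∀ {y₁ y₂ : G.Y} (h : G.π y₁ = G.π y₂),
    G.L.fiber (pair h) →ₗ[ℂ] E.fiber y₂ →ₗ[ℂ] E.fiber y₁
  isometric_act : ∀ {y₁ y₂ : G.Y} (h : G.π y₁ = G.π y₂), IsIsometricBilin (act h)
  smooth_act : IsSmoothBilin G.L (E.pullback (FibProd.snd G.π G.π) (FibProd.dSmooth_snd _ _))
    (E.pullback (FibProd.fst G.π G.π) (FibProd.dSmooth_fst _ _)) fun q => act q.2
  mul_act : ∀ {y₁ y₂ y₃ : G.Y} (h : G.π y₁ = G.π y₂) (k : G.π y₂ = G.π y₃)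
    (a : G.L.fiber (pair h)) (b : G.L.fiber (pair k)) (v : E.fiber y₃),
    act (h.trans k) (G.mul h k a b) v = act h a (act k b v)

/-- An isomorphism of bundle gerbe modules: an isomorphism of vector bundles that preserves the
action of the bundle gerbe. -/
structure ModuleIso {M : Type u} [DiffeologicalSpace M] {G : BundleGerbe.{u, v} M}
    (E F : GerbeModule G) extends BundleIso E.E F.E where
  map_act : ∀ {y₁ y₂ : G.Y} (h : G.π y₁ = G.π y₂) (a : G.L.fiber (pair h)) (v : E.E.fiber y₂),
    equiv y₁ (E.act h a v) = F.act h a (equiv y₂ v)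

section Modules
variable {M : Type u} [DiffeologicalSpace M] {G : BundleGerbe.{u, v} M}

def ModuleIso.refl (E : GerbeModule G) : ModuleIso E E :=
  { BundleIso.refl E.E with map_act := fun _ _ _ => rfl }

def ModuleIso.symm {E F : GerbeModule G} (φ : ModuleIso E F) : ModuleIso F E :=
  { BundleIso.symm φ.toBundleIso with
    map_act := fun {y₁ y₂} h a v => by
      change (φ.equiv y₁).symm _ = E.act h a ((φ.equiv y₂).symm v)
      rw [LinearEquiv.symm_apply_eq, φ.map_act, LinearEquiv.apply_symm_apply] }

def ModuleIso.trans {E F K : GerbeModule G} (φ : ModuleIso E F) (ψ : ModuleIso F K) :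
    ModuleIso E K :=
  { BundleIso.trans φ.toBundleIso ψ.toBundleIso with
    map_act := fun {y₁ y₂} h a v => by
      change ψ.equiv y₁ (φ.equiv y₁ _) = K.act h a (ψ.equiv y₂ (φ.equiv y₂ v))
      rw [φ.map_act, ψ.map_act] }

/-- The diagonal action on a direct sum. -/
def sumAct {A V V' W W' : Type} [AddCommGroup A] [Module ℂ A] [NormedAddCommGroup V]
    [InnerProductSpace ℂ V] [NormedAddCommGroup V'] [InnerProductSpace ℂ V']
    [NormedAddCommGroup W] [InnerProductSpace ℂ W] [NormedAddCommGroup W']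
    [InnerProductSpace ℂ W'] (β : A →ₗ[ℂ] V →ₗ[ℂ] V') (γ : A →ₗ[ℂ] W →ₗ[ℂ] W') :
    A →ₗ[ℂ] WithLp 2 (V × W) →ₗ[ℂ] WithLp 2 (V' × W') :=
  LinearMap.mk₂ ℂ (fun a v => WithLp.toLp 2 (β a v.fst, γ a v.snd))
    (fun a b v => by simp [← WithLp.toLp_add])
    (fun c a v => by simp [← WithLp.toLp_smul])
    (fun a v w => by simp [← WithLp.toLp_add])
    (fun c a v => by simp [← WithLp.toLp_smul])

@[simp] theorem sumAct_apply {A V V' W W' : Type} [AddCommGroup A] [Module ℂ A]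
    [NormedAddCommGroup V] [InnerProductSpace ℂ V] [NormedAddCommGroup V'] [InnerProductSpace ℂ V']
    [NormedAddCommGroup W] [InnerProductSpace ℂ W] [NormedAddCommGroup W']
    [InnerProductSpace ℂ W'] (β : A →ₗ[ℂ] V →ₗ[ℂ] V') (γ : A →ₗ[ℂ] W →ₗ[ℂ] W') (a : A)
    (v : WithLp 2 (V × W)) : sumAct β γ a v = WithLp.toLp 2 (β a v.fst, γ a v.snd) := rfl

/-- The action on a tensor product `U ⊗ V` induced by an action on the second factor. -/
def tensorAct {A U U' V V' : Type} [AddCommGroup A] [Module ℂ A] [AddCommGroup U] [Module ℂ U]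
    [AddCommGroup U'] [Module ℂ U'] [AddCommGroup V] [Module ℂ V] [AddCommGroup V'] [Module ℂ V']
    (c : U →ₗ[ℂ] U') (β : A →ₗ[ℂ] V →ₗ[ℂ] V') : A →ₗ[ℂ] U ⊗[ℂ] V →ₗ[ℂ] U' ⊗[ℂ] V' :=
  LinearMap.mk₂ ℂ (fun a x => TensorProduct.map c (β a) x)
    (fun a b x => by rw [map_add, TensorProduct.map_add_right, LinearMap.add_apply])
    (fun r a x => by rw [map_smul, TensorProduct.map_smul_right, LinearMap.smul_apply])
    (fun a x y => by rw [map_add])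
    (fun r a x => by rw [map_smul])

@[simp] theorem tensorAct_tmul {A U U' V V' : Type} [AddCommGroup A] [Module ℂ A] [AddCommGroup U]
    [Module ℂ U] [AddCommGroup U'] [Module ℂ U'] [AddCommGroup V] [Module ℂ V] [AddCommGroup V']
    [Module ℂ V'] (c : U →ₗ[ℂ] U') (β : A →ₗ[ℂ] V →ₗ[ℂ] V') (a : A) (u : U) (v : V) :
    tensorAct c β a (u ⊗ₜ v) = c u ⊗ₜ β a v := rfl

theorem tensorAct_isometric {A U U' V V' : Type} [NormedAddCommGroup A] [InnerProductSpace ℂ A]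
    [NormedAddCommGroup U] [InnerProductSpace ℂ U] [NormedAddCommGroup U'] [InnerProductSpace ℂ U']
    [NormedAddCommGroup V] [InnerProductSpace ℂ V] [NormedAddCommGroup V'] [InnerProductSpace ℂ V']
    (c : U →ₗᵢ[ℂ] U') (β : A →ₗ[ℂ] V →ₗ[ℂ] V') (hβ : IsIsometricBilin β) :
    IsIsometricBilin (tensorAct c.toLinearMap β) := by
  intro a x b y
  induction x with
  | zero => simp
  | add x x' hx hx' => simp only [map_add, inner_add_left, hx, hx', mul_add]
  | tmul u v =>
  induction y with
  | zero => simp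
  | add y y' hy hy' => simp only [map_add, inner_add_right, hy, hy', mul_add]
  | tmul u' v' =>
    simp only [tensorAct_tmul, TensorProduct.inner_tmul, LinearIsometry.coe_toLinearMap,
      LinearIsometry.inner_map_map, hβ a v b v']
    ring

theorem tensorAct_mul {A B C U U' U'' V V' V'' : Type} [AddCommGroup A] [Module ℂ A]
    [AddCommGroup B] [Module ℂ B] [AddCommGroup C] [Module ℂ C]
    [AddCommGroup U] [Module ℂ U] [AddCommGroup U'] [Module ℂ U'] [AddCommGroup U''] [Module ℂ U'']
    [AddCommGroup V] [Module ℂ V] [AddCommGroup V'] [Module ℂ V'] [AddCommGroup V''] [Module ℂ V'']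
    (μ : A →ₗ[ℂ] B →ₗ[ℂ] C) (c : U →ₗ[ℂ] U'') (c' : U →ₗ[ℂ] U') (c'' : U' →ₗ[ℂ] U'')
    (hc : ∀ u, c u = c'' (c' u)) (β : C →ₗ[ℂ] V →ₗ[ℂ] V'') (β' : B →ₗ[ℂ] V →ₗ[ℂ] V')
    (β'' : A →ₗ[ℂ] V' →ₗ[ℂ] V'') (hβ : ∀ a b v, β (μ a b) v = β'' a (β' b v))
    (a : A) (b : B) (x : U ⊗[ℂ] V) :
    tensorAct c β (μ a b) x = tensorAct c'' β'' a (tensorAct c' β' b x) := by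
  induction x with
  | zero => simp
  | add x x' hx hx' => simp only [map_add, hx, hx']
  | tmul u v => simp only [tensorAct_tmul, hc, hβ]

/-- The direct sum of two bundle gerbe modules. -/
@[reducible]
def GerbeModule.sum (E F : GerbeModule G) : GerbeModule G where
  E := E.E.sum F.E
  act h := sumAct (E.act h) (F.act h)
  isometric_act h a v b w := by
    simp [E.isometric_act h a _ b _, F.isometric_act h a _ b _, mul_add]
  smooth_act := by
    rintro l hl _ ⟨_, ⟨e, he, f, hf, rfl⟩, rfl⟩ _ ⟨_, ⟨e', he', f', hf', rfl⟩, rfl⟩ i (j | j)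
      (k | k)
    · refine SmoothFunOn.congr ((E.smooth_act l hl _ ⟨e, he, rfl⟩ _ ⟨e', he', rfl⟩ i j k).mono
        fun q hq => ⟨⟨hq.1.1, hq.1.2.1⟩, hq.2.1⟩) fun q _ => ?_
      simp
    · simpa using smoothFunOn_const (0 : ℂ) _
    · simpa using smoothFunOn_const (0 : ℂ) _
    · refine SmoothFunOn.congr ((F.smooth_act l hl _ ⟨f, hf, rfl⟩ _ ⟨f', hf', rfl⟩ i j k).mono
        fun q hq => ⟨⟨hq.1.1, hq.1.2.2⟩, hq.2.2⟩) fun q _ => ?_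
      simp
  mul_act h k a b v := by
    simp [E.mul_act, F.mul_act]

variable (G) in
/-- The zero module. -/
@[reducible]
def GerbeModule.zero : GerbeModule G where
  E := HermBundle.zero G.Y
  act h := 0
  isometric_act h a v b w := by
    rw [Subsingleton.elim v 0]
    simp
  smooth_act := by
    rintro l hl _ ⟨_, rfl, rfl⟩ _ ⟨_, rfl, rfl⟩ i j k
    exact j.elim0
  mul_act h k a b v := rfl

/-- The module `π⁻¹(F) ⊗ E`, for a vector bundle `F` on `M` and a bundle gerbe module `E`. -/
@[reducible]
def GerbeModule.tensorBundle (F : HermBundle M) (E : GerbeModule G) : GerbeModule G where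
  E := (F.pullback G.π G.smooth_π).tensor E.E
  act h := tensorAct (F.cast h.symm).toLinearIsometry.toLinearMap (E.act h)
  isometric_act h := tensorAct_isometric _ _ (E.isometric_act h)
  smooth_act := by
    rintro l hl _ ⟨_, ⟨_, ⟨e, he, rfl⟩, f, hf, rfl⟩, rfl⟩
      _ ⟨_, ⟨_, ⟨e', he', rfl⟩, f', hf', rfl⟩, rfl⟩ i j k
    have h₁ := (F.smooth e' he' e he k.1 j.1).comp
      (G.smooth_π.comp (FibProd.dSmooth_fst G.π G.π))
    have h₂ := E.smooth_act l hl _ ⟨f, hf, rfl⟩ _ ⟨f', hf', rfl⟩ i j.2 k.2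
    refine SmoothFunOn.congr ((h₁.mono ?_).mul (h₂.mono ?_)) fun q _ => ?_
    · intro q hq
      refine ⟨hq.2.1, ?_⟩
      have := hq.1.2.1
      change G.π (FibProd.snd G.π G.π q) ∈ e.dom at this
      rwa [← q.2] at this
    · exact fun q hq => ⟨⟨hq.1.1, hq.1.2.2⟩, hq.2.2⟩
    · rw [tensorAct_tmul, TensorProduct.inner_tmul]
      congr 2
      exact F.cast_vec q.2.symm e j.1
  mul_act h k := tensorAct_mul (G.mul h k) _ _ _
    (fun u => (F.cast_cast k.symm h.symm u).symm) _ _ _ (E.mul_act h k)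

/-- The pull-back of a bundle gerbe module. -/
@[reducible]
def GerbeModule.pullback {N : Type w} [DiffeologicalSpace N] (E : GerbeModule G) (f : N → M)
    (hf : DSmooth f) : GerbeModule (G.pullback f hf) where
  E := E.E.pullback (FibProd.snd f G.π) (FibProd.dSmooth_snd _ _)
  act h := E.act _
  isometric_act h := E.isometric_act _
  smooth_act := by
    rintro _ ⟨l, hl, rfl⟩ _ ⟨_, ⟨e, he, rfl⟩, rfl⟩ _ ⟨_, ⟨e', he', rfl⟩, rfl⟩ i j k
    exact (E.smooth_act l hl _ ⟨e, he, rfl⟩ _ ⟨e', he', rfl⟩ i j k).comp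
      (X := Fib2 fun q : FibProd f G.π => q.1.1)
      (g := fun q => pair (q.1.1.2.symm.trans ((congrArg f q.2).trans q.1.2.2)))
      (fun _ _ hp => ⟨hp.1.2, hp.2.2⟩)
  mul_act h k a b v := E.mul_act _ _ a b v

/-- The tensor product of a module for `(L, Y)` and a module for `(J, Z)`, a module for
`(L ⊗ J, Y ×_M Z)`. -/
@[reducible]
def GerbeModule.tensor {H : BundleGerbe.{u, w} M} (E : GerbeModule G) (F : GerbeModule H) :
    GerbeModule (G.tensor H) where
  E := (E.E.pullback (FibProd.fst G.π H.π) (FibProd.dSmooth_fst _ _)).tensor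
    (F.E.pullback (FibProd.snd G.π H.π) (FibProd.dSmooth_snd _ _))
  act h := TensorProduct.map₂ (E.act h) (F.act _)
  isometric_act h := (E.isometric_act h).map₂ (F.isometric_act _)
  smooth_act := by
    rintro _ ⟨_, ⟨l, hl, rfl⟩, _, ⟨l', hl', rfl⟩, rfl⟩
      _ ⟨_, ⟨_, ⟨e, he, rfl⟩, _, ⟨f, hf, rfl⟩, rfl⟩, rfl⟩
      _ ⟨_, ⟨_, ⟨e', he', rfl⟩, _, ⟨f', hf', rfl⟩, rfl⟩, rfl⟩ i j k
    have h₁ := (E.smooth_act l hl _ ⟨e, he, rfl⟩ _ ⟨e', he', rfl⟩ i.1 j.1 k.1).comp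
      (FibProd.dSmooth_fst₂ G.π H.π)
    have h₂ := (F.smooth_act l' hl' _ ⟨f, hf, rfl⟩ _ ⟨f', hf', rfl⟩ i.2 j.2 k.2).comp
      (FibProd.dSmooth_snd₂ G.π H.π)
    refine SmoothFunOn.congr ((h₁.mono ?_).mul (h₂.mono ?_)) fun q _ => ?_
    · exact fun q hq => ⟨⟨hq.1.1.1, hq.1.2.1⟩, hq.2.1⟩
    · exact fun q hq => ⟨⟨hq.1.1.2, hq.1.2.2⟩, hq.2.2⟩
    · rw [TensorProduct.map₂_apply_tmul, TensorProduct.map_tmul, TensorProduct.inner_tmul]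
  mul_act h k := map₂_assoc (G.mul h k) (E.act _) (E.act _) (E.act _)
    (H.mul _ _) (F.act _) (F.act _) (F.act _) (E.mul_act h k) (F.mul_act _ _)

end Modules

section GerbeKTheory
variable {M : Type u} [DiffeologicalSpace M] (G : BundleGerbe.{u, v} M)

instance moduleSetoid : Setoid (GerbeModule G) where
  r E F := Nonempty (ModuleIso E F)
  iseqv := ⟨fun E => ⟨.refl E⟩, fun ⟨φ⟩ => ⟨φ.symm⟩, fun ⟨φ⟩ ⟨ψ⟩ => ⟨φ.trans ψ⟩⟩

/-- Isomorphism classes of modules for a bundle gerbe. -/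
def BundleGerbe.Mod := Quotient (moduleSetoid G)

instance : Zero G.Mod := ⟨Quotient.mk _ (GerbeModule.zero G)⟩
instance : Add G.Mod :=
  ⟨Quotient.map₂ GerbeModule.sum fun E E' ⟨φ⟩ F F' ⟨ψ⟩ =>
    ⟨{ BundleIso.sumCongr φ.toBundleIso ψ.toBundleIso with
       map_act := fun h a v => by
        simp [BundleIso.sumCongr, φ.map_act, ψ.map_act] }⟩⟩

/-- `Mod(L)` is a commutative monoid under direct sum. -/
instance BundleGerbe.instModAddCommMonoid : AddCommMonoid G.Mod where
  nsmul := nsmulRec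
  add_assoc := by
    rintro ⟨E⟩ ⟨F⟩ ⟨K⟩
    exact Quotient.sound ⟨{ BundleIso.sumAssoc E.E F.E K.E with map_act := fun _ _ _ => rfl }⟩
  zero_add := by
    rintro ⟨E⟩
    exact Quotient.sound ⟨{ BundleIso.zeroSum E.E with map_act := fun _ _ _ => rfl }⟩
  add_zero := by
    rintro ⟨E⟩
    exact Quotient.sound ⟨{ (BundleIso.sumComm E.E _).trans (.zeroSum E.E) with
      map_act := fun _ _ _ => rfl }⟩
  add_comm := by
    rintro ⟨E⟩ ⟨F⟩
    exact Quotient.sound ⟨{ BundleIso.sumComm E.E F.E with map_act := fun _ _ _ => rfl }⟩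

/-- The `K`-group `K_bg(L)` of a bundle gerbe: the Grothendieck group of `Mod(L)`. -/
abbrev BundleGerbe.K := Algebra.GrothendieckAddGroup G.Mod

variable {G} in
/-- The class `[E] ∈ K_bg(L)` of a bundle gerbe module. -/
def GerbeModule.toK (E : GerbeModule G) : G.K :=
  Algebra.GrothendieckAddGroup.of (Quotient.mk _ E : G.Mod)

end GerbeKTheory

/-! ### Čech cohomology -/

section CechDifferential
variable {X Y : Type*}

/-- The Čech differential `(δc)(x₀,…,x_k) = ∑ (-1)^i c(x₀,…,x̂_i,…,x_k)`; a cochain assigns to a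
tuple of indices a function on the corresponding overlap (its values elsewhere are irrelevant). -/
def cechδ {A : Type*} [AddCommGroup A] {k : ℕ} (c : (Fin k → X) → X → A) :
    (Fin (k + 1) → X) → X → A :=
  fun x m => ∑ i : Fin (k + 1), (-1 : ℤ) ^ (i : ℕ) • c (x ∘ i.succAbove) m

theorem cechδ_add {A : Type*} [AddCommGroup A] {k : ℕ} (c d : (Fin k → X) → X → A)
    (x : Fin (k + 1) → X) (m : X) : cechδ (c + d) x m = cechδ c x m + cechδ d x m := by
  simp [cechδ, Finset.sum_add_distrib]

theorem cechδ_neg {A : Type*} [AddCommGroup A] {k : ℕ} (c : (Fin k → X) → X → A)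
    (x : Fin (k + 1) → X) (m : X) : cechδ (-c) x m = -cechδ c x m := by
  simp [cechδ]

theorem cechδ_zero {A : Type*} [AddCommGroup A] {k : ℕ}
    (x : Fin (k + 1) → X) (m : X) : cechδ (0 : (Fin k → X) → X → A) x m = 0 := by
  simp [cechδ]

end CechDifferential

section Cech
variable (X : Type*) [TopologicalSpace X] {Y : Type*} [TopologicalSpace Y]

/-- An open cover of `X` indexed by the points of `X`, the member with index `x` being a
neighbourhood of `x`.  Every open cover is refined by such a cover, and these covers are directed
under `U x ⊆ V x`; so Čech cohomology may be computed with them. -/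
structure PointCover where
  set : X → Set X
  isOpen : ∀ x, IsOpen (set x)
  mem : ∀ x, x ∈ set x

variable {X}

/-- The intersection `U_{x₁} ∩ ⋯ ∩ U_{x_k}`. -/
def PointCover.overlap (U : PointCover X) {k : ℕ} (x : Fin k → X) : Set X := ⋂ i, U.set (x i)

/-- The pull-back of a cover. -/
def PointCover.comap (U : PointCover X) (f : Y → X) (hf : Continuous f) : PointCover Y where
  set y := f ⁻¹' U.set (f y)
  isOpen _ := (U.isOpen _).preimage hf
  mem _ := U.mem _

/-- The common refinement of two covers. -/
def PointCover.inf (U V : PointCover X) : PointCover X where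
  set x := U.set x ∩ V.set x
  isOpen x := (U.isOpen x).inter (V.isOpen x)
  mem x := ⟨U.mem x, V.mem x⟩

theorem PointCover.mem_overlap {U : PointCover X} {k : ℕ} {x : Fin k → X} {m : X} :
    m ∈ U.overlap x ↔ ∀ i, m ∈ U.set (x i) := Set.mem_iInter

theorem PointCover.overlap_inf_left (U V : PointCover X) {k : ℕ} (x : Fin k → X) :
    (U.inf V).overlap x ⊆ U.overlap x :=
  fun _ h => mem_overlap.2 fun i => (mem_overlap.1 h i).1

theorem PointCover.overlap_inf_right (U V : PointCover X) {k : ℕ} (x : Fin k → X) :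
    (U.inf V).overlap x ⊆ V.overlap x :=
  fun _ h => mem_overlap.2 fun i => (mem_overlap.1 h i).2

variable (X)

/-- Čech cocycles with `k` indices (of degree `k - 1`), with values in the constant sheaf `ℤ`,
with respect to some open cover. -/
def cechCocycles (k : ℕ) : AddSubgroup ((Fin k → X) → X → ℤ) where
  carrier := {c | ∃ U : PointCover X, (∀ x, ContinuousOn (c x) (U.overlap x)) ∧
    ∀ x, ∀ m ∈ U.overlap x, cechδ c x m = 0}
  zero_mem' := ⟨⟨fun _ => Set.univ, fun _ => isOpen_univ, fun _ => trivial⟩,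
    fun _ => continuousOn_const, fun x m _ => cechδ_zero x m⟩
  add_mem' := by
    rintro c d ⟨U, hU, hU'⟩ ⟨V, hV, hV'⟩
    refine ⟨U.inf V, fun x => ((hU x).mono (U.overlap_inf_left V x)).add
      ((hV x).mono (U.overlap_inf_right V x)), fun x m hm => ?_⟩
    rw [cechδ_add, hU' x m (U.overlap_inf_left V x hm), hV' x m (U.overlap_inf_right V x hm),
      add_zero]
  neg_mem' := by
    rintro c ⟨U, hU, hU'⟩
    refine ⟨U, fun x => (hU x).neg, fun x m hm => ?_⟩
    rw [cechδ_neg, hU' x m hm, neg_zero]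

/-- Čech cochains with `k + 1` indices which are coboundaries with respect to some open cover. -/
def cechCoboundaries (k : ℕ) : AddSubgroup ((Fin (k + 1) → X) → X → ℤ) where
  carrier := {c | ∃ (U : PointCover X) (b : (Fin k → X) → X → ℤ),
    (∀ x, ContinuousOn (b x) (U.overlap x)) ∧ ∀ x, ∀ m ∈ U.overlap x, c x m = cechδ b x m}
  zero_mem' := ⟨⟨fun _ => Set.univ, fun _ => isOpen_univ, fun _ => trivial⟩, 0,
    fun _ => continuousOn_const, fun x m _ => (cechδ_zero x m).symm⟩
  add_mem' := by
    rintro c d ⟨U, b, hU, hU'⟩ ⟨V, b', hV, hV'⟩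
    refine ⟨U.inf V, b + b', fun x => ((hU x).mono (U.overlap_inf_left V x)).add
      ((hV x).mono (U.overlap_inf_right V x)), fun x m hm => ?_⟩
    rw [cechδ_add, ← hU' x m (U.overlap_inf_left V x hm),
      ← hV' x m (U.overlap_inf_right V x hm)]
    rfl
  neg_mem' := by
    rintro c ⟨U, b, hU, hU'⟩
    refine ⟨U, -b, fun x => (hU x).neg, fun x m hm => ?_⟩
    rw [cechδ_neg, ← hU' x m hm]
    rfl

/-- The third integral Čech cohomology group `H³(X, ℤ)`: the direct limit over the open covers of
`X` of cocycles modulo coboundaries. -/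
abbrev CechH3 := cechCocycles X 4 ⧸ (cechCoboundaries X 3).addSubgroupOf (cechCocycles X 4)

variable {X}

theorem PointCover.mem_overlap_comap {U : PointCover X} {f : Y → X} {hf : Continuous f} {k : ℕ}
    {y : Fin k → Y} {m : Y} (h : m ∈ (U.comap f hf).overlap y) : f m ∈ U.overlap (f ∘ y) :=
  mem_overlap.2 fun i => mem_overlap.1 h i

theorem PointCover.continuousOn_comap {U : PointCover X} {f : Y → X} {hf : Continuous f} {k : ℕ}
    {c : (Fin k → X) → X → ℤ} (hc : ∀ x, ContinuousOn (c x) (U.overlap x)) (y : Fin k → Y) :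
    ContinuousOn (fun m => c (f ∘ y) (f m)) ((U.comap f hf).overlap y) :=
  (hc (f ∘ y)).comp hf.continuousOn fun _ hm => PointCover.mem_overlap_comap hm

/-- The pull-back of cocycles along a continuous map. -/
def cechCocycles.pullback (f : Y → X) (hf : Continuous f) (k : ℕ) :
    cechCocycles X k →+ cechCocycles Y k where
  toFun c := ⟨fun y m => c.1 (f ∘ y) (f m), by
    obtain ⟨U, hU, hU'⟩ := c.2
    exact ⟨U.comap f hf, PointCover.continuousOn_comap hU,
      fun y m hm => hU' (f ∘ y) (f m) (PointCover.mem_overlap_comap hm)⟩⟩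
  map_zero' := rfl
  map_add' _ _ := rfl

/-- The homomorphism `f^* : H³(X, ℤ) → H³(Y, ℤ)` induced by a continuous map `f : Y → X`. -/
def CechH3.pullback (f : Y → X) (hf : Continuous f) : CechH3 X →+ CechH3 Y :=
  QuotientAddGroup.map _ _ (cechCocycles.pullback f hf 4) fun c hc => by
    obtain ⟨U, b, hU, hU'⟩ := hc
    exact ⟨U.comap f hf, fun y m => b (f ∘ y) (f m), PointCover.continuousOn_comap hU,
      fun y m hm => hU' (f ∘ y) (f m) (PointCover.mem_overlap_comap hm)⟩

end Cech

/-! ### Dixmier–Douady classes -/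

section DixmierDouady
variable {M : Type u} [TopologicalSpace M] [DiffeologicalSpace M]

/-- Local data for the Dixmier–Douady class of a bundle gerbe: an open cover `U`, local sections
`s_x : U_x → Y`, unit sections `σ_{xy}` of `(s_x, s_y)⁻¹ L` over `U_x ∩ U_y` and real functions
`ζ_{xyz}` with `σ_{xy} σ_{yz} = exp(2πi ζ_{xyz}) σ_{xz}`. -/
structure BundleGerbe.LocalData (G : BundleGerbe.{u, v} M) where
  U : PointCover M
  s : ∀ x, U.set x → G.Y
  smooth_s : ∀ x, DSmooth (s x)
  π_s : ∀ x m, G.π (s x m) = m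
  σ : ∀ (x y m : M) (hx : m ∈ U.set x) (hy : m ∈ U.set y),
    G.L.fiber (pair ((π_s x ⟨m, hx⟩).trans (π_s y ⟨m, hy⟩).symm))
  norm_σ : ∀ x y m hx hy, ‖σ x y m hx hy‖ = 1
  smooth_σ : ∀ (x y : M) (n : ℕ) (p : EuclideanSpace ℝ (Fin n) → M), IsPlot p →
    ∀ (hx : ∀ t, p t ∈ U.set x) (hy : ∀ t, p t ∈ U.set y),
      IsSmoothAlong G.L
        (fun t => pair ((π_s x ⟨p t, hx t⟩).trans (π_s y ⟨p t, hy t⟩).symm))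
        fun t => σ x y (p t) (hx t) (hy t)
  ζ : (Fin 3 → M) → M → ℝ
  smooth_ζ : ∀ x, SmoothFunOn (ζ x) (U.overlap x)
  mul_σ : ∀ (x y z m : M) (hx : m ∈ U.set x) (hy : m ∈ U.set y) (hz : m ∈ U.set z),
    G.mul _ _ (σ x y m hx hy) (σ y z m hy hz) =
      Complex.exp (2 * Real.pi * Complex.I * ζ ![x, y, z] m) • σ x z m hx hz

/-- `d(L) = h`: the class `h ∈ H³(M, ℤ)` is represented by the integral cocycle `δζ`, for some
choice of local data. -/
def BundleGerbe.HasDDClass (G : BundleGerbe.{u, v} M) (h : CechH3 M) : Prop :=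
  ∃ (D : G.LocalData) (c : cechCocycles M 4),
    (∀ x, ∀ m ∈ D.U.overlap x, (c.1 x m : ℝ) = cechδ D.ζ x m) ∧ h = QuotientAddGroup.mk c

end DixmierDouady

/-! ### Trivialisations and stable isomorphisms -/

section Stable
variable {M : Type u} [DiffeologicalSpace M]

/-- A trivialisation of `(L, Y)`: a hermitian line bundle `T → Y` with an isomorphism of bundle
gerbes `τ : δ(T) ≃ L`, where `δ(T)_{(y₁,y₂)} = T_{y₂} ⊗ T_{y₁}^*` has the product
`(t₂ ⊗ f₁)(t₃ ⊗ f₂) = f₂(t₂) t₃ ⊗ f₁`. -/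
structure BundleGerbe.Trivialisation (G : BundleGerbe.{u, v} M) where
  T : HermBundle G.Y
  rank_one : ∀ y, Module.finrank ℂ (T.fiber y) = 1
  τ : ∀ {y₁ y₂ : G.Y} (h : G.π y₁ = G.π y₂),
    T.fiber y₂ →ₗ[ℂ] StrongDual ℂ (T.fiber y₁) →ₗ[ℂ] G.L.fiber (pair h)
  isometric_τ : ∀ {y₁ y₂ : G.Y} (h : G.π y₁ = G.π y₂), IsIsometricBilin (τ h)
  smooth_τ : IsSmoothBilin (T.pullback (FibProd.snd G.π G.π) (FibProd.dSmooth_snd _ _))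
    (T.dual.pullback (FibProd.fst G.π G.π) (FibProd.dSmooth_fst _ _)) G.L fun q => τ q.2
  mul_τ : ∀ {y₁ y₂ y₃ : G.Y} (h : G.π y₁ = G.π y₂) (k : G.π y₂ = G.π y₃) (t₂ : T.fiber y₂)
    (f₁ : StrongDual ℂ (T.fiber y₁)) (t₃ : T.fiber y₃) (f₂ : StrongDual ℂ (T.fiber y₂)),
    G.mul h k (τ h t₂ f₁) (τ k t₃ f₂) = f₂ t₂ • τ (h.trans k) t₃ f₁

/-- A bundle gerbe is trivial if it has a trivialisation. -/
def BundleGerbe.IsTrivial (G : BundleGerbe.{u, v} M) : Prop := Nonempty G.Trivialisation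

/-- `T ⊗ E` is the pull-back of the bundle `F` on `M`, the descent data being the isomorphisms
`T_{y₂} ⊗ E_{y₂} ≃ T_{y₁} ⊗ E_{y₁}` given by `L_{(y₁,y₂)} ≃ T_{y₂} ⊗ T_{y₁}^*` and the action of
`L` on `E`. -/
def BundleGerbe.Trivialisation.Descends {G : BundleGerbe.{u, v} M} (T : G.Trivialisation)
    (E : GerbeModule G) (F : HermBundle M) : Prop :=
  ∃ θ : BundleIso (T.T.tensor E.E) (F.pullback G.π G.smooth_π),
    ∀ {y₁ y₂ : G.Y} (h : G.π y₁ = G.π y₂) (t₁ : T.T.fiber y₁)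
      (f₁ : StrongDual ℂ (T.T.fiber y₁)) (t₂ : T.T.fiber y₂) (v : E.E.fiber y₂),
      θ.equiv y₁ (t₁ ⊗ₜ E.act h (T.τ h t₂ f₁) v) =
        f₁ t₁ • F.cast h.symm (θ.equiv y₂ (t₂ ⊗ₜ v))

/-- A stable isomorphism from `(L, Y)` to `(J, Z)`: a trivialisation of `L* ⊗ J`. -/
abbrev StableIso (G : BundleGerbe.{u, v} M) (H : BundleGerbe.{u, w} M) :=
  (G.dual.tensor H).Trivialisation

/-- Contraction of `V* ⊗ W` with a vector of `V`. -/
def contract {V W : Type} [NormedAddCommGroup V] [InnerProductSpace ℂ V] [AddCommGroup W]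
    [Module ℂ W] (v : V) : StrongDual ℂ V ⊗[ℂ] W →ₗ[ℂ] W :=
  TensorProduct.lift (LinearMap.mk₂ ℂ (fun f w => f v • w)
    (fun f g w => by simp [add_smul]) (fun c f w => by simp [smul_smul])
    (fun f w w' => by simp) (fun c f w => by simp [smul_comm c]))

/-- The `(J, Z)`-module `F` corresponds to the `(L, Y)`-module `E` under the stable isomorphism
`K → Y ×_M Z`, `L_{(y₁,y₂)}^* ⊗ J_{(z₁,z₂)} ≃ K_{(y₂,z₂)} ⊗ K_{(y₁,z₁)}^*`: the bundle
`K_{(y,z)}^* ⊗ E_y` is the pull-back of `F_z`, compatibly with the actions of `L` and `J`. -/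
def StableIso.Transports {G : BundleGerbe.{u, v} M} {H : BundleGerbe.{u, w} M}
    (α : StableIso G H) (E : GerbeModule G) (F : GerbeModule H) : Prop :=
  ∃ θ : BundleIso
      (α.T.dual.tensor (E.E.pullback (FibProd.fst G.π H.π) (FibProd.dSmooth_fst _ _)))
      (F.E.pullback (FibProd.snd G.π H.π) (FibProd.dSmooth_snd _ _)),
    ∀ (q₁ q₂ : FibProd G.π H.π) (h : G.π q₁.1.1 = G.π q₂.1.1) (k : H.π q₁.1.2 = H.π q₂.1.2)
      (t₂ : α.T.fiber q₂) (f₁ : StrongDual ℂ (α.T.fiber q₁))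
      (f₂ : StrongDual ℂ (α.T.fiber q₂)) (l : G.L.fiber (pair h)) (v : E.E.fiber q₂.1.1),
      F.act k (contract l (α.τ (y₁ := q₁) (y₂ := q₂) h t₂ f₁)) (θ.equiv q₂ (f₂ ⊗ₜ v)) =
        f₂ t₂ • θ.equiv q₁ (f₁ ⊗ₜ E.act h l v)

/-- The isomorphism of `K`-groups induced by a stable isomorphism. -/
def StableIso.Induces {G : BundleGerbe.{u, v} M} {H : BundleGerbe.{u, w} M}
    (α : StableIso G H) (φ : G.K ≃+ H.K) : Prop :=
  ∀ E : GerbeModule G, ∃ F : GerbeModule H, α.Transports E F ∧ φ E.toK = F.toK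

end Stable

end BundleGerbeK

end

open BundleGerbeK

universe x

noncomputable section
namespace BundleGerbeK

/-! ### Smooth sections along plots -/

/-! Parts (1), (3) and (4) rest on one equivalence of modules. Let `W` map to `Y` by `p` and to `Z`
by `q`, both maps locally split, and let `K` be a line bundle on `W` with isometric, multiplicative
isomorphisms L ⊗ K₂ ⊗ K₁* ≃ J; this is a `Twist`. If `E` is an L-module, then K* ⊗ p⁻¹E is a module
for the gerbe q⁻¹J on `W`, and it descends along `q` to a J-module. Conversely K ⊗ q⁻¹F is a module
for p⁻¹L and descends along `p`. The two constructions are mutually inverse on isomorphism classes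
because K ⊗ K* is trivial, and the first is additive, so the K-groups are isomorphic
(`Twist.exists_addEquiv`). A stable isomorphism is the case where `W` is the fibre product of `Y`
and `Z`. A trivialisation is the case where the first gerbe is the trivial one (ℂ, M) and W = Y;
since a module for (ℂ, M) is nothing but a bundle on `M`, this is (1).

Descent needs no data beyond the module structure. If r(w₁) = r(w₂), the line L over (r(w₁), r(w₂))
contains a canonical unit element (`BundleGerbe.one`), and its action identifies the fibres at w₂
and w₁. The cocycle condition holds because units multiply to units, and morphisms of modules
respect the identification because they commute with the action (`GerbeModule.exists_descent`,
`GerbeModule.iso_of_refine`).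

The operations in (2), (3) and (4) are additive in each variable on isomorphism classes and
therefore extend to Grothendieck groups. Local data can be tensored, dualised and pulled back, with
the expected effect on the class d.

It remains to see that gerbes with equal classes are stably isomorphic. A stable isomorphism is a
trivialisation of L* ⊗ J, whose class is zero, so it is enough that d(L) = 0 makes `L` trivial
(`HasDDClass.isTrivial`). If δζ = δb with `b` integral, then ζ - b is a smooth real cocycle, hence
δη for some smooth η, by a partition of unity. Since `b` does not change exp(2πiζ), multiplying σ by
exp(-2πiη) gives σ_ab σ_bc = σ_ac. On the disjoint union of the sets π⁻¹(U_a) the lines L over (y,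
s_a(π(y))) then form a rank one module: `L` multiplies from the left, and σ on the right changes the
index. It descends to a rank one module `S` on `Y`. From L ⊗ S_{y₂} ≃ S_{y₁} one gets L ≃ S_{y₁} ⊗
S_{y₂}*, so T = S* trivialises `L`.

Smoothness is checked throughout on sections along plots: a map of bundles is smooth when it takes
smooth sections along plots to such sections, and local choices are made after reparametrising the
plot. -/

abbrev Euc (n : ℕ) := EuclideanSpace ℝ (Fin n)

/-! ### Localising plots by reparametrisation. -/

section Reparam
variable {n : ℕ}

/-- Plots are defined on all of ℝⁿ, so a plot is restricted to an open set by composing it with a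
diffeomorphism `b` of ℝⁿ onto a small ball. The inverse `c` is only needed near `t`, to carry
smoothness back. -/
theorem exists_reparam {O : Set (Euc n)} (hO : IsOpen O) {t : Euc n} (ht : t ∈ O) :
    ∃ b : Euc n → Euc n, ContDiff ℝ ∞ b ∧ (∀ x, b x ∈ O) ∧
      ∃ c : Euc n → Euc n, ContDiffAt ℝ ∞ c t ∧ ∀ᶠ x in 𝓝 t, b (c x) = x := by
  obtain ⟨r, hr, hrO⟩ := Metric.isOpen_iff.1 hO t ht
  refine ⟨OpenPartialHomeomorph.univBall t r, OpenPartialHomeomorph.contDiff_univBall, fun x => ?_,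
    (OpenPartialHomeomorph.univBall t r).symm,
    (OpenPartialHomeomorph.contDiffOn_univBall_symm (c := t) (r := r)).contDiffAt
      (Metric.ball_mem_nhds t hr), ?_⟩
  · have := (OpenPartialHomeomorph.univBall t r).map_source (x := x) (by simp)
    rw [OpenPartialHomeomorph.univBall_target t hr] at this
    exact hrO this
  · filter_upwards [Metric.ball_mem_nhds t hr] with y hy
    exact (OpenPartialHomeomorph.univBall t r).right_inv (by
      rwa [OpenPartialHomeomorph.univBall_target t hr])

theorem contDiff_congr_fun {V : Type*} [NormedAddCommGroup V] [NormedSpace ℝ V] {f g : Euc n → V}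
    (hf : ContDiff ℝ ∞ f) (h : ∀ t, g t = f t) : ContDiff ℝ ∞ g :=
  (funext h : g = f) ▸ hf

/-- The local hypothesis speaks of all reparametrisations into `O` rather than of smoothness on `O`,
because a section along a plot can be restricted only by composing the plot. -/
theorem contDiff_of_local {V : Type*} [NormedAddCommGroup V] [NormedSpace ℝ V] {g : Euc n → V}
    (h : ∀ t, ∃ O, IsOpen O ∧ t ∈ O ∧ ∀ f : Euc n → Euc n, ContDiff ℝ ∞ f → (∀ x, f x ∈ O) →
      ContDiff ℝ ∞ fun x => g (f x)) : ContDiff ℝ ∞ g := by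
  refine contDiff_iff_contDiffAt.2 fun t => ?_
  obtain ⟨O, hO, ht, h⟩ := h t
  obtain ⟨b, hb, hbO, c, hc, hbc⟩ := exists_reparam hO ht
  refine (((h b hb hbO).contDiffAt (x := c t)).comp t hc).congr_of_eventuallyEq ?_
  filter_upwards [hbc] with x hx
  simp [hx]

end Reparam

/-! ### Sections of bundles along plots. -/

section Along
variable {X Z : Type*} [DiffeologicalSpace X] [DiffeologicalSpace Z]

theorem isOpen_inter {U W : Set X} (hU : IsOpen[dTopology] U) (hW : IsOpen[dTopology] W) :
    IsOpen[dTopology] (U ∩ W) :=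
  @IsOpen.inter _ dTopology _ _ hU hW

theorem isOpen_preimage_plot {n : ℕ} {p : Euc n → X} (hp : IsPlot p) {U : Set X}
    (hU : IsOpen[dTopology] U) : IsOpen (p ⁻¹' U) :=
  isOpen_iff_preimages_plots.1 hU n p hp

/-- It is enough to test plots that stay in `U`: near a parameter mapped into `U`, any plot is such
a plot followed by a local diffeomorphism. -/
theorem smoothFunOn_of_plots {V : Type*} [NormedAddCommGroup V] [NormedSpace ℝ V] {f : X → V}
    {U : Set X} (hU : IsOpen[dTopology] U)
    (h : ∀ (n : ℕ) (p : Euc n → X), IsPlot p → (∀ t, p t ∈ U) → ContDiff ℝ ∞ fun t => f (p t)) :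
    SmoothFunOn f U := by
  intro n p hp t ht
  obtain ⟨b, hb, hbO, c, hc, hbc⟩ := exists_reparam (isOpen_preimage_plot hp hU) ht
  have h1 := h n (p ∘ b) (isPlot_reparam hp hb) hbO
  refine ContDiffAt.contDiffWithinAt ?_
  refine ((h1.contDiffAt (x := c t)).comp t hc).congr_of_eventuallyEq ?_
  filter_upwards [hbc] with x hx
  simp [hx]

theorem SmoothFunOn.along {V : Type*} [NormedAddCommGroup V] [NormedSpace ℝ V] {f : X → V}
    {U : Set X} (h : SmoothFunOn f U) {n : ℕ} {p : Euc n → X} (hp : IsPlot p)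
    (hU : ∀ t, p t ∈ U) : ContDiff ℝ ∞ fun t => f (p t) := by
  have := h n p hp
  rwa [show p ⁻¹' U = Set.univ from Set.eq_univ_of_forall hU, contDiffOn_univ] at this

variable {E F G : HermBundle X} {n : ℕ} {p : Euc n → X}

theorem IsSmoothAlong.reparam {s : ∀ t, E.fiber (p t)} (hs : IsSmoothAlong E p s) {k : ℕ}
    {f : Euc k → Euc n} (hf : ContDiff ℝ ∞ f) :
    IsSmoothAlong E (fun t => p (f t)) fun t => s (f t) :=
  fun e he i => (hs e he i).comp hf.contDiffOn fun _ h => h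

theorem IsSmoothAlong.of_local (hp : IsPlot p) {s : ∀ t, E.fiber (p t)}
    (h : ∀ t, ∃ O, IsOpen O ∧ t ∈ O ∧ ∀ f : Euc n → Euc n, ContDiff ℝ ∞ f → (∀ x, f x ∈ O) →
      IsSmoothAlong E (fun x => p (f x)) fun x => s (f x)) : IsSmoothAlong E p s := by
  intro e he i t ht
  obtain ⟨O, hO, htO, h⟩ := h t
  obtain ⟨b, hb, hbO, c, hc, hbc⟩ := exists_reparam hO htO
  refine ContDiffAt.contDiffWithinAt ?_
  have ho := isOpen_preimage_plot (isPlot_reparam hp hb) e.isOpen_dom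
  have h1 := (h b hb hbO e he i).contDiffAt (x := c t) (ho.mem_nhds (by
    change p (b (c t)) ∈ e.dom
    rwa [hbc.self_of_nhds]))
  refine (h1.comp t hc).congr_of_eventuallyEq ?_
  filter_upwards [hbc] with x hx
  exact (congrArg (fun y => ⟪e.vec i (p y), s y⟫_ℂ) hx).symm

/-- To check a property of sections along plots one may assume that the plot lies in the domain of
a frame. -/
theorem exists_frame_nhds (E : HermBundle X) (hp : IsPlot p) (t : Euc n) :
    ∃ e ∈ E.atlas, IsOpen (p ⁻¹' e.dom) ∧ t ∈ p ⁻¹' e.dom := by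
  obtain ⟨e, he, h⟩ := E.cover (p t)
  exact ⟨e, he, isOpen_preimage_plot hp e.isOpen_dom, h⟩

theorem Frame.sum_inner_smul {V : X → Type} [∀ x, NormedAddCommGroup (V x)]
    [∀ x, InnerProductSpace ℂ (V x)] (e : Frame V) {x : X} (hx : x ∈ e.dom) (v : V x) :
    ∑ i, ⟪e.vec i x, v⟫_ℂ • e.vec i x = v := by
  have h := (e.basis hx).sum_repr' v
  simpa only [Frame.basis_apply] using h

theorem Frame.inner_eq_sum {V : X → Type} [∀ x, NormedAddCommGroup (V x)]
    [∀ x, InnerProductSpace ℂ (V x)] (e : Frame V) {x : X} (hx : x ∈ e.dom) (v w : V x) :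
    ⟪v, w⟫_ℂ = ∑ i, (starRingEnd ℂ) ⟪e.vec i x, v⟫_ℂ * ⟪e.vec i x, w⟫_ℂ := by
  conv_lhs => rw [← e.sum_inner_smul hx v, sum_inner]
  exact Finset.sum_congr rfl fun i _ => inner_smul_left _ _ _

theorem IsSmoothAlong.coeff {s : ∀ t, E.fiber (p t)} (hs : IsSmoothAlong E p s)
    {e : Frame E.fiber} (he : e ∈ E.atlas) (hd : ∀ t, p t ∈ e.dom) (i : e.ι) :
    ContDiff ℝ ∞ fun t => ⟪e.vec i (p t), s t⟫_ℂ := by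
  have := hs e he i
  rwa [show p ⁻¹' e.dom = Set.univ from Set.eq_univ_of_forall hd, contDiffOn_univ] at this

/-- The coefficients in any other frame are the given ones multiplied by the smooth transition
matrix, so one frame suffices. -/
theorem isSmoothAlong_of_frame (hp : IsPlot p) {s : ∀ t, E.fiber (p t)} {e : Frame E.fiber}
    (he : e ∈ E.atlas) (hd : ∀ t, p t ∈ e.dom)
    (h : ∀ i, ContDiff ℝ ∞ fun t => ⟪e.vec i (p t), s t⟫_ℂ) : IsSmoothAlong E p s := by
  intro f hf j
  have h1 : ContDiffOn ℝ ∞ (fun t => ∑ i, ⟪f.vec j (p t), e.vec i (p t)⟫_ℂ *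
      ⟪e.vec i (p t), s t⟫_ℂ) (p ⁻¹' f.dom) :=
    ContDiffOn.sum fun i _ => (((E.smooth f hf e he j i) n p hp).mono
      fun t ht => ⟨ht, hd t⟩).mul (h i).contDiffOn
  refine h1.congr fun t _ => ?_
  rw [e.inner_eq_sum (hd t)]
  simp

theorem isSmoothAlong_vec (hp : IsPlot p) {e : Frame E.fiber} (he : e ∈ E.atlas)
    (hd : ∀ t, p t ∈ e.dom) (i : e.ι) : IsSmoothAlong E p fun t => e.vec i (p t) :=
  fun f hf j => ((E.smooth f hf e he j i) n p hp).mono fun t ht => ⟨ht, hd t⟩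

theorem IsSmoothAlong.inner (hp : IsPlot p) {s s' : ∀ t, E.fiber (p t)}
    (hs : IsSmoothAlong E p s) (hs' : IsSmoothAlong E p s') :
    ContDiff ℝ ∞ fun t => ⟪s t, s' t⟫_ℂ := by
  refine contDiff_of_local fun t => ?_
  obtain ⟨e, he, hO, ht⟩ := exists_frame_nhds E hp t
  refine ⟨_, hO, ht, fun f hf hfO => ?_⟩
  have h : ContDiff ℝ ∞ fun x => ∑ i, (starRingEnd ℂ) ⟪e.vec i (p (f x)), s (f x)⟫_ℂ *
      ⟪e.vec i (p (f x)), s' (f x)⟫_ℂ :=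
    ContDiff.sum fun i _ => (Complex.conjCLE.contDiff.comp
      ((hs.reparam hf).coeff he hfO i)).mul ((hs'.reparam hf).coeff he hfO i)
  refine contDiff_congr_fun h fun x => ?_
  exact e.inner_eq_sum (hfO x) _ _

/-- A section along a plot is smooth if its inner products with smooth sections are smooth. -/
theorem isSmoothAlong_of_inner (hp : IsPlot p) {s : ∀ t, E.fiber (p t)}
    (h : ∀ f : Euc n → Euc n, ContDiff ℝ ∞ f → ∀ s' : ∀ t, E.fiber (p (f t)),
      IsSmoothAlong E (fun t => p (f t)) s' → ContDiff ℝ ∞ fun t => ⟪s' t, s (f t)⟫_ℂ) :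
    IsSmoothAlong E p s := by
  refine IsSmoothAlong.of_local hp fun t => ?_
  obtain ⟨e, he, hO, ht⟩ := exists_frame_nhds E hp t
  refine ⟨_, hO, ht, fun f hf hfO => ?_⟩
  have hq : IsPlot fun x => p (f x) := isPlot_reparam hp hf
  exact isSmoothAlong_of_frame hq he hfO fun i => h f hf _ (isSmoothAlong_vec hq he hfO i)

theorem IsSmoothAlong.smul {c : Euc n → ℂ} (hc : ContDiff ℝ ∞ c) {s : ∀ t, E.fiber (p t)}
    (hs : IsSmoothAlong E p s) : IsSmoothAlong E p fun t => c t • s t := fun e he i => by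
  simpa only [inner_smul_right] using hc.contDiffOn.mul (hs e he i)

theorem IsSmoothAlong.congr {s s' : ∀ t, E.fiber (p t)} (hs : IsSmoothAlong E p s)
    (h : ∀ t, s' t = s t) : IsSmoothAlong E p s' := by
  obtain rfl : s' = s := funext h
  exact hs

/-! ### Smooth homomorphisms through their effect on sections -/

theorem isSmoothHom_of_frames {φ : ∀ x, E.fiber x →ₗ[ℂ] F.fiber x}
    (h : ∀ e ∈ E.atlas, ∀ i, ∀ (n : ℕ) (p : Euc n → X), IsPlot p → (∀ t, p t ∈ e.dom) →
      IsSmoothAlong F p fun t => φ (p t) (e.vec i (p t))) : IsSmoothHom E F φ :=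
  fun e he f hf i j => smoothFunOn_of_plots (isOpen_inter e.isOpen_dom f.isOpen_dom)
    fun n p hp hd => (h e he i n p hp fun t => (hd t).1).coeff hf (fun t => (hd t).2) j

theorem isSmoothHom_of_sections {φ : ∀ x, E.fiber x →ₗ[ℂ] F.fiber x}
    (h : ∀ (n : ℕ) (p : Euc n → X), IsPlot p → ∀ s : ∀ t, E.fiber (p t), IsSmoothAlong E p s →
      IsSmoothAlong F p fun t => φ (p t) (s t)) : IsSmoothHom E F φ :=
  isSmoothHom_of_frames fun _ he i n p hp hd => h n p hp _ (isSmoothAlong_vec hp he hd i)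

theorem IsSmoothHom.apply {φ : ∀ x, E.fiber x →ₗ[ℂ] F.fiber x} (hφ : IsSmoothHom E F φ)
    (hp : IsPlot p) {s : ∀ t, E.fiber (p t)} (hs : IsSmoothAlong E p s) :
    IsSmoothAlong F p fun t => φ (p t) (s t) := by
  refine IsSmoothAlong.of_local hp fun t => ?_
  obtain ⟨e, he, hO, ht⟩ := exists_frame_nhds E hp t
  obtain ⟨f, hf, hO', ht'⟩ := exists_frame_nhds F hp t
  refine ⟨_, hO.inter hO', ⟨ht, ht'⟩, fun g hg hgO => ?_⟩
  have hq : IsPlot fun x => p (g x) := isPlot_reparam hp hg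
  refine isSmoothAlong_of_frame hq hf (fun x => (hgO x).2) fun j => ?_
  have h : ContDiff ℝ ∞ fun x => ∑ i, ⟪e.vec i (p (g x)), s (g x)⟫_ℂ *
      ⟪f.vec j (p (g x)), φ (p (g x)) (e.vec i (p (g x)))⟫_ℂ :=
    ContDiff.sum fun i _ => ((hs.reparam hg).coeff he (fun x => (hgO x).1) i).mul
      ((hφ e he f hf i j).along hq hgO)
  refine contDiff_congr_fun h fun x => ?_
  conv_lhs => rw [← e.sum_inner_smul (hgO x).1 (s (g x))]
  simp

theorem isSmoothBilin_of_frames {β : ∀ x, E.fiber x →ₗ[ℂ] F.fiber x →ₗ[ℂ] G.fiber x}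
    (h : ∀ e ∈ E.atlas, ∀ f ∈ F.atlas, ∀ i j, ∀ (n : ℕ) (p : Euc n → X), IsPlot p →
      (∀ t, p t ∈ e.dom) → (∀ t, p t ∈ f.dom) →
      IsSmoothAlong G p fun t => β (p t) (e.vec i (p t)) (f.vec j (p t))) :
    IsSmoothBilin E F G β :=
  fun e he f hf g hg i j k => smoothFunOn_of_plots
    (isOpen_inter (isOpen_inter e.isOpen_dom f.isOpen_dom) g.isOpen_dom)
    fun n p hp hd => (h e he f hf i j n p hp (fun t => (hd t).1.1) fun t => (hd t).1.2).coeff hg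
      (fun t => (hd t).2) k

theorem isSmoothBilin_of_sections {β : ∀ x, E.fiber x →ₗ[ℂ] F.fiber x →ₗ[ℂ] G.fiber x}
    (h : ∀ (n : ℕ) (p : Euc n → X), IsPlot p → ∀ (s : ∀ t, E.fiber (p t))
      (s' : ∀ t, F.fiber (p t)), IsSmoothAlong E p s → IsSmoothAlong F p s' →
      IsSmoothAlong G p fun t => β (p t) (s t) (s' t)) : IsSmoothBilin E F G β :=
  isSmoothBilin_of_frames fun _ he _ hf i j n p hp hd hd' =>
    h n p hp _ _ (isSmoothAlong_vec hp he hd i) (isSmoothAlong_vec hp hf hd' j)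

theorem IsSmoothBilin.apply {β : ∀ x, E.fiber x →ₗ[ℂ] F.fiber x →ₗ[ℂ] G.fiber x}
    (hβ : IsSmoothBilin E F G β) (hp : IsPlot p) {s : ∀ t, E.fiber (p t)}
    {s' : ∀ t, F.fiber (p t)} (hs : IsSmoothAlong E p s) (hs' : IsSmoothAlong F p s') :
    IsSmoothAlong G p fun t => β (p t) (s t) (s' t) := by
  refine IsSmoothAlong.of_local hp fun t => ?_
  obtain ⟨e, he, hO, ht⟩ := exists_frame_nhds E hp t
  obtain ⟨f, hf, hO', ht'⟩ := exists_frame_nhds F hp t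
  obtain ⟨g, hg, hO'', ht''⟩ := exists_frame_nhds G hp t
  refine ⟨_, (hO.inter hO').inter hO'', ⟨⟨ht, ht'⟩, ht''⟩, fun r hr hrO => ?_⟩
  have hq : IsPlot fun x => p (r x) := isPlot_reparam hp hr
  refine isSmoothAlong_of_frame hq hg (fun x => (hrO x).2) fun k => ?_
  have h : ContDiff ℝ ∞ fun x => ∑ i, ∑ j, ⟪e.vec i (p (r x)), s (r x)⟫_ℂ *
      (⟪f.vec j (p (r x)), s' (r x)⟫_ℂ *
      ⟪g.vec k (p (r x)), β (p (r x)) (e.vec i (p (r x))) (f.vec j (p (r x)))⟫_ℂ) :=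
    ContDiff.sum fun i _ => ContDiff.sum fun j _ =>
      ((hs.reparam hr).coeff he (fun x => (hrO x).1.1) i).mul
        (((hs'.reparam hr).coeff hf (fun x => (hrO x).1.2) j).mul
          ((hβ e he f hf g hg i j k).along hq hrO))
  refine contDiff_congr_fun h fun x => ?_
  conv_lhs => rw [← e.sum_inner_smul (hrO x).1.1 (s (r x)),
    ← f.sum_inner_smul (hrO x).1.2 (s' (r x))]
  simp only [map_sum, map_smul, LinearMap.sum_apply, LinearMap.smul_apply, inner_sum,
    inner_smul_right, Finset.mul_sum]
  rw [Finset.sum_comm]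
  refine Finset.sum_congr rfl fun i _ => Finset.sum_congr rfl fun j _ => ?_
  rw [mul_left_comm]

/-! ### Sections of the bundles constructed from given ones -/

theorem isSmoothAlong_pullback {q : Euc n → Z} {g : Z → X} {hg : DSmooth g}
    {s : ∀ t, E.fiber (g (q t))} :
    IsSmoothAlong (E.pullback g hg) q s ↔ IsSmoothAlong E (fun t => g (q t)) s :=
  ⟨fun h e he i => h _ ⟨e, he, rfl⟩ i, by rintro h _ ⟨e, he, rfl⟩ i; exact h e he i⟩

theorem IsSmoothAlong.tmul {s : ∀ t, E.fiber (p t)} {s' : ∀ t, F.fiber (p t)}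
    (hs : IsSmoothAlong E p s) (hs' : IsSmoothAlong F p s') :
    IsSmoothAlong (E.tensor F) p fun t => s t ⊗ₜ s' t := by
  rintro _ ⟨e, he, f, hf, rfl⟩ i
  simp only [TensorProduct.inner_tmul]
  exact ((hs e he i.1).mono fun t ht => ht.1).mul ((hs' f hf i.2).mono fun t ht => ht.2)

theorem IsSmoothAlong.toDual {s : ∀ t, E.fiber (p t)} (hs : IsSmoothAlong E p s) :
    IsSmoothAlong E.dual p fun t => InnerProductSpace.toDual ℂ _ (s t) := by
  rintro _ ⟨e, he, rfl⟩ i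
  refine (Complex.conjCLE.contDiff.comp_contDiffOn (hs e he i)).congr fun t _ => ?_
  simp only [dual_inner_toDual, Function.comp_apply, Complex.conjCLE_apply, inner_conj_symm]

theorem IsSmoothAlong.toDual_symm {s : ∀ t, E.dual.fiber (p t)} (hs : IsSmoothAlong E.dual p s) :
    IsSmoothAlong E p fun t => (InnerProductSpace.toDual ℂ (E.fiber (p t))).symm (s t) := by
  intro e he i
  refine (Complex.conjCLE.contDiff.comp_contDiffOn (hs _ ⟨e, he, rfl⟩ i)).congr fun t _ => ?_
  simp only [dual_inner, Function.comp_apply, Complex.conjCLE_apply, inner_conj_symm,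
    LinearIsometryEquiv.symm_apply_apply]

theorem IsSmoothAlong.dual_apply (hp : IsPlot p) {f : ∀ t, E.dual.fiber (p t)}
    {s : ∀ t, E.fiber (p t)} (hf : IsSmoothAlong E.dual p f) (hs : IsSmoothAlong E p s) :
    ContDiff ℝ ∞ fun t => (f t) (s t) := by
  refine contDiff_congr_fun (hf.toDual_symm.inner hp hs) fun t => ?_
  simp

theorem isSmoothAlong_cast {p' : Euc n → X} (h : ∀ t, p t = p' t) {s : ∀ t, E.fiber (p t)}
    (hs : IsSmoothAlong E p s) : IsSmoothAlong E p' fun t => E.cast (h t) (s t) := by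
  obtain rfl : p = p' := funext h
  exact hs

/-- The frames of a tensor bundle consist of pure tensors, so smoothness need only be seen on pure
tensors of smooth sections. -/
theorem isSmoothHom_tensor {H : HermBundle X} {φ : ∀ x, (E.tensor F).fiber x →ₗ[ℂ] H.fiber x}
    (h : ∀ (n : ℕ) (p : Euc n → X), IsPlot p → ∀ (s : ∀ t, E.fiber (p t))
      (s' : ∀ t, F.fiber (p t)), IsSmoothAlong E p s → IsSmoothAlong F p s' →
      IsSmoothAlong H p fun t => φ (p t) (s t ⊗ₜ s' t)) : IsSmoothHom (E.tensor F) H φ := by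
  refine isSmoothHom_of_frames ?_
  rintro _ ⟨e, he, f, hf, rfl⟩ i n p hp hd
  exact h n p hp _ _ (isSmoothAlong_vec hp he (fun t => (hd t).1) i.1)
    (isSmoothAlong_vec hp hf (fun t => (hd t).2) i.2)

theorem isSmoothBilin_tensor_right {H : HermBundle X}
    {β : ∀ x, G.fiber x →ₗ[ℂ] (E.tensor F).fiber x →ₗ[ℂ] H.fiber x}
    (h : ∀ (n : ℕ) (p : Euc n → X), IsPlot p → ∀ (r : ∀ t, G.fiber (p t)) (s : ∀ t, E.fiber (p t))
      (s' : ∀ t, F.fiber (p t)), IsSmoothAlong G p r → IsSmoothAlong E p s →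
      IsSmoothAlong F p s' → IsSmoothAlong H p fun t => β (p t) (r t) (s t ⊗ₜ s' t)) :
    IsSmoothBilin G (E.tensor F) H β := by
  refine isSmoothBilin_of_frames ?_
  rintro g hg _ ⟨e, he, f, hf, rfl⟩ i j n p hp hd hd'
  exact h n p hp _ _ _ (isSmoothAlong_vec hp hg hd i)
    (isSmoothAlong_vec hp he (fun t => (hd' t).1) j.1)
    (isSmoothAlong_vec hp hf (fun t => (hd' t).2) j.2)

/-- The inverse of a smooth isometric isomorphism is smooth. -/
theorem IsSmoothHom.symm_of_isometry {φ : ∀ x, E.fiber x ≃ₗ[ℂ] F.fiber x}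
    (hφ : IsSmoothHom E F fun x => (φ x).toLinearMap)
    (hi : ∀ x (a b : E.fiber x), ⟪φ x a, φ x b⟫_ℂ = ⟪a, b⟫_ℂ) :
    IsSmoothHom F E fun x => (φ x).symm.toLinearMap := by
  refine isSmoothHom_of_sections fun n p hp s hs => isSmoothAlong_of_inner hp fun f hf s' hs' => ?_
  have hq : IsPlot fun x => p (f x) := isPlot_reparam hp hf
  -- Since ⟪s', φ⁻¹ s⟫ = ⟪φ s', s⟫, the inner products to be tested no longer contain the inverse.
  refine contDiff_congr_fun ((hφ.apply hq hs').inner hq (hs.reparam hf)) fun t => ?_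
  rw [← hi]
  simp

/-- The bundle isomorphism given by a smooth family of isometric isomorphisms. -/
@[reducible]
def BundleIso.ofIsometry (φ : ∀ x, E.fiber x ≃ₗ[ℂ] F.fiber x)
    (hφ : IsSmoothHom E F fun x => (φ x).toLinearMap)
    (hi : ∀ x (a b : E.fiber x), ⟪φ x a, φ x b⟫_ℂ = ⟪a, b⟫_ℂ) : BundleIso E F where
  equiv := φ
  smooth := hφ
  smooth_symm := hφ.symm_of_isometry hi

end Along

/-! ### Lines -/

section Lines
variable {V : Type} [NormedAddCommGroup V] [InnerProductSpace ℂ V]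

theorem exists_unit (h : Module.finrank ℂ V = 1) : ∃ u : V, ‖u‖ = 1 := by
  have : Nontrivial V := Module.nontrivial_of_finrank_pos (R := ℂ) (by omega)
  obtain ⟨v, hv⟩ := exists_ne (0 : V)
  exact ⟨((‖v‖⁻¹ : ℝ) : ℂ) • v, by
    rw [norm_smul, Complex.norm_real, norm_inv, norm_norm, inv_mul_cancel₀ (norm_ne_zero_iff.2 hv)]⟩

theorem inner_self_unit {u : V} (hu : ‖u‖ = 1) : ⟪u, u⟫_ℂ = 1 := by
  rw [inner_self_eq_norm_sq_to_K, hu]; simp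

theorem norm_eq_one_of_inner {u : V} (hu : ⟪u, u⟫_ℂ = 1) : ‖u‖ = 1 := by
  rw [inner_self_eq_norm_sq_to_K] at hu
  have h2 : ‖u‖ ^ 2 = 1 := Complex.ofReal_injective (by simpa using hu)
  nlinarith [norm_nonneg u]

theorem line_eq (h : Module.finrank ℂ V = 1) {u : V} (hu : ‖u‖ = 1) (v : V) :
    ⟪u, v⟫_ℂ • u = v := by
  obtain ⟨c, rfl⟩ := exists_smul_eq_of_finrank_eq_one h
    (norm_ne_zero_iff.1 (by rw [hu]; exact one_ne_zero)) v
  rw [inner_smul_right, inner_self_unit hu, mul_one]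

/-- In terms of a unit vector each inner product is a product of two scalars, so the right-hand
entries can be exchanged. This is what makes contraction with a line isometric. -/
theorem inner_mul_inner_line (h : Module.finrank ℂ V = 1) (a b c d : V) :
    ⟪a, b⟫_ℂ * ⟪c, d⟫_ℂ = ⟪a, d⟫_ℂ * ⟪c, b⟫_ℂ := by
  obtain ⟨u, hu⟩ := exists_unit h
  rw [← line_eq h hu a, ← line_eq h hu b, ← line_eq h hu c, ← line_eq h hu d]
  simp only [inner_smul_left, inner_smul_right, inner_self_unit hu]
  ring

end Lines

theorem IsIsometricBilin.norm {V V' V'' : Type} [NormedAddCommGroup V] [InnerProductSpace ℂ V]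
    [NormedAddCommGroup V'] [InnerProductSpace ℂ V'] [NormedAddCommGroup V'']
    [InnerProductSpace ℂ V''] {β : V →ₗ[ℂ] V' →ₗ[ℂ] V''} (hβ : IsIsometricBilin β) {a : V} {b : V'}
    (ha : ‖a‖ = 1) (hb : ‖b‖ = 1) : ‖β a b‖ = 1 :=
  norm_eq_one_of_inner (by rw [hβ, inner_self_unit ha, inner_self_unit hb, mul_one])

/-- Local smooth unit sections of a line bundle along a plot. -/
theorem exists_unit_nhds {X : Type*} [DiffeologicalSpace X] {E : HermBundle X} {n : ℕ}
    {p : Euc n → X} (hE : ∀ x, Module.finrank ℂ (E.fiber x) = 1) (hp : IsPlot p) (t : Euc n) :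
    ∃ O, IsOpen O ∧ t ∈ O ∧ ∃ s : ∀ x, E.fiber x, (∀ t ∈ O, ‖s (p t)‖ = 1) ∧
      ∀ f : Euc n → Euc n, ContDiff ℝ ∞ f → (∀ x, f x ∈ O) →
        IsSmoothAlong E (fun x => p (f x)) fun x => s (p (f x)) := by
  obtain ⟨e, he, hO, ht⟩ := exists_frame_nhds E hp t
  have hcard : Fintype.card e.ι = 1 := by
    rw [← hE (p t), Module.finrank_eq_card_basis (e.basis ht).toBasis]
  obtain ⟨i, -⟩ := Fintype.card_eq_one_iff.1 hcard
  exact ⟨_, hO, ht, e.vec i, fun t ht => (e.orthonormal _ ht).1 i, fun f hf hfO =>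
    isSmoothAlong_vec (isPlot_reparam hp hf) he hfO i⟩

/-! ### Units of a bundle gerbe -/

namespace BundleGerbe
variable {M : Type u} [DiffeologicalSpace M] (G : BundleGerbe.{u, v} M)

/-- The unit element of the line `L_{(y,y)}`. -/
def one (y : G.Y) : G.L.fiber (pair (rfl : G.π y = G.π y)) :=
  let u := (exists_unit (G.rank_one (pair (rfl : G.π y = G.π y)))).choose
  -- Writing u·u = λu with |λ| = 1, the idempotent on this line is λ⁻¹u, and λ⁻¹ is the conjugate of
  -- λ, that is ⟪u·u, u⟫.
  ⟪G.mul rfl rfl u u, u⟫_ℂ • u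

/-- Replacing `u` by cu with |c| = 1 multiplies ⟪u·u, u⟫ u by |c|⁴ = 1. So any unit vector computes
the unit element; a smooth local unit section therefore shows that the unit element varies smoothly.
-/
theorem one_eq {y : G.Y} {u : G.L.fiber (pair (rfl : G.π y = G.π y))} (hu : ‖u‖ = 1) :
    G.one y = ⟪G.mul rfl rfl u u, u⟫_ℂ • u := by
  have h := G.rank_one (pair (rfl : G.π y = G.π y))
  have hu' := (exists_unit h).choose_spec
  change ⟪G.mul rfl rfl (exists_unit h).choose (exists_unit h).choose, _⟫_ℂ • _ = _
  generalize (exists_unit h).choose = a at hu' ⊢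
  rw [← line_eq h hu a] at hu' ⊢
  generalize ⟪u, a⟫_ℂ = c at hu' ⊢
  have hc : (starRingEnd ℂ) c * c = 1 := by
    have := inner_self_unit hu'
    rwa [inner_smul_left, inner_smul_right, inner_self_unit hu, mul_one] at this
  simp only [map_smul, LinearMap.smul_apply, inner_smul_left, inner_smul_right, smul_smul, map_mul]
  congr 1
  linear_combination ((starRingEnd ℂ) c * c + 1) * ⟪G.mul rfl rfl u u, u⟫_ℂ * hc

theorem norm_one (y : G.Y) : ‖G.one y‖ = 1 := by
  have h := G.rank_one (pair (rfl : G.π y = G.π y))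
  obtain ⟨u, hu⟩ := exists_unit h
  rw [G.one_eq hu, norm_smul, hu, mul_one]
  have h1 : ‖G.mul rfl rfl u u‖ = 1 := (G.isometric_mul rfl rfl).norm hu hu
  have h2 : ‖⟪G.mul rfl rfl u u, u⟫_ℂ • G.mul rfl rfl u u‖ = ‖u‖ := by rw [line_eq h h1]
  rwa [norm_smul, h1, mul_one, hu] at h2

/-- Applying `one_eq` to the unit element e itself gives ⟪e·e, e⟫ = 1, and e·e has norm one in a
line, so e·e = e. -/
theorem one_mul_one (y : G.Y) : G.mul rfl rfl (G.one y) (G.one y) = G.one y := by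
  have h := G.rank_one (pair (rfl : G.π y = G.π y))
  have h1 := G.norm_one y
  have h2 := G.one_eq h1
  have h3 : ‖G.mul rfl rfl (G.one y) (G.one y)‖ = 1 := (G.isometric_mul rfl rfl).norm h1 h1
  exact (line_eq h h3 _).symm.trans (by
    have h4 := line_eq h h1 (G.mul rfl rfl (G.one y) (G.one y))
    have h5 : ⟪G.one y, G.mul rfl rfl (G.one y) (G.one y)⟫_ℂ = 1 := by
      have := congrArg (fun x => ⟪G.one y, x⟫_ℂ) h2
      simp only [inner_smul_right, inner_self_unit h1, mul_one] at this
      rw [← inner_conj_symm, ← this, map_one]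
    rw [line_eq h h3]
    rw [h5, one_smul] at h4
    exact h4.symm)

/-- With e the unit element, e(ea - a) = (ee)a - ea = 0, and multiplication by a unit vector is
isometric, hence injective. The same argument gives `mul_one` and the action of e on modules. -/
theorem one_mul {y z : G.Y} (h : G.π y = G.π z) (a : G.L.fiber (pair h)) :
    G.mul rfl h (G.one y) a = a := by
  have h1 := G.mul_assoc rfl rfl h (G.one y) (G.one y) a
  rw [one_mul_one] at h1
  have h2 : G.mul rfl h (G.one y) (G.mul rfl h (G.one y) a - a) = 0 := by
    rw [map_sub, ← h1]; exact sub_self _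
  have h3 := G.isometric_mul rfl h (G.one y) (G.mul rfl h (G.one y) a - a) (G.one y)
    (G.mul rfl h (G.one y) a - a)
  rw [h2, inner_zero_left, inner_self_unit (G.norm_one y), _root_.one_mul] at h3
  exact sub_eq_zero.1 (inner_self_eq_zero.1 h3.symm)

theorem mul_one {y z : G.Y} (h : G.π y = G.π z) (a : G.L.fiber (pair h)) :
    G.mul h rfl a (G.one z) = a := by
  obtain ⟨u, hu⟩ := exists_unit (G.rank_one (pair h))
  have key : G.mul h rfl u (G.one z) = u := by
    have h1 := G.mul_assoc h rfl rfl u (G.one z) (G.one z)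
    rw [one_mul_one] at h1
    have h2 : G.mul h rfl (G.mul h rfl u (G.one z) - u) (G.one z) = 0 := by
      rw [map_sub, LinearMap.sub_apply]; exact sub_eq_zero.2 h1
    have h3 := G.isometric_mul h rfl (G.mul h rfl u (G.one z) - u) (G.one z)
      (G.mul h rfl u (G.one z) - u) (G.one z)
    rw [h2, inner_zero_left, inner_self_unit (G.norm_one z), _root_.mul_one] at h3
    exact sub_eq_zero.1 (inner_self_eq_zero.1 h3.symm)
  rw [← line_eq (G.rank_one (pair h)) hu a, map_smul, LinearMap.smul_apply, key]

theorem isSmoothAlong_one {n : ℕ} {p : Euc n → G.Y} (hp : IsPlot p) :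
    IsSmoothAlong G.L (fun t => pair (rfl : G.π (p t) = G.π (p t))) fun t => G.one (p t) := by
  have hq : IsPlot fun t => pair (rfl : G.π (p t) = G.π (p t)) := ⟨hp, hp⟩
  refine IsSmoothAlong.of_local hq fun t => ?_
  obtain ⟨O, hO, ht, s, hs, hs'⟩ := exists_unit_nhds G.rank_one hq t
  refine ⟨O, hO, ht, fun f hf hfO => ?_⟩
  have hf' : IsPlot fun x => p (f x) := isPlot_reparam hp hf
  have hqf : IsPlot fun x => pair (rfl : G.π (p (f x)) = G.π (p (f x))) := ⟨hf', hf'⟩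
  have h1 := hs' f hf hfO
  have h2 := G.smooth_mul.apply (p := fun x => (⟨(p (f x), p (f x), p (f x)), rfl, rfl⟩ : Fib3 G.π))
    ⟨hf', hf', hf'⟩ (isSmoothAlong_pullback.2 h1) (isSmoothAlong_pullback.2 h1)
  rw [isSmoothAlong_pullback] at h2
  refine ((h1.smul (h2.inner hqf h1))).congr fun x => ?_
  exact G.one_eq (hs _ (hfO x))

/-- Transport of `L_{(y₁,y₂)}` along equalities. -/
def castL {y₁ y₁' y₂ y₂' : G.Y} (e₁ : y₁ = y₁') (e₂ : y₂ = y₂') {h : G.π y₁ = G.π y₂}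
    {h' : G.π y₁' = G.π y₂'} : G.L.fiber (pair h) ≃ₗᵢ[ℂ] G.L.fiber (pair h') :=
  G.L.cast (by subst e₁ e₂; rfl)

theorem castL_castL {y₁ y₁' y₁'' y₂ y₂' y₂'' : G.Y} (e₁ : y₁ = y₁') (e₂ : y₂ = y₂')
    (f₁ : y₁' = y₁'') (f₂ : y₂' = y₂'') {h : G.π y₁ = G.π y₂} {h' : G.π y₁' = G.π y₂'}
    {h'' : G.π y₁'' = G.π y₂''} (a : G.L.fiber (pair h)) :
    G.castL f₁ f₂ (h' := h'') (G.castL e₁ e₂ (h' := h') a) =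
      G.castL (e₁.trans f₁) (e₂.trans f₂) a := by
  subst e₁ e₂ f₁ f₂
  rfl

/-- The unit element of `L_{(y₁,y₂)}`, if `y₁ = y₂`. -/
def unit {y₁ y₂ : G.Y} (e : y₁ = y₂) {h : G.π y₁ = G.π y₂} : G.L.fiber (pair h) :=
  G.castL rfl e (G.one y₁)

theorem norm_unit {y₁ y₂ : G.Y} (e : y₁ = y₂) {h : G.π y₁ = G.π y₂} :
    ‖G.unit e (h := h)‖ = 1 := by
  rw [unit, LinearIsometryEquiv.norm_map, norm_one]

/-- The unit law for points that are equal only propositionally, as r(w₁) and r(w₂) are in descent;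
multiplying by a unit is then the same as transporting the line. -/
theorem unit_mul_cast {y₁ y₁' y₂ : G.Y} (e : y₁' = y₁) {h : G.π y₁ = G.π y₂} {k : G.π y₁' = G.π y₁}
    (a : G.L.fiber (pair h)) :
    G.mul k h (G.unit e) a = G.castL e.symm rfl a := by
  subst e
  exact G.one_mul h a

theorem cast_mul_unit {y₁ y₁' y₂ y₂' : G.Y} (e : y₁ = y₁') (e' : y₂ = y₂') {h : G.π y₁ = G.π y₂}
    {h' : G.π y₁' = G.π y₂'} {k : G.π y₂' = G.π y₂} (a : G.L.fiber (pair h)) :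
    G.mul h' k (G.castL e e' a) (G.unit e'.symm) = G.castL e rfl a := by
  subst e e'
  exact G.mul_one h a

theorem unit_mul_unit {y₁ y₂ y₃ : G.Y} (e : y₁ = y₂) (e' : y₂ = y₃) {h : G.π y₁ = G.π y₂}
    {k : G.π y₂ = G.π y₃} : G.mul h k (G.unit e) (G.unit e') = G.unit (e.trans e') := by
  subst e e'
  exact G.one_mul_one y₁

theorem cast_mul_cast {y₁ y₁' y₂ y₂' y₃ y₃' : G.Y} (e₁ : y₁ = y₁') (e₂ : y₂ = y₂') (e₃ : y₃ = y₃')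
    {h : G.π y₁ = G.π y₂} {k : G.π y₂ = G.π y₃} {h' : G.π y₁' = G.π y₂'} {k' : G.π y₂' = G.π y₃'}
    (a : G.L.fiber (pair h)) (b : G.L.fiber (pair k)) :
    G.mul h' k' (G.castL e₁ e₂ a) (G.castL e₂ e₃ b) = G.castL e₁ e₃ (G.mul h k a b) := by
  subst e₁ e₂ e₃
  rfl

theorem isSmoothAlong_castL {n : ℕ} {p₁ p₁' p₂ p₂' : Euc n → G.Y} (e₁ : ∀ t, p₁ t = p₁' t)
    (e₂ : ∀ t, p₂ t = p₂' t) {h : ∀ t, G.π (p₁ t) = G.π (p₂ t)}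
    {h' : ∀ t, G.π (p₁' t) = G.π (p₂' t)} {s : ∀ t, G.L.fiber (pair (h t))}
    (hs : IsSmoothAlong G.L (fun t => pair (h t)) s) :
    IsSmoothAlong G.L (fun t => pair (h' t)) fun t => G.castL (e₁ t) (e₂ t) (s t) := by
  obtain rfl : p₁ = p₁' := funext e₁
  obtain rfl : p₂ = p₂' := funext e₂
  exact hs

theorem isSmoothAlong_unit {n : ℕ} {p₁ p₂ : Euc n → G.Y} (hp : IsPlot p₁)
    (e : ∀ t, p₁ t = p₂ t) {h : ∀ t, G.π (p₁ t) = G.π (p₂ t)} :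
    IsSmoothAlong G.L (fun t => pair (h t)) fun t => G.unit (e t) := by
  obtain rfl : p₁ = p₂ := funext e
  exact G.isSmoothAlong_one hp

end BundleGerbe

/-! ### Units acting on modules. -/

namespace GerbeModule
variable {M : Type u} [DiffeologicalSpace M] {G : BundleGerbe.{u, v} M} (A : GerbeModule G)

theorem act_one (y : G.Y) (v : A.E.fiber y) : A.act rfl (G.one y) v = v := by
  have h1 := A.mul_act rfl rfl (G.one y) (G.one y) v
  rw [G.one_mul_one] at h1
  have h2 : A.act rfl (G.one y) (A.act rfl (G.one y) v - v) = 0 := by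
    rw [map_sub]; exact sub_eq_zero.2 h1.symm
  have h3 := A.isometric_act rfl (G.one y) (A.act rfl (G.one y) v - v) (G.one y)
    (A.act rfl (G.one y) v - v)
  rw [h2, inner_zero_left, inner_self_unit (G.norm_one y), _root_.one_mul] at h3
  exact sub_eq_zero.1 (inner_self_eq_zero.1 h3.symm)

theorem act_smooth {n : ℕ} {p₁ p₂ : Euc n → G.Y} (hp₁ : IsPlot p₁) (hp₂ : IsPlot p₂)
    {h : ∀ t, G.π (p₁ t) = G.π (p₂ t)} {l : ∀ t, G.L.fiber (pair (h t))}
    {s : ∀ t, A.E.fiber (p₂ t)} (hl : IsSmoothAlong G.L (fun t => pair (h t)) l)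
    (hs : IsSmoothAlong A.E p₂ s) : IsSmoothAlong A.E p₁ fun t => A.act (h t) (l t) (s t) :=
  (isSmoothAlong_pullback (g := FibProd.fst G.π G.π) (q := fun t => pair (h t))).1
    (A.smooth_act.apply (p := fun t => pair (h t)) ⟨hp₁, hp₂⟩ hl (isSmoothAlong_pullback.2 hs))

/-- Transport of fibres is the action of a unit, so whatever commutes with the action of the gerbe
commutes with transport. -/
theorem cast_eq_act {y y' : G.Y} (e : y = y') {h : G.π y' = G.π y} (v : A.E.fiber y) :
    A.E.cast e v = A.act h (G.unit e.symm) v := by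
  subst e
  exact (A.act_one y v).symm

theorem cast_act {y₁ y₁' y₂ y₂' : G.Y} (e₁ : y₁ = y₁') (e₂ : y₂ = y₂') {h : G.π y₁ = G.π y₂}
    {h' : G.π y₁' = G.π y₂'} (a : G.L.fiber (pair h)) (v : A.E.fiber y₂) :
    A.E.cast e₁ (A.act h a v) = A.act h' (G.castL e₁ e₂ a) (A.E.cast e₂ v) := by
  subst e₁ e₂
  rfl

end GerbeModule

/-! ### Local sections -/

section LocalSections
variable {X W Z : Type*} [DiffeologicalSpace X] [DiffeologicalSpace W] [DiffeologicalSpace Z]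

/-- A section of `r : W → Z` that is smooth on the open set `U`. -/
structure LocSec (r : W → Z) where
  U : Set Z
  isOpen_U : IsOpen[dTopology] U
  s : Z → W
  right_inv : ∀ z, r (s z) = z
  smooth : ∀ (n : ℕ) (p : Euc n → Z), IsPlot p → (∀ t, p t ∈ U) → IsPlot fun t => s (p t)

/-- A map that admits local smooth sections. -/
def LocSplit (r : W → Z) : Prop := ∀ z, ∃ σ : LocSec r, z ∈ σ.U

theorem LocSplit.surjective {r : W → Z} (h : LocSplit r) : Function.Surjective r := fun z => by
  obtain ⟨σ, -⟩ := h z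
  exact ⟨σ.s z, σ.right_inv z⟩

/-- Outside its domain a local section is extended by an arbitrary choice of preimages, which exist
because the local sections reach every point. Total sections keep subtypes out of the frames built
from them. -/
theorem locSplit_of_sections {r : W → Z} (h : ∀ z, ∃ U : Set Z, IsOpen[dTopology] U ∧ z ∈ U ∧
    ∃ s : U → W, DSmooth s ∧ ∀ x, r (s x) = x) : LocSplit r := by
  classical
  have hs : ∀ z, ∃ y, r y = z := fun z => by
    obtain ⟨U, -, hz, s, -, hs⟩ := h z
    exact ⟨s ⟨z, hz⟩, hs _⟩
  choose g hg using hs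
  intro z
  obtain ⟨U, hU, hz, s, hs, hs'⟩ := h z
  refine ⟨⟨U, hU, fun z => if hz : z ∈ U then s ⟨z, hz⟩ else g z, fun z => ?_,
    fun n p hp hpU => ?_⟩, hz⟩
  · by_cases hz : z ∈ U
    · simp only [dif_pos hz, hs']
    · simp only [dif_neg hz, hg]
  · simp only [dif_pos (hpU _)]
    exact hs n (fun t => ⟨p t, hpU t⟩) hp

theorem BundleGerbe.locSplit {M : Type u} [DiffeologicalSpace M] (G : BundleGerbe.{u, v} M) :
    LocSplit G.π :=
  locSplit_of_sections G.locally_split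

theorem LocSplit.sections {r : W → Z} (h : LocSplit r) (z : Z) : ∃ U : Set Z,
    IsOpen[dTopology] U ∧ z ∈ U ∧ ∃ s : U → W, DSmooth s ∧ ∀ x, r (s x) = x := by
  obtain ⟨σ, hz⟩ := h z
  exact ⟨σ.U, σ.isOpen_U, hz, fun x => σ.s x, fun n p hp => σ.smooth n _ hp fun t => (p t).2,
    fun x => σ.right_inv x⟩

/-- The section is smooth only along plots inside `σ.U`, so openness is tested near each parameter
after reparametrising the plot into `σ.U`. -/
theorem LocSec.isOpen_preimage {r : W → Z} (σ : LocSec r) {V : Set W} (hV : IsOpen[dTopology] V) :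
    IsOpen[dTopology] (σ.U ∩ σ.s ⁻¹' V) := by
  refine isOpen_iff_preimages_plots.2 fun n p hp => isOpen_iff_mem_nhds.2 fun t ht => ?_
  obtain ⟨b, hb, hbO, c, hc, hbc⟩ := exists_reparam (isOpen_preimage_plot hp σ.isOpen_U) ht.1
  have h1 := isOpen_preimage_plot (σ.smooth n _ (isPlot_reparam hp hb) hbO) hV
  have h2 := hc.continuousAt.preimage_mem_nhds (h1.mem_nhds (by
    change σ.s (p (b (c t))) ∈ V
    rw [hbc.self_of_nhds]
    exact ht.2))
  filter_upwards [h2, hbc, (isOpen_preimage_plot hp σ.isOpen_U).mem_nhds ht.1] with x h3 h4 h5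
  refine ⟨h5, ?_⟩
  change σ.s (p (b (c x))) ∈ V at h3
  rwa [h4] at h3

theorem LocSplit.comp {r : W → Z} {ρ : Z → X} (hr : LocSplit r) (hρ : LocSplit ρ) :
    LocSplit fun w => ρ (r w) := by
  intro x
  obtain ⟨σ, hσ⟩ := hρ x
  obtain ⟨τ, hτ⟩ := hr (σ.s x)
  exact ⟨⟨σ.U ∩ σ.s ⁻¹' τ.U, σ.isOpen_preimage τ.isOpen_U, fun x => τ.s (σ.s x),
    fun x => by rw [τ.right_inv, σ.right_inv],
    fun n p hp hpU => τ.smooth n _ (σ.smooth n p hp fun t => (hpU t).1) fun t => (hpU t).2⟩,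
    hσ, hτ⟩

theorem FibProd.locSplit_snd {π : Z → X} {ρ : W → X} (h : LocSplit π) (hρ : DSmooth ρ) :
    LocSplit (FibProd.snd π ρ) := by
  intro z
  obtain ⟨σ, hσ⟩ := h (ρ z)
  exact ⟨⟨ρ ⁻¹' σ.U, BundleGerbeK.isOpen_preimage hρ σ.isOpen_U,
    fun z => ⟨(σ.s (ρ z), z), σ.right_inv _⟩, fun z => rfl,
    fun n p hp hpU => ⟨σ.smooth n _ (hρ n p hp) hpU, hp⟩⟩, hσ⟩

theorem FibProd.locSplit_fst {π : Z → X} {ρ : W → X} (h : LocSplit ρ) (hπ : DSmooth π) :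
    LocSplit (FibProd.fst π ρ) := by
  intro z
  obtain ⟨σ, hσ⟩ := h (π z)
  exact ⟨⟨π ⁻¹' σ.U, BundleGerbeK.isOpen_preimage hπ σ.isOpen_U,
    fun z => ⟨(z, σ.s (π z)), (σ.right_inv _).symm⟩, fun z => rfl,
    fun n p hp hpU => ⟨hp, σ.smooth n _ (hπ n p hp) hpU⟩⟩, hσ⟩

end LocalSections

/-! ### Descent of bundle gerbe modules along a locally split map -/

section Refine
variable {M : Type u} [DiffeologicalSpace M] (J : BundleGerbe.{u, v} M) {W : Type w}
  [DiffeologicalSpace W] (r : W → J.Y) (hr : DSmooth r) (hs : LocSplit r)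

/-- The bundle gerbe on `W → M` pulled back from `Z → M` along `r : W → Z`. -/
@[reducible]
def BundleGerbe.refine : BundleGerbe.{u, w} M where
  Y := W
  π w := J.π (r w)
  smooth_π := J.smooth_π.comp hr
  locally_split := (hs.comp J.locSplit).sections
  L := J.L.pullback (fun q => pair (y₁ := r q.1.1) (y₂ := r q.1.2) q.2)
    fun n _ hp => ⟨hr n _ hp.1, hr n _ hp.2⟩
  rank_one q := J.rank_one _
  mul h k := J.mul _ _
  isometric_mul h k := J.isometric_mul _ _
  smooth_mul := by
    rintro _ ⟨_, ⟨e, he, rfl⟩, rfl⟩ _ ⟨_, ⟨e', he', rfl⟩, rfl⟩ _ ⟨_, ⟨g, hg, rfl⟩, rfl⟩ i j k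
    exact (J.smooth_mul _ ⟨e, he, rfl⟩ _ ⟨e', he', rfl⟩ _ ⟨g, hg, rfl⟩ i j k).comp
      (X := Fib3 fun w : W => J.π (r w))
      (g := fun q => ⟨(r q.1.1, r q.1.2.1, r q.1.2.2), q.2.1, q.2.2⟩)
      (fun n _ hp => ⟨hr n _ hp.1, hr n _ hp.2.1, hr n _ hp.2.2⟩)
  mul_assoc h k l a b c := J.mul_assoc _ _ _ a b c

variable {J}

/-- The pull-back of a module along `r : W → Z`. -/
@[reducible]
def GerbeModule.refine (F : GerbeModule J) : GerbeModule (J.refine r hr hs) where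
  E := F.E.pullback r hr
  act h := F.act _
  isometric_act h := F.isometric_act _
  smooth_act := by
    rintro _ ⟨l, hl, rfl⟩ _ ⟨_, ⟨e, he, rfl⟩, rfl⟩ _ ⟨_, ⟨e', he', rfl⟩, rfl⟩ i j k
    exact (F.smooth_act l hl _ ⟨e, he, rfl⟩ _ ⟨e', he', rfl⟩ i j k).comp
      (X := Fib2 fun w : W => J.π (r w))
      (g := fun q => pair (y₁ := r q.1.1) (y₂ := r q.1.2) q.2)
      (fun n _ hp => ⟨hr n _ hp.1, hr n _ hp.2⟩)
  mul_act h k a b v := F.mul_act _ _ a b v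

namespace GerbeModule
variable {r hr hs}
variable (A : GerbeModule (J.refine r hr hs))

theorem act_unit {w : W} (v : A.E.fiber w) : A.act rfl (J.unit rfl) v = v := by
  -- The refined gerbe has at (w, w) the same line with the same product as `J` at (r(w), r(w)), and
  -- `one_eq` determines the unit element from these.
  have h : (J.refine r hr hs).one w = J.unit (y₁ := r w) rfl := by
    have h1 : ‖J.one (r w)‖ = 1 := J.norm_one (r w)
    refine ((J.refine r hr hs).one_eq (y := w) (u := J.one (r w)) h1).trans ?_
    change ⟪J.mul rfl rfl (J.one (r w)) (J.one (r w)), J.one (r w)⟫_ℂ • J.one (r w) = _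
    rw [J.one_mul_one, inner_self_unit h1, one_smul]
    rfl
  rw [← h]
  exact A.act_one w v

/-- This is the cocycle condition of the descent data: the product of two units is a unit. -/
theorem act_unit_unit {w₁ w₂ w₃ : W} (e : r w₁ = r w₂) (e' : r w₂ = r w₃) (v : A.E.fiber w₃) :
    A.act (congrArg J.π e) (J.unit e) (A.act (congrArg J.π e') (J.unit e') v) =
      A.act (congrArg J.π (e.trans e')) (J.unit (e.trans e')) v := by
  rw [← A.mul_act, ← J.unit_mul_unit e e']

theorem act_smooth_refine {n : ℕ} {p₁ p₂ : Euc n → W} (hp₁ : IsPlot p₁) (hp₂ : IsPlot p₂)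
    {h : ∀ t, J.π (r (p₁ t)) = J.π (r (p₂ t))} {l : ∀ t, J.L.fiber (pair (h t))}
    {s : ∀ t, A.E.fiber (p₂ t)} (hl : IsSmoothAlong J.L (fun t => pair (h t)) l)
    (hs' : IsSmoothAlong A.E p₂ s) : IsSmoothAlong A.E p₁ fun t => A.act (h t) (l t) (s t) := by
  refine A.act_smooth hp₁ hp₂ (h := h) ?_ hs'
  exact isSmoothAlong_pullback.2 hl

/-- The descent isomorphisms. -/
def transport {w₁ w₂ : W} (e : r w₁ = r w₂) : A.E.fiber w₂ ≃ₗᵢ[ℂ] A.E.fiber w₁ :=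
  LinearEquiv.isometryOfInner
    { A.act (congrArg J.π e) (J.unit e) with
      invFun := A.act (congrArg J.π e.symm) (J.unit e.symm)
      left_inv := fun v => (A.act_unit_unit e.symm e v).trans (A.act_unit v)
      right_inv := fun v => (A.act_unit_unit e e.symm v).trans (A.act_unit v) }
    fun a b => by
      refine (A.isometric_act (congrArg J.π e) (J.unit e) a (J.unit e) b).trans ?_
      rw [inner_self_unit (J.norm_unit e), _root_.one_mul]

theorem transport_apply {w₁ w₂ : W} (e : r w₁ = r w₂) (v : A.E.fiber w₂) :
    A.transport e v = A.act (congrArg J.π e) (J.unit e) v := rfl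

theorem transport_transport {w₁ w₂ w₃ : W} (e : r w₁ = r w₂) (e' : r w₂ = r w₃)
    (v : A.E.fiber w₃) : A.transport e (A.transport e' v) = A.transport (e.trans e') v :=
  A.act_unit_unit e e' v

/-- The common point w₁ disappears. With w₁ a chosen preimage, the choice drops out of the
transition functions of the descended bundle. -/
theorem inner_transport {w₁ w₂ w₃ : W} (e : r w₁ = r w₂) (e' : r w₁ = r w₃)
    (a : A.E.fiber w₂) (b : A.E.fiber w₃) :
    ⟪A.transport e a, A.transport e' b⟫_ℂ = ⟪a, A.transport (e.symm.trans e') b⟫_ℂ := by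
  rw [← LinearIsometryEquiv.inner_map_map (A.transport e) a, transport_transport]

/-- The descent isomorphisms commute with the action: both sides are the action of one element of
`J`, obtained from `l` by a unit on the right or by a unit on the left. -/
theorem act_castL_transport {w₁ w₁' w₂ w₂' : W} (e : r w₁ = r w₁') (e' : r w₂ = r w₂')
    (h : J.π (r w₁) = J.π (r w₂)) (h' : J.π (r w₁') = J.π (r w₂'))
    (l : J.L.fiber (pair h)) (v : A.E.fiber w₂) :
    A.act h' (J.castL e e' l) (A.transport e'.symm v) = A.transport e.symm (A.act h l v) := by
  rw [transport_apply, transport_apply, ← A.mul_act, ← A.mul_act]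
  refine congrArg (fun x => A.act _ x v) ?_
  exact (J.cast_mul_unit e e' l).trans (J.unit_mul_cast e.symm l).symm

theorem transport_smooth {n : ℕ} {p₁ p₂ : Euc n → W} (hp₁ : IsPlot p₁) (hp₂ : IsPlot p₂)
    (e : ∀ t, r (p₁ t) = r (p₂ t)) {s : ∀ t, A.E.fiber (p₂ t)} (hs' : IsSmoothAlong A.E p₂ s) :
    IsSmoothAlong A.E p₁ fun t => A.transport (e t) (s t) := by
  exact A.act_smooth_refine hp₁ hp₂ (h := fun t => congrArg J.π (e t))
    (J.isSmoothAlong_unit (hr n _ hp₁) e) hs'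

/-- A preimage under `r`. -/
def preim (hs : LocSplit r) (z : J.Y) : W := (hs.surjective z).choose

theorem r_preim (hs : LocSplit r) (z : J.Y) : r (preim hs z) = z := (hs.surjective z).choose_spec

/-- The frame of the descended bundle given by a local section of `r` and a local frame. -/
@[reducible]
def descFrame (σ : LocSec r) (e : Frame A.E.fiber) : Frame fun z => A.E.fiber (preim hs z) where
  ι := e.ι
  dom := σ.U ∩ σ.s ⁻¹' e.dom
  isOpen_dom := σ.isOpen_preimage e.isOpen_dom
  vec i z := A.transport ((r_preim hs z).trans (σ.right_inv z).symm) (e.vec i (σ.s z))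
  orthonormal z hz := (e.orthonormal _ hz.2).comp_linearIsometryEquiv _
  span z hz := by
    have h := ((e.basis hz.2).map
      (A.transport ((r_preim hs z).trans (σ.right_inv z).symm))).toBasis.span_eq
    refine h.ge.trans (Submodule.span_mono ?_)
    rintro _ ⟨i, rfl⟩
    exact ⟨i, by simp⟩

/-- The underlying bundle of the descended module. -/
@[reducible]
def descBundle : HermBundle J.Y where
  -- The preimage is chosen without any continuity. Smoothness comes from the frames alone, which
  -- carry frames of `A` along local sections of `r` to the chosen fibre.
  fiber z := A.E.fiber (preim hs z)
  atlas := {f | ∃ (σ : LocSec r) (e : Frame A.E.fiber), e ∈ A.E.atlas ∧ f = A.descFrame σ e}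
  cover z := by
    obtain ⟨σ, hσ⟩ := hs z
    obtain ⟨e, he, h⟩ := A.E.cover (σ.s z)
    exact ⟨_, ⟨σ, e, he, rfl⟩, hσ, h⟩
  smooth := by
    rintro _ ⟨σ, e, he, rfl⟩ _ ⟨τ, f, hf, rfl⟩ i j
    refine smoothFunOn_of_plots (isOpen_inter (Frame.isOpen_dom _) (Frame.isOpen_dom _))
      fun n p hp hd => ?_
    have hσ := σ.smooth n p hp fun t => (hd t).1.1
    have hτ := τ.smooth n p hp fun t => (hd t).2.1
    refine contDiff_congr_fun ((isSmoothAlong_vec hσ he (fun t => (hd t).1.2) i).inner hσ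
      (A.transport_smooth hσ hτ (fun t => (σ.right_inv _).trans (τ.right_inv _).symm)
        (isSmoothAlong_vec hτ hf (fun t => (hd t).2.2) j))) fun t => ?_
    exact A.inner_transport _ _ _ _

/-- Any smooth lift `q` of the plot `p` may be used: it is related by smooth descent isomorphisms to
the local sections that define the frames. -/
theorem isSmoothAlong_desc {n : ℕ} {p : Euc n → J.Y} (hp : IsPlot p) {q : Euc n → W}
    (hq : IsPlot q) (e : ∀ t, p t = r (q t)) {s : ∀ t, A.E.fiber (q t)}
    (hs' : IsSmoothAlong A.E q s) :
    IsSmoothAlong A.descBundle p fun t => A.transport ((r_preim hs (p t)).trans (e t)) (s t) := by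
  refine IsSmoothAlong.of_local hp fun t => ?_
  obtain ⟨_, ⟨σ, f, hf, rfl⟩, hO, ht⟩ := exists_frame_nhds A.descBundle hp t
  refine ⟨_, hO, ht, fun g hg hgO => ?_⟩
  have hpg : IsPlot fun x => p (g x) := isPlot_reparam hp hg
  have hqg : IsPlot fun x => q (g x) := isPlot_reparam hq hg
  refine isSmoothAlong_of_frame hpg ⟨σ, f, hf, rfl⟩ hgO fun i => ?_
  have hσ := σ.smooth n _ hpg fun t => (hgO t).1
  refine contDiff_congr_fun ((isSmoothAlong_vec hσ hf (fun t => (hgO t).2) i).inner hσ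
      (A.transport_smooth hσ hqg (fun t => (σ.right_inv _).trans (e _)) (hs'.reparam hg)))
    fun t => ?_
  exact A.inner_transport _ _ _ _

/-- The module for `J` to which a module for the refinement of `J` descends. -/
@[reducible]
def desc : GerbeModule J where
  E := A.descBundle
  act {z₁ z₂} h := A.act (((congrArg J.π (r_preim hs z₁)).trans h).trans
      (congrArg J.π (r_preim hs z₂)).symm) ∘ₗ
    (J.castL (r_preim hs z₁).symm (r_preim hs z₂).symm).toLinearEquiv.toLinearMap
  isometric_act {z₁ z₂} h a v b w := by
    refine (A.isometric_act _ _ v _ w).trans ?_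
    congr 1
    exact LinearIsometryEquiv.inner_map_map _ a b
  smooth_act := by
    refine isSmoothBilin_of_frames ?_
    rintro l hl _ ⟨_, ⟨σ, f, hf, rfl⟩, rfl⟩ i j n p hp hd hd'
    refine isSmoothAlong_pullback.2 ?_
    have hp₁ : IsPlot fun t => (p t).1.1 := hp.1
    have hp₂ : IsPlot fun t => (p t).1.2 := hp.2
    refine IsSmoothAlong.of_local hp₁ fun t => ?_
    -- The section `σ` of the frame lifts the second point, and `τ` lifts the first. The action is
    -- smooth at these lifts, and equivariance of the descent isomorphisms moves it to the chosen
    -- preimages.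
    obtain ⟨τ, hτ⟩ := hs (p t).1.1
    refine ⟨_, isOpen_preimage_plot hp₁ τ.isOpen_U, hτ, fun g hg hgO => ?_⟩
    have hσ := σ.smooth n _ (isPlot_reparam hp₂ hg) fun x => (hd' (g x)).1
    have hτ := τ.smooth n _ (isPlot_reparam hp₁ hg) hgO
    have h1 : IsSmoothAlong J.L (fun x => p (g x)) fun x => l.vec i (p (g x)) :=
      isSmoothAlong_vec (isPlot_reparam hp hg) hl (fun x => hd (g x)) i
    have hπ : ∀ x, J.π (r (τ.s (p (g x)).1.1)) = J.π (r (σ.s (p (g x)).1.2)) := fun x =>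
      ((congrArg J.π (τ.right_inv _)).trans (p (g x)).2).trans (congrArg J.π (σ.right_inv _)).symm
    have h2 := J.isSmoothAlong_castL (p₁ := fun x => (p (g x)).1.1) (p₂ := fun x => (p (g x)).1.2)
      (fun x => (τ.right_inv _).symm) (fun x => (σ.right_inv _).symm) (h := fun x => (p (g x)).2)
      (h' := hπ) h1
    have h3 := A.act_smooth_refine hτ hσ h2
      (isSmoothAlong_vec hσ hf (fun x => (hd' (g x)).2) j)
    refine (A.isSmoothAlong_desc (isPlot_reparam hp₁ hg) hτ (fun x => (τ.right_inv _).symm)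
      h3).congr fun x => ?_
    refine Eq.trans ?_ (A.act_castL_transport ((τ.right_inv _).trans (r_preim hs _).symm)
      ((σ.right_inv _).trans (r_preim hs _).symm) (hπ x)
      (((congrArg J.π (r_preim hs _)).trans (p (g x)).2).trans (congrArg J.π (r_preim hs _)).symm)
      _ _)
    rw [J.castL_castL]
    rfl
  mul_act {z₁ z₂ z₃} h k a b v := by
    refine Eq.trans ?_ (A.mul_act _ _ _ _ v)
    exact congrArg (fun x => A.act _ x v) (J.cast_mul_cast _ _ _ a b).symm

/-- The isomorphism at `w` is the descent isomorphism from `w` to the chosen preimage of r(w). It is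
smooth because `w` is itself a lift of r(w). -/
theorem exists_descent : ∃ F : GerbeModule J, Nonempty (ModuleIso A (F.refine r hr hs)) := by
  refine ⟨A.desc, ⟨{ BundleIso.ofIsometry (fun w => (A.transport (r_preim hs (r w))).toLinearEquiv)
    ?_ ?_ with map_act := ?_ }⟩⟩
  · refine isSmoothHom_of_sections fun n p hp s hs' => ?_
    exact isSmoothAlong_pullback.2 (A.isSmoothAlong_desc (hr n _ hp) hp (fun t => rfl) hs')
  · exact fun w a b => LinearIsometryEquiv.inner_map_map _ a b
  · intro y₁ y₂ h a v
    exact (A.act_castL_transport (r_preim hs (r y₁)).symm (r_preim hs (r y₂)).symm h _ a v).symm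

/-- Plots of the base of `r` lift locally, so smoothness of a section can be tested after pulling
back along `r`. -/
theorem isSmoothAlong_of_refine {F : GerbeModule J} {n : ℕ} {p : Euc n → J.Y} (hp : IsPlot p)
    {s : ∀ t, F.E.fiber (p t)}
    (h : ∀ f : Euc n → Euc n, ContDiff ℝ ∞ f → ∀ q : Euc n → W, IsPlot q →
      ∀ e : ∀ t, p (f t) = r (q t),
        IsSmoothAlong (F.refine r hr hs).E q fun t => F.E.cast (e t) (s (f t))) :
    IsSmoothAlong F.E p s := by
  refine IsSmoothAlong.of_local hp fun t => ?_
  obtain ⟨τ, hτ⟩ := hs (p t)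
  refine ⟨_, isOpen_preimage_plot hp τ.isOpen_U, hτ, fun f hf hfO => ?_⟩
  have hpf : IsPlot fun x => p (f x) := isPlot_reparam hp hf
  have h1 := isSmoothAlong_pullback.1 (h f hf _ (τ.smooth n _ hpf hfO) fun t =>
    (τ.right_inv _).symm)
  refine (isSmoothAlong_cast (fun x => τ.right_inv _) h1).congr fun x => ?_
  rw [HermBundle.cast_cast]
  rfl

/-- A module isomorphism commutes with the action of units, and these are the descent data; hence
its values at two points of `W` with the same image under `r` agree. -/
theorem cast_equiv_refine {F F' : GerbeModule J}
    (φ : ModuleIso (F.refine r hr hs) (F'.refine r hr hs)) {w₁ w₂ : W} (e : r w₁ = r w₂)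
    (v : F.E.fiber (r w₁)) :
    F'.E.cast e (φ.equiv w₁ v) = φ.equiv w₂ (F.E.cast e v) := by
  rw [F'.cast_eq_act e (h := congrArg J.π e.symm), F.cast_eq_act e (h := congrArg J.π e.symm)]
  exact (φ.map_act (y₁ := w₂) (y₂ := w₁) (congrArg J.π e.symm) (J.unit e.symm) v).symm

theorem isSmoothHom_descent {F F' : GerbeModule J}
    (φ : ModuleIso (F.refine r hr hs) (F'.refine r hr hs)) :
    IsSmoothHom F.E F'.E fun z => ((F.E.cast (r_preim hs z).symm).toLinearEquiv.trans
      ((φ.equiv (preim hs z)).trans (F'.E.cast (r_preim hs z)).toLinearEquiv)).toLinearMap := by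
  refine isSmoothHom_of_sections fun n p hp s hs' => ?_
  refine isSmoothAlong_of_refine (hr := hr) (hs := hs) hp fun f hf q hq e => ?_
  have h1 := isSmoothAlong_cast e (hs'.reparam hf)
  refine (φ.smooth.apply hq (isSmoothAlong_pullback.2 h1)).congr fun t => ?_
  change F'.E.cast (e t) (F'.E.cast _ (φ.equiv _ (F.E.cast _ _))) = φ.equiv _ (F.E.cast _ _)
  rw [HermBundle.cast_cast]
  refine (cast_equiv_refine φ ((r_preim hs _).trans (e t)) _).trans ?_
  rw [HermBundle.cast_cast]

/-- Isomorphisms of modules descend. -/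
theorem iso_of_refine {F F' : GerbeModule J} (φ : ModuleIso (F.refine r hr hs) (F'.refine r hr hs)) :
    Nonempty (ModuleIso F F') := by
  have hc : ∀ (H : GerbeModule J) {x y : J.Y} (h : x = y) (v : H.E.fiber y),
      (H.E.cast h).symm v = H.E.cast h.symm v := fun H x y h v => by subst h; rfl
  refine ⟨{ equiv := fun z => (F.E.cast (r_preim hs z).symm).toLinearEquiv.trans
              ((φ.equiv (preim hs z)).trans (F'.E.cast (r_preim hs z)).toLinearEquiv)
            smooth := isSmoothHom_descent φ
            smooth_symm := ?_
            map_act := ?_ }⟩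
  · convert isSmoothHom_descent φ.symm using 2 with z
    refine LinearMap.ext fun v => ?_
    change (F.E.cast _).symm ((φ.equiv _).symm ((F'.E.cast _).symm v)) =
      F.E.cast _ ((φ.equiv _).symm (F'.E.cast _ v))
    rw [hc, hc]
  · intro z₁ z₂ h a v
    change F'.E.cast _ (φ.equiv _ (F.E.cast _ _)) =
      F'.act h a (F'.E.cast _ (φ.equiv _ (F.E.cast _ v)))
    have h' : J.π (r (preim hs z₁)) = J.π (r (preim hs z₂)) :=
      ((congrArg J.π (r_preim hs z₁)).trans h).trans (congrArg J.π (r_preim hs z₂)).symm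
    rw [F.cast_act (r_preim hs z₁).symm (r_preim hs z₂).symm (h' := h') a]
    refine (congrArg (F'.E.cast _) (φ.map_act (y₁ := preim hs z₁) (y₂ := preim hs z₂) h'
      (J.castL (r_preim hs z₁).symm (r_preim hs z₂).symm a) _)).trans ?_
    refine (F'.cast_act (r_preim hs z₁) (r_preim hs z₂) (h' := h) _ _).trans ?_
    rw [J.castL_castL]
    rfl

end GerbeModule
end Refine

/-! ### Cancellation of line bundles -/

section LinePairing

/-- The map ψ is T ⊗ B → T ⊗ T' ⊗ A → A, and its inverse sends `a` to t₀ ⊗ θ(t₀' ⊗ a). Duality of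
lines enters as a pairing with exchange identities, so that the roles of K and K* can be
interchanged without a double dual. -/
theorem exists_cancel {T T' A B : Type} [AddCommGroup T] [Module ℂ T] [AddCommGroup T']
    [Module ℂ T'] [AddCommGroup A] [Module ℂ A] [AddCommGroup B] [Module ℂ B]
    (e : T →ₗ[ℂ] T' →ₗ[ℂ] ℂ) (hT : ∀ s t t', e s t' • t = e t t' • s)
    (hT' : ∀ t s' t', e t s' • t' = e t t' • s') (h0 : ∃ t t', e t t' = 1)
    (θ : T' ⊗[ℂ] A ≃ₗ[ℂ] B) :
    ∃ ψ : T ⊗[ℂ] B ≃ₗ[ℂ] A, ∀ t x,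
      ψ (t ⊗ₜ θ x) = TensorProduct.lid ℂ A ((e t).rTensor A x) := by
  obtain ⟨t₀, t₀', h0⟩ := h0
  let f : T ⊗[ℂ] B →ₗ[ℂ] A := TensorProduct.lift (LinearMap.mk₂ ℂ
    (fun t b => TensorProduct.lid ℂ A ((e t).rTensor A (θ.symm b)))
    (fun s t b => by rw [map_add, LinearMap.rTensor_add, LinearMap.add_apply, map_add])
    (fun c t b => by rw [map_smul, LinearMap.rTensor_smul, LinearMap.smul_apply, map_smul])
    (fun t b b' => by simp only [map_add])
    (fun c t b => by simp only [map_smul]))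
  have hf : ∀ t x, f (t ⊗ₜ θ x) = TensorProduct.lid ℂ A ((e t).rTensor A x) := fun t x => by
    change TensorProduct.lid ℂ A ((e t).rTensor A (θ.symm (θ x))) = _
    rw [LinearEquiv.symm_apply_apply]
  refine ⟨{ f with
    invFun := fun a => t₀ ⊗ₜ θ (t₀' ⊗ₜ a)
    left_inv := fun x => ?_
    right_inv := fun a => ?_ }, hf⟩
  · change t₀ ⊗ₜ θ (t₀' ⊗ₜ f x) = x
    induction x with
    | zero => simp
    | add x y hx hy => simp only [map_add, TensorProduct.tmul_add, hx, hy]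
    | tmul t b =>
      obtain ⟨x, rfl⟩ := θ.surjective b
      rw [hf]
      induction x with
      | zero => simp
      | add x y hx hy => simp only [map_add, TensorProduct.tmul_add, hx, hy]
      | tmul t' a =>
        -- The scalar e(t, t') on t₀ is exchanged for e(t₀, t') on `t`; moved to the other factor,
        -- it turns t₀' into e(t₀, t₀') t' = t'.
        rw [LinearMap.rTensor_tmul, TensorProduct.lid_tmul, TensorProduct.tmul_smul, map_smul,
          TensorProduct.tmul_smul, TensorProduct.smul_tmul', ← hT t₀ t t',
          TensorProduct.smul_tmul, ← map_smul, TensorProduct.smul_tmul', hT', h0, one_smul]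
  · change f (t₀ ⊗ₜ θ (t₀' ⊗ₜ a)) = a
    rw [hf, LinearMap.rTensor_tmul, TensorProduct.lid_tmul, h0, one_smul]

variable {X : Type*} [DiffeologicalSpace X]

/-- A smooth duality of line bundles. -/
structure LinePairing (K K' : HermBundle X) where
  e : ∀ x, K.fiber x →ₗ[ℂ] K'.fiber x →ₗ[ℂ] ℂ
  left : ∀ x s t t', e x s t' • t = e x t t' • s
  right : ∀ x t s' t', e x t s' • t' = e x t t' • s'
  smooth : ∀ (n : ℕ) (p : Euc n → X), IsPlot p → ∀ (s : ∀ t, K.fiber (p t))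
    (s' : ∀ t, K'.fiber (p t)), IsSmoothAlong K p s → IsSmoothAlong K' p s' →
      ContDiff ℝ ∞ fun t => e (p t) (s t) (s' t)
  exists_one : ∀ x, ∃ t t', e x t t' = 1
  exists_local : ∀ (n : ℕ) (p : Euc n → X), IsPlot p → ∀ t, ∃ O, IsOpen O ∧ t ∈ O ∧
    ∃ (s : ∀ x, K.fiber x) (s' : ∀ x, K'.fiber x), (∀ t ∈ O, e (p t) (s (p t)) (s' (p t)) = 1) ∧
      ∀ f : Euc n → Euc n, ContDiff ℝ ∞ f → (∀ x, f x ∈ O) →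
        IsSmoothAlong K (fun x => p (f x)) (fun x => s (p (f x))) ∧
        IsSmoothAlong K' (fun x => p (f x)) fun x => s' (p (f x))

theorem dual_apply_smul_line {V : Type} [NormedAddCommGroup V] [InnerProductSpace ℂ V]
    (h : Module.finrank ℂ V = 1) (f : StrongDual ℂ V) (s t : V) : f s • t = f t • s := by
  obtain ⟨u, hu⟩ := exists_unit h
  rw [← line_eq h hu s, ← line_eq h hu t]
  simp only [map_smul, smul_smul, smul_eq_mul]
  congr 1
  ring

theorem dual_smul_line {V : Type} [NormedAddCommGroup V] [InnerProductSpace ℂ V]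
    (h : Module.finrank ℂ V = 1) (f g : StrongDual ℂ V) (t : V) : f t • g = g t • f := by
  ext s
  have := congrArg g (dual_apply_smul_line h f s t)
  simp only [map_smul, smul_eq_mul, smul_apply] at this ⊢
  linear_combination -this

/-- The evaluation of linear forms. -/
def evalₗ (V : Type) [NormedAddCommGroup V] [InnerProductSpace ℂ V] :
    V →ₗ[ℂ] StrongDual ℂ V →ₗ[ℂ] ℂ :=
  LinearMap.mk₂ ℂ (fun t f => f t) (fun _ _ f => map_add f _ _) (fun _ _ f => map_smul f _ _)
    (fun _ _ _ => rfl) (fun _ _ _ => rfl)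

theorem toDual_apply_self {V : Type} [NormedAddCommGroup V] [InnerProductSpace ℂ V]
    [CompleteSpace V] {u : V} (hu : ‖u‖ = 1) : InnerProductSpace.toDual ℂ V u u = 1 := by
  rw [InnerProductSpace.toDual_apply_apply, inner_self_unit hu]

def LinePairing.dual (K : HermBundle X) (hK : ∀ x, Module.finrank ℂ (K.fiber x) = 1) :
    LinePairing K K.dual where
  e x := evalₗ (K.fiber x)
  left x s t t' := dual_apply_smul_line (hK x) t' s t
  right x t s' t' := dual_smul_line (hK x) s' t' t
  smooth n p hp s s' hs hs' := hs'.dual_apply hp hs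
  exists_one x := by
    obtain ⟨u, hu⟩ := exists_unit (hK x)
    exact ⟨u, InnerProductSpace.toDual ℂ _ u, toDual_apply_self hu⟩
  exists_local n p hp t := by
    obtain ⟨O, hO, ht, s, h, h'⟩ := exists_unit_nhds hK hp t
    exact ⟨O, hO, ht, s, fun x => InnerProductSpace.toDual ℂ _ (s x),
      fun t ht => toDual_apply_self (h t ht), fun f hf hfO => ⟨h' f hf hfO, (h' f hf hfO).toDual⟩⟩

def LinePairing.flip {K K' : HermBundle X} (P : LinePairing K K') : LinePairing K' K where
  e x := (P.e x).flip
  left x s t t' := P.right x t' s t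
  right x t s' t' := P.left x s' t' t
  smooth n p hp s s' hs hs' := P.smooth n p hp s' s hs' hs
  exists_one x := by
    obtain ⟨t, t', h⟩ := P.exists_one x
    exact ⟨t', t, h⟩
  exists_local n p hp t := by
    obtain ⟨O, hO, ht, s, s', h, h'⟩ := P.exists_local n p hp t
    exact ⟨O, hO, ht, s', s, h, fun f hf hfO => (h' f hf hfO).symm⟩

/-- Fibrewise this is `exists_cancel`. For smoothness, ψ is a contraction after θ⁻¹, and its inverse
is a ↦ s ⊗ θ(s' ⊗ a) for any local smooth sections `s`, `s'` that pair to 1. -/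
theorem LinePairing.cancel {K K' A B : HermBundle X} (P : LinePairing K K')
    (θ : BundleIso (K'.tensor A) B) : ∃ ψ : BundleIso (K.tensor B) A, ∀ x t t' a,
      ψ.equiv x (t ⊗ₜ θ.equiv x (t' ⊗ₜ a)) = P.e x t t' • a := by
  have h := fun x => exists_cancel (P.e x) (P.left x) (P.right x) (P.exists_one x) (θ.equiv x)
  choose ψ hψ using h
  have hψ' : ∀ x t t' a, ψ x (t ⊗ₜ θ.equiv x (t' ⊗ₜ a)) = P.e x t t' • a := fun x t t' a => by
    rw [hψ, LinearMap.rTensor_tmul, TensorProduct.lid_tmul]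
  refine ⟨⟨ψ, isSmoothHom_tensor fun n p hp s b hs hb => ?_,
    isSmoothHom_of_sections fun n p hp a ha => ?_⟩, hψ'⟩
  · have h1 : IsSmoothBilin K (K'.tensor A) A fun x => LinearMap.mk₂ ℂ
        (fun t y => TensorProduct.lid ℂ (A.fiber x) ((P.e x t).rTensor (A.fiber x) y))
        (fun s t b => by rw [map_add, LinearMap.rTensor_add, LinearMap.add_apply, map_add])
        (fun c t b => by rw [map_smul, LinearMap.rTensor_smul, LinearMap.smul_apply, map_smul])
        (fun t b b' => by simp only [map_add])
        (fun c t b => by simp only [map_smul]) := by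
      refine isSmoothBilin_tensor_right fun n p hp r s s' hr hs hs' => ?_
      refine (hs'.smul (P.smooth n p hp r s hr hs)).congr fun t => ?_
      rw [LinearMap.mk₂_apply, LinearMap.rTensor_tmul, TensorProduct.lid_tmul]
    refine (h1.apply hp hs (θ.smooth_symm.apply hp hb)).congr fun t => ?_
    refine Eq.trans ?_ (hψ (p t) (s t) ((θ.equiv (p t)).symm (b t)))
    rw [LinearEquiv.apply_symm_apply]
    rfl
  · refine IsSmoothAlong.of_local hp fun t => ?_
    obtain ⟨O, hO, ht, s, s', h, h'⟩ := P.exists_local n p hp t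
    refine ⟨O, hO, ht, fun f hf hfO => ?_⟩
    obtain ⟨h1, h2⟩ := h' f hf hfO
    refine (h1.tmul (θ.smooth.apply (isPlot_reparam hp hf) (h2.tmul (ha.reparam hf)))).congr
      fun x => ?_
    refine (LinearEquiv.symm_apply_eq _).2 ?_
    refine Eq.trans ?_ (hψ' _ _ _ _).symm
    rw [h _ (hfO x), one_smul]

end LinePairing

/-! ### Fibrewise construction of the actions on `K* ⊗ E` and `K ⊗ F` -/

section LineAct
variable {A B S T V V' : Type} [NormedAddCommGroup A] [InnerProductSpace ℂ A]
  [NormedAddCommGroup B] [InnerProductSpace ℂ B] [NormedAddCommGroup S] [InnerProductSpace ℂ S]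
  [NormedAddCommGroup T] [InnerProductSpace ℂ T] [AddCommGroup V] [Module ℂ V]
  [AddCommGroup V'] [Module ℂ V'] [CompleteSpace S]
  (m : A →ₗ[ℂ] T →ₗ[ℂ] StrongDual ℂ S →ₗ[ℂ] B)

theorem dual_eq_smul_line {V : Type} [NormedAddCommGroup V] [InnerProductSpace ℂ V]
    [CompleteSpace V] (h : Module.finrank ℂ V = 1) {u : V} (hu : ‖u‖ = 1) (f : StrongDual ℂ V) :
    f u • InnerProductSpace.toDual ℂ V u = f := by
  rw [dual_smul_line h, toDual_apply_self hu, one_smul]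

/-- The map `m` identifies A ⊗ T ⊗ S* with the line `B`, so an action of `B` may be prescribed on
the values of `m`. It is defined from one unit vector of each line; both sides of the formula scale
alike, so the formula holds for all vectors. -/
theorem exists_pushAct (hA : Module.finrank ℂ A = 1) (hS : Module.finrank ℂ S = 1)
    (hT : Module.finrank ℂ T = 1) (hm : ∀ a t s, ‖a‖ = 1 → ‖t‖ = 1 → ‖s‖ = 1 →
      ‖m a t (InnerProductSpace.toDual ℂ S s)‖ = 1) (β : A →ₗ[ℂ] V →ₗ[ℂ] V') :
    ∃ γ : B →ₗ[ℂ] StrongDual ℂ T ⊗[ℂ] V →ₗ[ℂ] StrongDual ℂ S ⊗[ℂ] V', ∀ a t f g v,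
      γ (m a t f) (g ⊗ₜ v) = g t • f ⊗ₜ β a v := by
  obtain ⟨a₀, ha⟩ := exists_unit hA
  obtain ⟨t₀, ht⟩ := exists_unit hT
  obtain ⟨s₀, hs⟩ := exists_unit hS
  have hb := hm a₀ t₀ s₀ ha ht hs
  refine ⟨(innerₛₗ ℂ (m a₀ t₀ (InnerProductSpace.toDual ℂ S s₀))).smulRight (TensorProduct.map
    ((LinearMap.toSpanSingleton ℂ _ (InnerProductSpace.toDual ℂ S s₀)) ∘ₗ (evalₗ T t₀)) (β a₀)), fun a t f g v => ?_⟩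
  rw [← line_eq hA ha a, ← line_eq hT ht t, ← dual_eq_smul_line hS hs f]
  simp only [map_smul, LinearMap.smul_apply, LinearMap.smulRight_apply, innerₛₗ_apply_apply,
    inner_self_unit hb, one_smul, TensorProduct.map_tmul, LinearMap.comp_apply,
    LinearMap.toSpanSingleton_apply, smul_eq_mul, evalₗ, LinearMap.mk₂_apply,
    TensorProduct.tmul_smul, ← TensorProduct.smul_tmul', smul_smul]
  congr 1
  ring

/-- The action is a·(t ⊗ v) = s₀ ⊗ m(a, t, s₀*)v, with s₀ ⊗ s₀* the canonical element of S ⊗ S*.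
Multiplying by f(s) gives a formula free of the choice of s₀. -/
theorem exists_pullAct (hS : Module.finrank ℂ S = 1) (δ : B →ₗ[ℂ] V →ₗ[ℂ] V') :
    ∃ γ : A →ₗ[ℂ] T ⊗[ℂ] V →ₗ[ℂ] S ⊗[ℂ] V', ∀ a t f s v,
      f s • γ a (t ⊗ₜ v) = s ⊗ₜ δ (m a t f) v := by
  obtain ⟨s₀, hs⟩ := exists_unit hS
  refine ⟨{
    toFun := fun a => (TensorProduct.mk ℂ S V' s₀) ∘ₗ TensorProduct.lift
      (δ.comp ((m a).flip (InnerProductSpace.toDual ℂ S s₀)))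
    map_add' := fun a b => TensorProduct.ext' fun t v => by simp [TensorProduct.tmul_add]
    map_smul' := fun c a => TensorProduct.ext' fun t v => by simp }, fun a t f s v => ?_⟩
  rw [← line_eq hS hs s, ← dual_eq_smul_line hS hs f]
  simp only [map_smul, smul_apply, toDual_apply_self hs, LinearMap.coe_mk, AddHom.coe_mk,
    LinearMap.comp_apply, TensorProduct.lift.tmul, LinearMap.flip_apply, TensorProduct.mk_apply,
    LinearMap.smul_apply, TensorProduct.tmul_smul, ← TensorProduct.smul_tmul', smul_smul,
    smul_eq_mul, mul_one]
  congr 1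
  ring

end LineAct

/-! ### Twists: stable isomorphisms over an arbitrary common refinement -/

theorem finrank_dual_line {X : Type*} [DiffeologicalSpace X] {K : HermBundle X} {x : X}
    (h : Module.finrank ℂ (K.fiber x) = 1) : Module.finrank ℂ (K.dual.fiber x) = 1 := by
  rw [← h]
  exact (LinearMap.toContinuousLinearMap (𝕜 := ℂ) (E := K.fiber x)
    (F' := ℂ)).finrank_eq.symm.trans Subspace.dual_finrank_eq

/-- A line bundle `K` on a common refinement `W` of `Y → M` and `Z → M`, with isomorphisms
`L_{(y₁,y₂)} ⊗ K_{w₂} ⊗ K_{w₁}^* ≃ J_{(z₁,z₂)}` compatible with the products. -/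
structure Twist {M : Type u} [DiffeologicalSpace M] (G : BundleGerbe.{u, v} M)
    (H : BundleGerbe.{u, w} M) where
  -- An arbitrary refinement rather than the fibre product, so that a trivialisation, which lives on
  -- `Y`, is also a twist.
  W : Type x
  [diffeology : DiffeologicalSpace W]
  p : W → G.Y
  smooth_p : DSmooth p
  split_p : LocSplit p
  q : W → H.Y
  smooth_q : DSmooth q
  split_q : LocSplit q
  π_eq : ∀ w, G.π (p w) = H.π (q w)
  K : HermBundle W
  rank_one : ∀ w, Module.finrank ℂ (K.fiber w) = 1
  m : ∀ {w₁ w₂ : W} (h : G.π (p w₁) = G.π (p w₂)) (k : H.π (q w₁) = H.π (q w₂)),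
    G.L.fiber (pair h) →ₗ[ℂ] K.fiber w₂ →ₗ[ℂ] StrongDual ℂ (K.fiber w₁) →ₗ[ℂ] H.L.fiber (pair k)
  inner_m : ∀ {w₁ w₂ : W} (h : G.π (p w₁) = G.π (p w₂)) (k : H.π (q w₁) = H.π (q w₂)) l t f l' t' f',
    ⟪m h k l t f, m h k l' t' f'⟫_ℂ = ⟪l, l'⟫_ℂ * (⟪t, t'⟫_ℂ * ⟪f, f'⟫_ℂ)
  smooth_m : ∀ {n : ℕ} {p₁ p₂ : Euc n → W} (_ : IsPlot p₁) (_ : IsPlot p₂)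
    {h : ∀ t, G.π (p (p₁ t)) = G.π (p (p₂ t))} {k : ∀ t, H.π (q (p₁ t)) = H.π (q (p₂ t))}
    {l : ∀ t, G.L.fiber (pair (h t))} {s : ∀ t, K.fiber (p₂ t)} {f : ∀ t, K.dual.fiber (p₁ t)},
    IsSmoothAlong G.L (fun t => pair (h t)) l → IsSmoothAlong K p₂ s →
      IsSmoothAlong K.dual p₁ f →
        IsSmoothAlong H.L (fun t => pair (k t)) fun t => m (h t) (k t) (l t) (s t) (f t)
  mul_m : ∀ {w₁ w₂ w₃ : W} (h : G.π (p w₁) = G.π (p w₂)) (k : H.π (q w₁) = H.π (q w₂))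
    (h' : G.π (p w₂) = G.π (p w₃)) (k' : H.π (q w₂) = H.π (q w₃)) l t f l' t' f',
    H.mul k k' (m h k l t f) (m h' k' l' t' f') =
      f' t • m (h.trans h') (k.trans k') (G.mul h h' l l') t' f

attribute [instance] Twist.diffeology

namespace Twist
variable {M : Type u} [DiffeologicalSpace M] {G : BundleGerbe.{u, v} M} {H : BundleGerbe.{u, w} M}
  (α : Twist.{u, v, w, x} G H)

theorem norm_m {w₁ w₂ : α.W} (h : G.π (α.p w₁) = G.π (α.p w₂)) (k : H.π (α.q w₁) = H.π (α.q w₂))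
    {l : G.L.fiber (pair h)} {t : α.K.fiber w₂} {s : α.K.fiber w₁} (hl : ‖l‖ = 1) (ht : ‖t‖ = 1)
    (hs : ‖s‖ = 1) : ‖α.m h k l t (InnerProductSpace.toDual ℂ _ s)‖ = 1 :=
  norm_eq_one_of_inner (by rw [α.inner_m, dual_inner_toDual, inner_self_unit hl,
    inner_self_unit ht, inner_self_unit hs, mul_one, mul_one])

theorem eq_G {w₁ w₂ : α.W} (k : H.π (α.q w₁) = H.π (α.q w₂)) : G.π (α.p w₁) = G.π (α.p w₂) :=
  ((α.π_eq w₁).trans k).trans (α.π_eq w₂).symm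

theorem eq_H {w₁ w₂ : α.W} (h : G.π (α.p w₁) = G.π (α.p w₂)) : H.π (α.q w₁) = H.π (α.q w₂) :=
  ((α.π_eq w₁).symm.trans h).trans (α.π_eq w₂)

/-- A value of `m` on unit vectors generates the line of `H`, so identities linear in that line need
checking only there. -/
theorem exists_m_eq {w₁ w₂ : α.W} (h : G.π (α.p w₁) = G.π (α.p w₂))
    (k : H.π (α.q w₁) = H.π (α.q w₂)) : ∃ l t s, ‖l‖ = 1 ∧ ‖t‖ = 1 ∧ ‖s‖ = 1 ∧
      ∀ j : H.L.fiber (pair k), ∃ c : ℂ, j = c • α.m h k l t (InnerProductSpace.toDual ℂ _ s) := by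
  obtain ⟨l, hl⟩ := exists_unit (G.rank_one (pair h))
  obtain ⟨t, ht⟩ := exists_unit (α.rank_one w₂)
  obtain ⟨s, hs⟩ := exists_unit (α.rank_one w₁)
  exact ⟨l, t, s, hl, ht, hs, fun j => ⟨_, (line_eq (H.rank_one _)
    (α.norm_m h k hl ht hs) j).symm⟩⟩

/-! ### The module K* ⊗ E. -/

section Push
variable (E : GerbeModule G)

/-- The action of `J` on `K* ⊗ E`. -/
def pushAct {w₁ w₂ : α.W} (k : H.π (α.q w₁) = H.π (α.q w₂)) :
    H.L.fiber (pair k) →ₗ[ℂ] StrongDual ℂ (α.K.fiber w₂) ⊗[ℂ] E.E.fiber (α.p w₂) →ₗ[ℂ]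
      StrongDual ℂ (α.K.fiber w₁) ⊗[ℂ] E.E.fiber (α.p w₁) :=
  (exists_pushAct (α.m (α.eq_G k) k) (G.rank_one _) (α.rank_one w₁) (α.rank_one w₂)
    (fun _ _ _ => α.norm_m _ _) (E.act (α.eq_G k))).choose

/-- The action is used only through this formula, which determines it because the values of `m` span
the line of `H`. -/
theorem pushAct_m {w₁ w₂ : α.W} (h : G.π (α.p w₁) = G.π (α.p w₂))
    (k : H.π (α.q w₁) = H.π (α.q w₂)) (l : G.L.fiber (pair h)) (t : α.K.fiber w₂)
    (f : StrongDual ℂ (α.K.fiber w₁)) (g : StrongDual ℂ (α.K.fiber w₂))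
    (v : E.E.fiber (α.p w₂)) :
    α.pushAct E k (α.m h k l t f) (g ⊗ₜ v) = g t • f ⊗ₜ E.act h l v :=
  (exists_pushAct (α.m (α.eq_G k) k) (G.rank_one _) (α.rank_one w₁) (α.rank_one w₂)
    (fun _ _ _ => α.norm_m _ _) (E.act (α.eq_G k))).choose_spec l t f g v

theorem inner_dual_line {V : Type} [NormedAddCommGroup V] [InnerProductSpace ℂ V]
    (h : Module.finrank ℂ V = 1) {t : V} (ht : ‖t‖ = 1) (a b : V) :
    ⟪a, b⟫_ℂ = ⟪a, t⟫_ℂ * ⟪t, b⟫_ℂ := by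
  rw [inner_mul_inner_line h, inner_self_unit ht, mul_one]

theorem inner_dual {w : α.W} {t : α.K.fiber w} (ht : ‖t‖ = 1) (g g' : StrongDual ℂ (α.K.fiber w)) :
    ⟪g, g'⟫_ℂ = (starRingEnd ℂ) (g t) * g' t := by
  rw [dual_inner, inner_dual_line (α.rank_one w) ht, mul_comm, ← inner_conj_symm t]
  congr 1
  · rw [InnerProductSpace.toDual_symm_apply]
  · rw [InnerProductSpace.toDual_symm_apply]

theorem pushAct_isometric {w₁ w₂ : α.W} (k : H.π (α.q w₁) = H.π (α.q w₂)) :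
    IsIsometricBilin (V' := (α.K.dual.tensor (E.E.pullback α.p α.smooth_p)).fiber w₂)
      (V'' := (α.K.dual.tensor (E.E.pullback α.p α.smooth_p)).fiber w₁) (α.pushAct E k) := by
  intro a b a' b'
  obtain ⟨l, t, s, hl, ht, hs, H1⟩ := α.exists_m_eq (α.eq_G k) k
  obtain ⟨c, rfl⟩ := H1 a
  obtain ⟨c', rfl⟩ := H1 a'
  simp only [map_smul, LinearMap.smul_apply, inner_smul_left, inner_smul_right,
    inner_self_unit (α.norm_m (α.eq_G k) k hl ht hs), mul_one, mul_assoc]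
  congr 2
  induction b using TensorProduct.induction_on with
  | zero => simp
  | add x y hx hy => simp only [map_add, inner_add_left, hx, hy]
  | tmul g v =>
  induction b' using TensorProduct.induction_on with
  | zero => simp
  | add x y hx hy => simp only [map_add, inner_add_right, hx, hy]
  | tmul g' v' =>
    rw [pushAct_m, pushAct_m, TensorProduct.smul_tmul', TensorProduct.smul_tmul',
      TensorProduct.inner_tmul, TensorProduct.inner_tmul, inner_smul_left, inner_smul_right,
      dual_inner_toDual, inner_self_unit hs, E.isometric_act, inner_self_unit hl,
      α.inner_dual ht g g', mul_one, one_mul]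

/-- Local smooth unit sections `l`, `r`, `s` give a smooth unit section m(l, r, s*) of the line of
`H`; then `j` acts as its coefficient along that section times the explicit action. -/
theorem pushAct_smooth {n : ℕ} {p₁ p₂ : Euc n → α.W} (hp₁ : IsPlot p₁) (hp₂ : IsPlot p₂)
    {k : ∀ t, H.π (α.q (p₁ t)) = H.π (α.q (p₂ t))} {j : ∀ t, H.L.fiber (pair (k t))}
    {g : ∀ t, α.K.dual.fiber (p₂ t)} {v : ∀ t, E.E.fiber (α.p (p₂ t))}
    (hj : IsSmoothAlong H.L (fun t => pair (k t)) j) (hg : IsSmoothAlong α.K.dual p₂ g)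
    (hv : IsSmoothAlong (E.E.pullback α.p α.smooth_p) p₂ v) :
    IsSmoothAlong (α.K.dual.tensor (E.E.pullback α.p α.smooth_p)) p₁
      fun t => α.pushAct E (k t) (j t) (g t ⊗ₜ v t) := by
  refine IsSmoothAlong.of_local hp₁ fun t => ?_
  have hP : IsPlot fun t => pair (α.eq_G (k t)) := ⟨α.smooth_p n _ hp₁, α.smooth_p n _ hp₂⟩
  obtain ⟨O, hO, ht, l, hl, hl'⟩ := exists_unit_nhds G.rank_one hP t
  obtain ⟨O', hO', ht', s, hs, hs'⟩ := exists_unit_nhds α.rank_one hp₁ t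
  obtain ⟨O'', hO'', ht'', r, hr, hr'⟩ := exists_unit_nhds α.rank_one hp₂ t
  refine ⟨_, (hO.inter hO').inter hO'', ⟨⟨ht, ht'⟩, ht''⟩, fun f hf hfO => ?_⟩
  have h₁ : IsPlot fun x => p₁ (f x) := isPlot_reparam hp₁ hf
  have h₂ : IsPlot fun x => p₂ (f x) := isPlot_reparam hp₂ hf
  have hk : IsPlot fun x => pair (k (f x)) := ⟨α.smooth_q n _ h₁, α.smooth_q n _ h₂⟩
  have hlf := hl' f hf fun x => (hfO x).1.1
  have hsf := hs' f hf fun x => (hfO x).1.2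
  have hrf := hr' f hf fun x => (hfO x).2
  have hm := α.smooth_m h₁ h₂ (h := fun x => α.eq_G (k (f x))) (k := fun x => k (f x)) hlf hrf
    hsf.toDual
  have hvf := isSmoothAlong_pullback.1 (hv.reparam hf)
  have hE : IsSmoothAlong (E.E.pullback α.p α.smooth_p) (fun x => p₁ (f x))
      fun x => E.act (α.eq_G (k (f x))) (l (pair (α.eq_G (k (f x))))) (v (f x)) :=
    isSmoothAlong_pullback.2 (E.act_smooth (α.smooth_p n _ h₁) (α.smooth_p n _ h₂) hlf
      hvf)
  refine ((hsf.toDual.tmul hE).smul ((hm.inner hk (hj.reparam hf)).mul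
    ((hg.reparam hf).dual_apply h₂ hrf))).congr fun x => ?_
  rw [← line_eq (H.rank_one _) (α.norm_m (α.eq_G (k (f x))) (k (f x)) (hl _ (hfO x).1.1)
    (hr _ (hfO x).2) (hs _ (hfO x).1.2)) (j (f x)), map_smul, LinearMap.smul_apply, pushAct_m,
    smul_smul, line_eq (H.rank_one _) (α.norm_m (α.eq_G (k (f x))) (k (f x)) (hl _ (hfO x).1.1)
    (hr _ (hfO x).2) (hs _ (hfO x).1.2))]

/-- The module `K* ⊗ E`. -/
@[reducible]
def push : GerbeModule (H.refine α.q α.smooth_q α.split_q) where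
  E := α.K.dual.tensor (E.E.pullback α.p α.smooth_p)
  act k := α.pushAct E k
  isometric_act k := α.pushAct_isometric E k
  smooth_act := by
    refine isSmoothBilin_of_frames ?_
    rintro _ ⟨j, hj, rfl⟩ _ ⟨_, ⟨g, hg, _, ⟨e, he, rfl⟩, rfl⟩, rfl⟩ i i' n P hP hd hd'
    refine isSmoothAlong_pullback.2 ?_
    have hP₁ : IsPlot fun t => (P t).1.1 := hP.1
    have hP₂ : IsPlot fun t => (P t).1.2 := hP.2
    have hs := isSmoothAlong_vec hP₂ hg (fun t => (hd' t).1) i'.1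
    have hv := isSmoothAlong_vec (E := E.E.pullback α.p α.smooth_p) hP₂ ⟨e, he, rfl⟩
      (fun t => (hd' t).2) i'.2
    have hPq : IsPlot fun t => (pair (y₁ := α.q (P t).1.1) (y₂ := α.q (P t).1.2) (P t).2 :
        Fib2 H.π) := ⟨α.smooth_q n _ hP₁, α.smooth_q n _ hP₂⟩
    have hj := isSmoothAlong_vec (E := H.L) hPq hj hd i
    exact α.pushAct_smooth E hP₁ hP₂ (k := fun t => (P t).2) hj hs hv
  mul_act {w₁ w₂ w₃} h k a b v := by
    obtain ⟨l, t, s, hl, ht, hs, H1⟩ := α.exists_m_eq (α.eq_G h) h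
    obtain ⟨l', t', s', hl', ht', hs', H2⟩ := α.exists_m_eq (α.eq_G k) k
    obtain ⟨c, rfl⟩ := H1 a
    obtain ⟨c', rfl⟩ := H2 b
    simp only [map_smul, LinearMap.smul_apply]
    congr 2
    change α.pushAct E (h.trans k) (H.mul h k _ _) v = _
    -- The scalar s'*(t) produced by `mul_m` is the one that arises when the first factor acts on
    -- the covector s'* left by the second.
    rw [α.mul_m]
    induction v using TensorProduct.induction_on with
    | zero => simp
    | add x y hx hy => rw [map_add, hx, hy, map_add, map_add]
    | tmul g v =>
      simp only [map_smul, LinearMap.smul_apply]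
      rw [pushAct_m, pushAct_m, map_smul, pushAct_m, E.mul_act, smul_comm]

end Push
end Twist

/-! ### Grothendieck groups and additive correspondences. -/

section KGroups
open Algebra (GrothendieckAddGroup)
open Algebra.GrothendieckAddGroup (of)

/-- Functoriality of the Grothendieck group. -/
def grothendieckCongr {A B : Type*} [AddCommMonoid A] [AddCommMonoid B] (e : A ≃+ B) :
    GrothendieckAddGroup A ≃+ GrothendieckAddGroup B :=
  AddMonoidHom.toAddEquiv
    (Algebra.GrothendieckAddGroup.lift ((of (M := B)).comp e.toAddMonoidHom))
    (Algebra.GrothendieckAddGroup.lift ((of (M := A)).comp e.symm.toAddMonoidHom))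
    (grothendieck_hom_ext fun a => by
      rw [AddMonoidHom.comp_apply, grothendieck_lift_of]
      exact (grothendieck_lift_of _ _).trans (congrArg of (e.symm_apply_apply a)))
    (grothendieck_hom_ext fun a => by
      rw [AddMonoidHom.comp_apply, grothendieck_lift_of]
      exact (grothendieck_lift_of _ _).trans (congrArg of (e.apply_symm_apply a)))

theorem grothendieckCongr_of {A B : Type*} [AddCommMonoid A] [AddCommMonoid B] (e : A ≃+ B)
    (a : A) : grothendieckCongr e (of a) = of (e a) :=
  grothendieck_lift_of ((of (M := B)).comp e.toAddMonoidHom) a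

/-- An additive correspondence between representatives that is bijective on classes gives an
isomorphism of Grothendieck groups. -/
theorem exists_grothendieck_addEquiv {S T A B : Type*} [AddCommMonoid A] [AddCommMonoid B]
    {p : S → A} {q : T → B} (hp : Function.Surjective p) (hq : Function.Surjective q)
    {R : S → T → Prop} (hR : ∀ s, ∃ t, R s t) (hR' : ∀ t, ∃ s, R s t)
    (hiff : ∀ {s t s' t'}, R s t → R s' t' → (p s = p s' ↔ q t = q t'))
    (hadd : ∀ {s t s' t'}, R s t → R s' t' →
      ∃ s'' t'', R s'' t'' ∧ p s'' = p s + p s' ∧ q t'' = q t + q t') :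
    ∃ φ : GrothendieckAddGroup A ≃+ GrothendieckAddGroup B,
      ∀ s, ∃ t, R s t ∧ φ (of (p s)) = of (q t) := by
  choose f hf using hR
  choose g hg using hp
  -- The class of a partner depends only on the class of `s`, so the arbitrary representatives `g`
  -- and partners `f` define a map on classes.
  have key : ∀ {a s t}, p s = a → R s t → q (f (g a)) = q t := fun h h' =>
    (hiff (hf _) h').1 ((hg _).trans h.symm)
  let e : A ≃+ B := AddEquiv.ofBijective
    ({ toFun := fun a => q (f (g a)), map_add' := fun a b => by
        obtain ⟨s, t, h, h1, h2⟩ := hadd (hf (g a)) (hf (g b))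
        rw [hg, hg] at h1
        exact (key h1 h).trans h2 } : A →ₙ+ B)
    ⟨fun a b h => by
      have := (hiff (hf (g a)) (hf (g b))).2 h
      rwa [hg, hg] at this, fun b => by
      obtain ⟨t, rfl⟩ := hq b
      obtain ⟨s, hs⟩ := hR' t
      exact ⟨p s, key rfl hs⟩⟩
  exact ⟨grothendieckCongr e, fun s => ⟨f s, hf s, (grothendieckCongr_of e _).trans
    (congrArg of (key rfl (hf s)))⟩⟩

end KGroups

/-! ### Pull-backs, tensor products and direct sums. -/

section Isos
variable {X Z : Type*} [DiffeologicalSpace X] [DiffeologicalSpace Z]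

/-- The pull-back of an isomorphism of bundles. -/
def BundleIso.pullback {E F : HermBundle X} (φ : BundleIso E F) (g : Z → X) (hg : DSmooth g) :
    BundleIso (E.pullback g hg) (F.pullback g hg) where
  equiv z := φ.equiv (g z)
  smooth := by
    rintro _ ⟨e, he, rfl⟩ _ ⟨f, hf, rfl⟩ i j
    exact (φ.smooth e he f hf i j).comp hg
  smooth_symm := by
    rintro _ ⟨e, he, rfl⟩ _ ⟨f, hf, rfl⟩ i j
    exact (φ.smooth_symm e he f hf i j).comp hg

/-- Pull-back commutes with direct sums. -/
def BundleIso.pullbackSum (E F : HermBundle X) (g : Z → X) (hg : DSmooth g) :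
    BundleIso ((E.sum F).pullback g hg) ((E.pullback g hg).sum (F.pullback g hg)) where
  -- The fibres coincide; only the atlases differ, since on the right the two frames are pulled back
  -- separately before they are combined.
  equiv z := LinearEquiv.refl ℂ _
  smooth := by
    rintro _ ⟨_, ⟨e, he, f, hf, rfl⟩, rfl⟩ _ ⟨_, ⟨e', he', rfl⟩, _, ⟨f', hf', rfl⟩, rfl⟩ i j
    exact (((E.sum F).smooth _ ⟨e', he', f', hf', rfl⟩ _ ⟨e, he, f, hf, rfl⟩ j i).comp hg).mono
      fun z hz => ⟨hz.2, hz.1⟩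
  smooth_symm := by
    rintro _ ⟨_, ⟨e', he', rfl⟩, _, ⟨f', hf', rfl⟩, rfl⟩ _ ⟨_, ⟨e, he, f, hf, rfl⟩, rfl⟩ i j
    exact (((E.sum F).smooth _ ⟨e, he, f, hf, rfl⟩ _ ⟨e', he', f', hf', rfl⟩ j i).comp hg).mono
      fun z hz => ⟨hz.2, hz.1⟩

/-- Distributivity of `⊗` over the hilbertian direct sum. -/
def tensorSumLin {U V W : Type} [NormedAddCommGroup U] [InnerProductSpace ℂ U]
    [NormedAddCommGroup V] [InnerProductSpace ℂ V] [NormedAddCommGroup W]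
    [InnerProductSpace ℂ W] :
    U ⊗[ℂ] WithLp 2 (V × W) ≃ₗ[ℂ] WithLp 2 ((U ⊗[ℂ] V) × (U ⊗[ℂ] W)) :=
  (TensorProduct.congr (LinearEquiv.refl ℂ _) (sumLin _ _)).trans
    ((TensorProduct.prodRight ℂ ℂ _ _ _).trans (sumLin _ _).symm)

theorem tensorSumLin_tmul {U V W : Type} [NormedAddCommGroup U] [InnerProductSpace ℂ U]
    [NormedAddCommGroup V] [InnerProductSpace ℂ V] [NormedAddCommGroup W]
    [InnerProductSpace ℂ W] (a : U) (b : WithLp 2 (V × W)) :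
    tensorSumLin (a ⊗ₜ[ℂ] b) = WithLp.toLp 2 (a ⊗ₜ[ℂ] b.fst, a ⊗ₜ[ℂ] b.snd) := rfl

/-- The linear algebra behind additivity of E ↦ K* ⊗ E. It is enough to compare the actions of one
generator `i` of the line, which acts through the direct sum of `a` and `b`. -/
theorem tensorSumLin_map {U U' V V' W W' : Type} [NormedAddCommGroup U] [InnerProductSpace ℂ U]
    [NormedAddCommGroup V] [InnerProductSpace ℂ V] [NormedAddCommGroup W] [InnerProductSpace ℂ W]
    [NormedAddCommGroup U'] [InnerProductSpace ℂ U'] [NormedAddCommGroup V']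
    [InnerProductSpace ℂ V'] [NormedAddCommGroup W'] [InnerProductSpace ℂ W']
    {J : Type} [AddCommGroup J] [Module ℂ J]
    (f : J →ₗ[ℂ] U ⊗[ℂ] WithLp 2 (V × W) →ₗ[ℂ] U' ⊗[ℂ] WithLp 2 (V' × W'))
    (f₁ : J →ₗ[ℂ] U ⊗[ℂ] V →ₗ[ℂ] U' ⊗[ℂ] V') (f₂ : J →ₗ[ℂ] U ⊗[ℂ] W →ₗ[ℂ] U' ⊗[ℂ] W')
    (c : U → ℂ) (r : U') (a : V →ₗ[ℂ] V') (b : W →ₗ[ℂ] W') {i j : J} (hj : ∃ z : ℂ, j = z • i)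
    (h : ∀ g e, f i (g ⊗ₜ e) = c g • r ⊗ₜ WithLp.toLp 2 (a e.fst, b e.snd))
    (h₁ : ∀ g e, f₁ i (g ⊗ₜ e) = c g • r ⊗ₜ a e) (h₂ : ∀ g e, f₂ i (g ⊗ₜ e) = c g • r ⊗ₜ b e)
    (y : U ⊗[ℂ] WithLp 2 (V × W)) :
    tensorSumLin (f j y) = sumAct f₁ f₂ j (tensorSumLin y) := by
  obtain ⟨z, rfl⟩ := hj
  rw [map_smul, map_smul, LinearMap.smul_apply, LinearMap.smul_apply, map_smul]
  congr 1
  induction y using TensorProduct.induction_on with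
  | zero => simp only [map_zero]
  | add x y hx hy => simp only [map_add, hx, hy]
  | tmul g e =>
    rw [h, map_smul, tensorSumLin_tmul, tensorSumLin_tmul]
    exact congrArg₂ (fun a b => WithLp.toLp 2 (a, b)) (h₁ g e.fst).symm (h₂ g e.snd).symm

/-- Distributivity of `⊗` over the pull-back of a direct sum. -/
def BundleIso.tensorPullbackSum (K : HermBundle Z) (E F : HermBundle X) (g : Z → X)
    (hg : DSmooth g) : BundleIso (K.tensor ((E.sum F).pullback g hg))
      ((K.tensor (E.pullback g hg)).sum (K.tensor (F.pullback g hg))) where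
  equiv _ := tensorSumLin
  smooth := by
    rintro _ ⟨k, hk, _, ⟨_, ⟨e, he, f, hf, rfl⟩, rfl⟩, rfl⟩ f' hf' i j
    exact (BundleIso.tensorSum K (E.pullback g hg) (F.pullback g hg)).smooth _
      ⟨k, hk, _, ⟨_, ⟨e, he, rfl⟩, _, ⟨f, hf, rfl⟩, rfl⟩, rfl⟩ f' hf' i j
  smooth_symm := by
    rintro f' hf' _ ⟨k, hk, _, ⟨_, ⟨e, he, f, hf, rfl⟩, rfl⟩, rfl⟩ i j
    exact (BundleIso.tensorSum K (E.pullback g hg) (F.pullback g hg)).smooth_symm f' hf' _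
      ⟨k, hk, _, ⟨_, ⟨e, he, rfl⟩, _, ⟨f, hf, rfl⟩, rfl⟩, rfl⟩ i j

variable {M : Type u} [DiffeologicalSpace M] {G : BundleGerbe.{u, v} M}

/-- The direct sum of isomorphisms of modules. -/
def ModuleIso.sumCongr {E E' F F' : GerbeModule G} (φ : ModuleIso E E') (ψ : ModuleIso F F') :
    ModuleIso (E.sum F) (E'.sum F') :=
  { BundleIso.sumCongr φ.toBundleIso ψ.toBundleIso with
    map_act := fun h a v => by simp [BundleIso.sumCongr, φ.map_act, ψ.map_act] }

/-- Refinement commutes with direct sums. -/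
def ModuleIso.refineSum (E F : GerbeModule G) {W : Type x} [DiffeologicalSpace W] (r : W → G.Y)
    (hr : DSmooth r) (hs : LocSplit r) :
    ModuleIso ((E.refine r hr hs).sum (F.refine r hr hs)) ((E.sum F).refine r hr hs) :=
  { (BundleIso.pullbackSum E.E F.E r hr).symm with
    map_act := fun _ _ _ => rfl }

end Isos

/-! ### The inverse construction K ⊗ F and the correspondence of modules. -/

namespace Twist
variable {M : Type u} [DiffeologicalSpace M] {G : BundleGerbe.{u, v} M} {H : BundleGerbe.{u, w} M}
  (α : Twist.{u, v, w, x} G H)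

section Pull
variable (F : GerbeModule H)

/-- The action of `L` on `K ⊗ F`. -/
def pullAct {w₁ w₂ : α.W} (h : G.π (α.p w₁) = G.π (α.p w₂)) :
    G.L.fiber (pair h) →ₗ[ℂ] α.K.fiber w₂ ⊗[ℂ] F.E.fiber (α.q w₂) →ₗ[ℂ]
      α.K.fiber w₁ ⊗[ℂ] F.E.fiber (α.q w₁) :=
  (exists_pullAct (α.m h (α.eq_H h)) (α.rank_one w₁) (F.act (α.eq_H h))).choose

theorem smul_pullAct {w₁ w₂ : α.W} (h : G.π (α.p w₁) = G.π (α.p w₂))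
    (k : H.π (α.q w₁) = H.π (α.q w₂)) (l : G.L.fiber (pair h)) (t : α.K.fiber w₂)
    (f : StrongDual ℂ (α.K.fiber w₁)) (s : α.K.fiber w₁) (v : F.E.fiber (α.q w₂)) :
    f s • α.pullAct F h l (t ⊗ₜ v) = s ⊗ₜ F.act k (α.m h k l t f) v :=
  (exists_pullAct (α.m h (α.eq_H h)) (α.rank_one w₁) (F.act (α.eq_H h))).choose_spec l t f s v

/-- With f = s* the scalar f(s) in `smul_pullAct` is 1. -/
theorem pullAct_tmul {w₁ w₂ : α.W} (h : G.π (α.p w₁) = G.π (α.p w₂))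
    (k : H.π (α.q w₁) = H.π (α.q w₂)) (l : G.L.fiber (pair h)) (t : α.K.fiber w₂)
    {s : α.K.fiber w₁} (hs : ‖s‖ = 1) (v : F.E.fiber (α.q w₂)) :
    α.pullAct F h l (t ⊗ₜ v) =
      s ⊗ₜ F.act k (α.m h k l t (InnerProductSpace.toDual ℂ _ s)) v := by
  rw [← smul_pullAct, toDual_apply_self hs, one_smul]

theorem pullAct_isometric {w₁ w₂ : α.W} (h : G.π (α.p w₁) = G.π (α.p w₂)) :
    IsIsometricBilin (V' := (α.K.tensor (F.E.pullback α.q α.smooth_q)).fiber w₂)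
      (V'' := (α.K.tensor (F.E.pullback α.q α.smooth_q)).fiber w₁) (α.pullAct F h) := by
  intro a b a' b'
  obtain ⟨s, hs⟩ := exists_unit (α.rank_one w₁)
  induction b using TensorProduct.induction_on with
  | zero => simp
  | add x y hx hy => simp only [map_add, inner_add_left, hx, hy, mul_add]
  | tmul t v =>
  induction b' using TensorProduct.induction_on with
  | zero => simp
  | add x y hx hy => simp only [map_add, inner_add_right, hx, hy, mul_add]
  | tmul t' v' =>
    rw [α.pullAct_tmul F h (α.eq_H h) a t hs, α.pullAct_tmul F h (α.eq_H h) a' t' hs,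
      TensorProduct.inner_tmul, TensorProduct.inner_tmul, F.isometric_act, α.inner_m,
      dual_inner_toDual, inner_self_unit hs]
    ring

/-- The module `K ⊗ F`. -/
@[reducible]
def pull : GerbeModule (G.refine α.p α.smooth_p α.split_p) where
  E := α.K.tensor (F.E.pullback α.q α.smooth_q)
  act k := α.pullAct F k
  isometric_act k := α.pullAct_isometric F k
  smooth_act := by
    refine isSmoothBilin_of_frames ?_
    rintro _ ⟨j, hj, rfl⟩ _ ⟨_, ⟨g, hg, _, ⟨e, he, rfl⟩, rfl⟩, rfl⟩ i i' n P hP hd hd'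
    refine isSmoothAlong_pullback.2 ?_
    have hp₁ : IsPlot fun t => (P t).1.1 := hP.1
    have hp₂ : IsPlot fun t => (P t).1.2 := hP.2
    have hr := isSmoothAlong_vec hp₂ hg (fun t => (hd' t).1) i'.1
    have hv := isSmoothAlong_pullback.1 (isSmoothAlong_vec (E := F.E.pullback α.q α.smooth_q) hp₂
      ⟨e, he, rfl⟩ (fun t => (hd' t).2) i'.2)
    have hPq : IsPlot fun t => (pair (y₁ := α.p (P t).1.1) (y₂ := α.p (P t).1.2) (P t).2 :
        Fib2 G.π) := ⟨α.smooth_p n _ hp₁, α.smooth_p n _ hp₂⟩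
    have hj := isSmoothAlong_vec (E := G.L) hPq hj hd i
    refine IsSmoothAlong.of_local hp₁ fun t => ?_
    obtain ⟨O, hO, ht, s, hs, hs'⟩ := exists_unit_nhds α.rank_one hp₁ t
    refine ⟨O, hO, ht, fun f hf hfO => ?_⟩
    have h₁ : IsPlot fun x => (P (f x)).1.1 := isPlot_reparam hp₁ hf
    have h₂ : IsPlot fun x => (P (f x)).1.2 := isPlot_reparam hp₂ hf
    have hsf := hs' f hf hfO
    have hm := α.smooth_m h₁ h₂ (h := fun x => (P (f x)).2) (k := fun x => α.eq_H (P (f x)).2)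
      (hj.reparam hf) (hr.reparam hf) hsf.toDual
    have hF := F.act_smooth (α.smooth_q n _ h₁) (α.smooth_q n _ h₂)
      (h := fun x => α.eq_H (P (f x)).2) hm (hv.reparam hf)
    refine (hsf.tmul (F := F.E.pullback α.q α.smooth_q)
      (isSmoothAlong_pullback.2 hF)).congr fun x => ?_
    exact α.pullAct_tmul F _ _ _ _ (hs _ (hfO x)) _
  mul_act {w₁ w₂ w₃} h k a b v := by
    obtain ⟨s, hs⟩ := exists_unit (α.rank_one w₁)
    obtain ⟨r, hr⟩ := exists_unit (α.rank_one w₂)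
    induction v using TensorProduct.induction_on with
    | zero => simp
    | add x y hx hy => rw [map_add, hx, hy, map_add, map_add]
    | tmul t v =>
      refine (α.pullAct_tmul F _ (α.eq_H (h.trans k)) _ _ hs _).trans ?_
      rw [α.pullAct_tmul F k (α.eq_H k) _ _ hr, α.pullAct_tmul F h (α.eq_H h) _ _ hs, ← F.mul_act,
        α.mul_m, toDual_apply_self hr, one_smul]

end Pull

section Relation

/-- The module `F` corresponds to the module `E`, in terms of `K* ⊗ E ≃ F`. -/
def Rel (E : GerbeModule G) (F : GerbeModule H) : Prop :=
  Nonempty (ModuleIso (α.push E) (F.refine α.q α.smooth_q α.split_q))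

/-- The module `F` corresponds to the module `E`, in terms of `K ⊗ F ≃ E`. -/
def Rel' (E : GerbeModule G) (F : GerbeModule H) : Prop :=
  Nonempty (ModuleIso (α.pull F) (E.refine α.p α.smooth_p α.split_p))

variable {α} {E E' : GerbeModule G} {F F' : GerbeModule H}

/-- Tensoring K* ⊗ E ≃ F with `K` cancels the line bundle. Equivariance is checked on the vectors t
⊗ θ(g ⊗ e), which span because θ is surjective. -/
theorem Rel.rel' (h : α.Rel E F) : α.Rel' E F := by
  obtain ⟨θ⟩ := h
  obtain ⟨ψ, hψ⟩ := (LinePairing.dual α.K α.rank_one).cancel θ.toBundleIso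
  have hψ' : ∀ (w : α.W) (t : α.K.fiber w) (g : StrongDual ℂ (α.K.fiber w)) a,
    ψ.equiv w (t ⊗ₜ θ.equiv w (g ⊗ₜ a)) = g t • a := hψ
  refine ⟨{ ψ with map_act := fun {w₁ w₂} h l y => ?_ }⟩
  obtain ⟨s, hs⟩ := exists_unit (α.rank_one w₁)
  change ψ.equiv w₁ (α.pullAct F h l y) = E.act h l (ψ.equiv w₂ y)
  induction y using TensorProduct.induction_on with
  | zero => simp only [LinearEquiv.map_zero, LinearMap.map_zero]
  | add x y hx hy => rw [map_add, map_add, hx, hy, map_add, map_add]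
  | tmul t v =>
    obtain ⟨x, rfl⟩ := (θ.equiv w₂).surjective v
    induction x using TensorProduct.induction_on with
    | zero => simp only [LinearEquiv.map_zero, LinearMap.map_zero, TensorProduct.tmul_zero]
    | add x y hx hy =>
      simp only [map_add, TensorProduct.tmul_add] at hx hy ⊢
      rw [hx, hy]
    | tmul g e =>
      rw [α.pullAct_tmul F h (α.eq_H h) l t hs, hψ', map_smul]
      have h1 := θ.map_act (y₁ := w₁) (y₂ := w₂) (α.eq_H h)
        (α.m h (α.eq_H h) l t (InnerProductSpace.toDual ℂ _ s)) (g ⊗ₜ e)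
      change θ.equiv w₁ (α.pushAct E _ _ _) = F.act _ _ _ at h1
      rw [← h1, α.pushAct_m, TensorProduct.smul_tmul', hψ', smul_apply, toDual_apply_self hs,
        smul_eq_mul, mul_one]

/-- The same cancellation for the flipped pairing, now tensoring K ⊗ F ≃ E with K*. -/
theorem Rel'.rel (h : α.Rel' E F) : α.Rel E F := by
  obtain ⟨ψ⟩ := h
  obtain ⟨θ, hθ⟩ := (LinePairing.dual α.K α.rank_one).flip.cancel ψ.toBundleIso
  have hθ' : ∀ (w : α.W) (g : StrongDual ℂ (α.K.fiber w)) (t : α.K.fiber w) a,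
    θ.equiv w (g ⊗ₜ ψ.equiv w (t ⊗ₜ a)) = g t • a := hθ
  refine ⟨{ θ with map_act := fun {w₁ w₂} k j y => ?_ }⟩
  obtain ⟨l, t, s, hl, ht, hs, H1⟩ := α.exists_m_eq (α.eq_G k) k
  obtain ⟨c, rfl⟩ := H1 j
  change θ.equiv w₁ (α.pushAct E k _ y) = F.act k _ (θ.equiv w₂ y)
  simp only [map_smul, LinearMap.smul_apply]
  congr 1
  induction y using TensorProduct.induction_on with
  | zero => simp only [LinearEquiv.map_zero, LinearMap.map_zero]
  | add x y hx hy => rw [map_add, map_add, hx, hy, map_add, map_add]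
  | tmul g e =>
    obtain ⟨x, rfl⟩ := (ψ.equiv w₂).surjective e
    induction x using TensorProduct.induction_on with
    | zero => simp only [LinearEquiv.map_zero, LinearMap.map_zero, TensorProduct.tmul_zero]
    | add x y hx hy =>
      simp only [map_add, TensorProduct.tmul_add] at hx hy ⊢
      rw [hx, hy]
    | tmul t' v =>
      rw [α.pushAct_m _ (α.eq_G k) k, hθ']
      have h1 := ψ.map_act (y₁ := w₁) (y₂ := w₂) (α.eq_G k) l (t' ⊗ₜ v)
      change ψ.equiv w₁ (α.pullAct F _ _ _) = E.act _ _ _ at h1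
      rw [← h1, α.pullAct_tmul F _ k _ _ hs, map_smul, hθ', toDual_apply_self hs, one_smul]
      -- One side has g(t) m(l, t', s*)v, the other g(t') m(l, t, s*)v; they agree because g(t) t' =
      -- g(t') t in a line.
      have h2 := dual_apply_smul_line (α.rank_one w₂) g t t'
      have h3 := congrArg (fun z => F.act k (α.m (α.eq_G k) k l z
        (InnerProductSpace.toDual ℂ _ s)) v) h2
      rw [map_smul]
      simpa only [map_smul, LinearMap.smul_apply] using h3

variable (α)

theorem exists_rel (E : GerbeModule G) : ∃ F, α.Rel E F := (α.push E).exists_descent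

/-- Descending K ⊗ F along `p` gives the relation in its second form, which implies the first. -/
theorem exists_rel' (F : GerbeModule H) : ∃ E, α.Rel E F := by
  obtain ⟨E, h⟩ := (α.pull F).exists_descent
  exact ⟨E, Rel'.rel h⟩

variable {α}

/-- Functoriality of `E ↦ K* ⊗ E`. -/
def pushCongr (α : Twist.{u, v, w, x} G H) (φ : ModuleIso E E') :
    ModuleIso (α.push E) (α.push E') :=
  { BundleIso.tensorCongr (BundleIso.refl _) (φ.toBundleIso.pullback α.p α.smooth_p) with
    map_act := fun {w₁ w₂} k j y => by
      obtain ⟨l, t, s, hl, ht, hs, H1⟩ := α.exists_m_eq (α.eq_G k) k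
      obtain ⟨c, rfl⟩ := H1 j
      change TensorProduct.congr (LinearEquiv.refl ℂ _) (φ.equiv _) (α.pushAct E k _ y) =
        α.pushAct E' k _ (TensorProduct.congr (LinearEquiv.refl ℂ _) (φ.equiv _) y)
      simp only [map_smul, LinearMap.smul_apply]
      congr 1
      induction y using TensorProduct.induction_on with
      | zero => simp only [LinearEquiv.map_zero, LinearMap.map_zero]
      | add x y hx hy => rw [map_add, map_add, hx, hy, map_add, map_add]
      | tmul g e =>
        rw [TensorProduct.congr_tmul, α.pushAct_m _ (α.eq_G k) k, α.pushAct_m _ (α.eq_G k) k,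
          map_smul, TensorProduct.congr_tmul, φ.map_act]
        rfl }

/-- Functoriality of `F ↦ K ⊗ F`. -/
def pullCongr (α : Twist.{u, v, w, x} G H) (φ : ModuleIso F F') :
    ModuleIso (α.pull F) (α.pull F') :=
  { BundleIso.tensorCongr (BundleIso.refl _) (φ.toBundleIso.pullback α.q α.smooth_q) with
    map_act := fun {w₁ w₂} h l y => by
      obtain ⟨s, hs⟩ := exists_unit (α.rank_one w₁)
      change TensorProduct.congr (LinearEquiv.refl ℂ _) (φ.equiv _) (α.pullAct F h l y) =
        α.pullAct F' h l (TensorProduct.congr (LinearEquiv.refl ℂ _) (φ.equiv _) y)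
      induction y using TensorProduct.induction_on with
      | zero => simp only [LinearEquiv.map_zero, LinearMap.map_zero]
      | add x y hx hy => rw [map_add, map_add, hx, hy, map_add, map_add]
      | tmul t v =>
        rw [TensorProduct.congr_tmul, α.pullAct_tmul F h (α.eq_H h) l _ hs, LinearEquiv.refl_apply,
          α.pullAct_tmul F' h (α.eq_H h) l _ hs, TensorProduct.congr_tmul, φ.map_act]
        rfl }

theorem tensorSumLin_pushAct (α : Twist.{u, v, w, x} G H) (E E' : GerbeModule G) {w₁ w₂ : α.W}
    (k : H.π (α.q w₁) = H.π (α.q w₂)) (j : H.L.fiber (pair k))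
    (y : StrongDual ℂ (α.K.fiber w₂) ⊗[ℂ]
      WithLp 2 (E.E.fiber (α.p w₂) × E'.E.fiber (α.p w₂))) :
    tensorSumLin (U := StrongDual ℂ (α.K.fiber w₁)) (V := E.E.fiber (α.p w₁))
        (W := E'.E.fiber (α.p w₁)) (α.pushAct (E.sum E') k j y) =
      sumAct (α.pushAct E k) (α.pushAct E' k) j (tensorSumLin (U := StrongDual ℂ (α.K.fiber w₂))
        (V := E.E.fiber (α.p w₂)) (W := E'.E.fiber (α.p w₂)) y) := by
  obtain ⟨l, t, s, hl, ht, hs, H1⟩ := α.exists_m_eq (α.eq_G k) k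
  have h1 := α.pushAct_m E (α.eq_G k) k l t (InnerProductSpace.toDual ℂ _ s)
  have h2 := α.pushAct_m E' (α.eq_G k) k l t (InnerProductSpace.toDual ℂ _ s)
  have h3 : ∀ (g : StrongDual ℂ (α.K.fiber w₂))
      (e : WithLp 2 (E.E.fiber (α.p w₂) × E'.E.fiber (α.p w₂))),
      α.pushAct (E.sum E') k (α.m (α.eq_G k) k l t (InnerProductSpace.toDual ℂ _ s)) (g ⊗ₜ e) =
        g t • (InnerProductSpace.toDual ℂ _ s) ⊗ₜ WithLp.toLp 2 (E.act (α.eq_G k) l e.fst,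
          E'.act (α.eq_G k) l e.snd) :=
    fun g e => α.pushAct_m (E.sum E') (α.eq_G k) k l t (InnerProductSpace.toDual ℂ _ s) g e
  have h4 := H1 j
  have h5 := tensorSumLin_map (α.pushAct (E.sum E') k) (α.pushAct E k) (α.pushAct E' k)
    (fun g => g t) (InnerProductSpace.toDual ℂ _ s) (E.act (α.eq_G k) l) (E'.act (α.eq_G k) l) h4
  with_reducible exact h5 h3 h1 h2 y

/-- Additivity of `E ↦ K* ⊗ E`. -/
def pushSum (α : Twist.{u, v, w, x} G H) (E E' : GerbeModule G) :
    ModuleIso (α.push (E.sum E')) ((α.push E).sum (α.push E')) :=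
  { BundleIso.tensorPullbackSum α.K.dual E.E E'.E α.p α.smooth_p with
    map_act := fun k j y => tensorSumLin_pushAct α E E' k j y }

theorem Rel.add (h : α.Rel E F) (h' : α.Rel E' F') : α.Rel (E.sum E') (F.sum F') := by
  obtain ⟨θ⟩ := h
  obtain ⟨θ'⟩ := h'
  exact ⟨((α.pushSum E E').trans (.sumCongr θ θ')).trans
    (.refineSum F F' α.q α.smooth_q α.split_q)⟩

/-- An isomorphism of `E` and `E'` gives one of K* ⊗ E and K* ⊗ E', hence one of the pull-backs of
`F` and `F'`, and this descends. The converse runs through K ⊗ F in the same way. Together they make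
the map on classes well defined and injective. -/
theorem Rel.iso_iff (h : α.Rel E F) (h' : α.Rel E' F') :
    Nonempty (ModuleIso E E') ↔ Nonempty (ModuleIso F F') := by
  refine ⟨fun ⟨φ⟩ => ?_, fun ⟨φ⟩ => ?_⟩
  · obtain ⟨θ⟩ := h
    obtain ⟨θ'⟩ := h'
    exact GerbeModule.iso_of_refine ((θ.symm.trans (α.pushCongr φ)).trans θ')
  · obtain ⟨θ⟩ := h.rel'
    obtain ⟨θ'⟩ := h'.rel'
    exact GerbeModule.iso_of_refine ((θ.symm.trans (α.pullCongr φ)).trans θ')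

/-- A twist induces an isomorphism of `K`-groups. -/
theorem exists_addEquiv (α : Twist.{u, v, w, x} G H) :
    ∃ φ : G.K ≃+ H.K, ∀ E : GerbeModule G, ∃ F, α.Rel E F ∧ φ E.toK = F.toK :=
  exists_grothendieck_addEquiv (A := G.Mod) (B := H.Mod) (p := fun E : GerbeModule G => (Quotient.mk _ E : G.Mod))
    (q := fun F : GerbeModule H => (Quotient.mk _ F : H.Mod)) Quotient.mk_surjective
    Quotient.mk_surjective α.exists_rel α.exists_rel'
    (fun h h' => Quotient.eq.trans ((h.iso_iff h').trans
      (Quotient.eq (r := moduleSetoid H)).symm))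
    fun {E F E' F'} h h' => ⟨E.sum E', F.sum F', h.add h', rfl, rfl⟩

end Relation
end Twist

/-! ### Stable isomorphisms are twists -/

section Contract
variable {V W : Type} [NormedAddCommGroup V] [InnerProductSpace ℂ V] [AddCommGroup W] [Module ℂ W]

@[simp] theorem contract_tmul (v : V) (f : StrongDual ℂ V) (w : W) :
    contract v (f ⊗ₜ w) = f v • w := rfl

/-- Contraction, as a bilinear map. -/
def contractₗ : V →ₗ[ℂ] StrongDual ℂ V ⊗[ℂ] W →ₗ[ℂ] W where
  toFun := contract
  map_add' v v' := TensorProduct.ext' fun f w => by simp [add_smul]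
  map_smul' c v := TensorProduct.ext' fun f w => by simp [smul_smul]

theorem contractₗ_apply (v : V) (y : StrongDual ℂ V ⊗[ℂ] W) : contractₗ v y = contract v y := rfl

end Contract

theorem inner_map_tensor {U V W : Type} [NormedAddCommGroup U] [InnerProductSpace ℂ U]
    [NormedAddCommGroup V] [InnerProductSpace ℂ V] [NormedAddCommGroup W] [InnerProductSpace ℂ W]
    (P Q : U ⊗[ℂ] V →ₗ[ℂ] W) (z : ℂ)
    (h : ∀ u v u' v', ⟪P (u ⊗ₜ v), Q (u' ⊗ₜ v')⟫_ℂ = z * (⟪u, u'⟫_ℂ * ⟪v, v'⟫_ℂ))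
    (y y' : U ⊗[ℂ] V) : ⟪P y, Q y'⟫_ℂ = z * ⟪y, y'⟫_ℂ := by
  induction y using TensorProduct.induction_on with
  | zero => simp only [map_zero, inner_zero_left, mul_zero]
  | add a b ha hb => simp only [map_add, inner_add_left, ha, hb, mul_add]
  | tmul f w =>
  induction y' using TensorProduct.induction_on with
  | zero => simp only [map_zero, inner_zero_right, mul_zero]
  | add a b ha hb => simp only [map_add, inner_add_right, ha, hb, mul_add]
  | tmul f' w' => rw [h, TensorProduct.inner_tmul]

variable {X : Type*} [DiffeologicalSpace X]

/-- Since `A` is a line, contraction identifies A ⊗ A* ⊗ B isometrically with `B`; on pure tensors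
this is the exchange `inner_mul_inner_line`. -/
theorem inner_contract {A B : HermBundle X} {x : X} (hA : Module.finrank ℂ (A.fiber x) = 1)
    (l l' : A.fiber x) (y y' : (A.dual.tensor B).fiber x) :
    ⟪(contract l y : B.fiber x), contract l' y'⟫_ℂ = ⟪l, l'⟫_ℂ * ⟪y, y'⟫_ℂ := by
  refine inner_map_tensor (U := A.dual.fiber x) (contract l) (contract l') ⟪l, l'⟫_ℂ
    (fun f w f' w' => ?_) y y'
  obtain ⟨a, rfl⟩ := (InnerProductSpace.toDual ℂ (A.fiber x)).surjective f
  obtain ⟨a', rfl⟩ := (InnerProductSpace.toDual ℂ (A.fiber x)).surjective f'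
  rw [contract_tmul, contract_tmul, inner_smul_left, inner_smul_right,
    dual_inner_toDual, InnerProductSpace.toDual_apply_apply,
    InnerProductSpace.toDual_apply_apply, inner_conj_symm, ← mul_assoc, ← mul_assoc,
    inner_mul_inner_line hA]

theorem isSmoothBilin_contract (A B : HermBundle X) :
    IsSmoothBilin A (A.dual.tensor B) B fun _ => contractₗ := by
  rintro e he _ ⟨_, ⟨f, hf, rfl⟩, g, hg, rfl⟩ g' hg' i j k
  refine SmoothFunOn.congr (((A.smooth f hf e he j.1 i).mono ?_).mul
    ((B.smooth g' hg' g hg k j.2).mono ?_)) fun x _ => ?_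
  · exact fun x hx => ⟨hx.1.2.1, hx.1.1⟩
  · exact fun x hx => ⟨hx.2, hx.1.2.2⟩
  · rw [contractₗ_apply, contract_tmul, inner_smul_right, InnerProductSpace.toDual_apply_apply]

variable {M : Type u} [DiffeologicalSpace M] {G : BundleGerbe.{u, v} M} {H : BundleGerbe.{u, w} M}

/-- The product on L* is dual to that on `L`, so a product of functionals evaluated on a product of
vectors is the product of the two values. -/
theorem contract_dualMul {y₁ y₂ y₃ : G.Y} (h : G.π y₁ = G.π y₂) (k : G.π y₂ = G.π y₃)
    {W₁ W₂ W₃ : Type} [AddCommGroup W₁] [Module ℂ W₁] [AddCommGroup W₂] [Module ℂ W₂]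
    [AddCommGroup W₃] [Module ℂ W₃] (μ : W₁ →ₗ[ℂ] W₂ →ₗ[ℂ] W₃)
    (l : G.L.fiber (pair h)) (l' : G.L.fiber (pair k))
    (a : StrongDual ℂ (G.L.fiber (pair h)) ⊗[ℂ] W₁)
    (b : StrongDual ℂ (G.L.fiber (pair k)) ⊗[ℂ] W₂) :
    contract (G.mul h k l l') (TensorProduct.map₂ (G.dualMul h k) μ a b) =
      μ (contract l a) (contract l' b) := by
  induction a using TensorProduct.induction_on with
  | zero => simp only [map_zero, LinearMap.zero_apply]
  | add a a' ha ha' => simp only [map_add, LinearMap.add_apply, ha, ha']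
  | tmul f w =>
  induction b using TensorProduct.induction_on with
  | zero => simp only [map_zero]
  | add b b' hb hb' => simp only [map_add, hb, hb']
  | tmul f' w' =>
    rw [TensorProduct.map₂_apply_tmul, TensorProduct.map_tmul, contract_tmul, contract_tmul,
      contract_tmul, G.dualMul_apply_mul, map_smul, map_smul, LinearMap.smul_apply, smul_smul,
      mul_comm]

namespace StableIso
variable (α : StableIso G H)

/-- The trilinear map given by a stable isomorphism. -/
def trilinear {q₁ q₂ : FibProd G.π H.π} (h : G.π q₁.1.1 = G.π q₂.1.1)
    (k : H.π q₁.1.2 = H.π q₂.1.2) : G.L.fiber (pair h) →ₗ[ℂ] α.T.fiber q₂ →ₗ[ℂ]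
      StrongDual ℂ (α.T.fiber q₁) →ₗ[ℂ] H.L.fiber (pair k) :=
  LinearMap.mk₂ ℂ (fun l t => (contractₗ (W := H.L.fiber (pair k)) l) ∘ₗ
      α.τ (y₁ := q₁) (y₂ := q₂) h t)
    (fun l l' t => by rw [map_add, LinearMap.add_comp])
    (fun c l t => by rw [map_smul, LinearMap.smul_comp])
    (fun l t t' => by rw [map_add, LinearMap.comp_add])
    (fun c l t => by rw [map_smul, LinearMap.comp_smul])

theorem inner_trilinear {q₁ q₂ : FibProd G.π H.π} (h : G.π q₁.1.1 = G.π q₂.1.1)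
    (k : H.π q₁.1.2 = H.π q₂.1.2) (l l' : G.L.fiber (pair h)) (t t' : α.T.fiber q₂)
    (f f' : StrongDual ℂ (α.T.fiber q₁)) :
    ⟪trilinear α h k l t f, trilinear α h k l' t' f'⟫_ℂ =
      ⟪l, l'⟫_ℂ * (⟪t, t'⟫_ℂ * ⟪f, f'⟫_ℂ) := by
  have h1 := inner_contract (A := G.L.pullback (FibProd.fst₂ G.π H.π) (FibProd.dSmooth_fst₂ _ _))
    (B := H.L.pullback (FibProd.snd₂ G.π H.π) (FibProd.dSmooth_snd₂ _ _))
    (x := pair (y₁ := q₁) (y₂ := q₂) h) (G.rank_one _) l l'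
    (α.τ (y₁ := q₁) (y₂ := q₂) h t f) (α.τ (y₁ := q₁) (y₂ := q₂) h t' f')
  have h2 := α.isometric_τ (y₁ := q₁) (y₂ := q₂) h t f t' f'
  exact h1.trans (congrArg (fun z => ⟪l, l'⟫_ℂ * z) h2)

theorem smooth_trilinear {n : ℕ} {p₁ p₂ : Euc n → FibProd G.π H.π} (hp₁ : IsPlot p₁)
    (hp₂ : IsPlot p₂) {h : ∀ t, G.π (p₁ t).1.1 = G.π (p₂ t).1.1}
    {k : ∀ t, H.π (p₁ t).1.2 = H.π (p₂ t).1.2} {l : ∀ t, G.L.fiber (pair (h t))}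
    {s : ∀ t, α.T.fiber (p₂ t)} {f : ∀ t, α.T.dual.fiber (p₁ t)}
    (hl : IsSmoothAlong G.L (fun t => pair (h t)) l) (hs : IsSmoothAlong α.T p₂ s)
    (hf : IsSmoothAlong α.T.dual p₁ f) :
    IsSmoothAlong H.L (fun t => pair (k t)) fun t => trilinear α (h t) (k t) (l t) (s t) (f t) := by
  have hP : IsPlot fun t => (pair (y₁ := p₁ t) (y₂ := p₂ t) (h t) :
      Fib2 (G.dual.tensor H).π) := ⟨hp₁, hp₂⟩
  have h1 := α.smooth_τ.apply hP (isSmoothAlong_pullback.2 hs) (isSmoothAlong_pullback.2 hf)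
  -- The gerbe L* ⊗ J uses the pull-back of the dual, whereas contraction uses the dual of the
  -- pull-back; the fibres are the same and the frames correspond.
  have h1' : IsSmoothAlong ((G.L.pullback (FibProd.fst₂ G.π H.π)
      (FibProd.dSmooth_fst₂ _ _)).dual.tensor (H.L.pullback (FibProd.snd₂ G.π H.π)
      (FibProd.dSmooth_snd₂ _ _))) (fun t => pair (y₁ := p₁ t) (y₂ := p₂ t) (h t))
      fun t => α.τ (y₁ := p₁ t) (y₂ := p₂ t) (h t) (s t) (f t) := by
    rintro _ ⟨_, ⟨_, ⟨e, he, rfl⟩, rfl⟩, e', he', rfl⟩ i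
    exact h1 _ ⟨_, ⟨_, ⟨e, he, rfl⟩, rfl⟩, e', he', rfl⟩ i
  have h2 : IsSmoothAlong (G.L.pullback (FibProd.fst₂ G.π H.π) (FibProd.dSmooth_fst₂ _ _))
      (fun t => pair (y₁ := p₁ t) (y₂ := p₂ t) (h t)) l := isSmoothAlong_pullback.2 hl
  have h3 := (isSmoothBilin_contract
    (G.L.pullback (FibProd.fst₂ G.π H.π) (FibProd.dSmooth_fst₂ _ _))
    (H.L.pullback (FibProd.snd₂ G.π H.π) (FibProd.dSmooth_snd₂ _ _))).apply hP h2 h1'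
  exact isSmoothAlong_pullback.1 h3

theorem mul_trilinear {q₁ q₂ q₃ : FibProd G.π H.π} (h : G.π q₁.1.1 = G.π q₂.1.1)
    (k : H.π q₁.1.2 = H.π q₂.1.2) (h' : G.π q₂.1.1 = G.π q₃.1.1) (k' : H.π q₂.1.2 = H.π q₃.1.2)
    (l : G.L.fiber (pair h)) (t : α.T.fiber q₂) (f : StrongDual ℂ (α.T.fiber q₁))
    (l' : G.L.fiber (pair h')) (t' : α.T.fiber q₃) (f' : StrongDual ℂ (α.T.fiber q₂)) :
    H.mul k k' (trilinear α h k l t f) (trilinear α h' k' l' t' f') =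
      f' t • trilinear α (h.trans h') (k.trans k') (G.mul h h' l l') t' f := by
  have h1 := contract_dualMul h h' (H.mul k k') l l' (α.τ (y₁ := q₁) (y₂ := q₂) h t f)
    (α.τ (y₁ := q₂) (y₂ := q₃) h' t' f')
  have h2 := α.mul_τ (y₁ := q₁) (y₂ := q₂) (y₃ := q₃) h h' t f t' f'
  exact h1.symm.trans ((congrArg (contract (G.mul h h' l l')) h2).trans (map_smul _ _ _))

/-- The twist given by a stable isomorphism. -/
@[reducible]
def toTwist : Twist.{u, v, w, max v w} G H where
  W := FibProd G.π H.π
  p := FibProd.fst G.π H.π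
  smooth_p := FibProd.dSmooth_fst _ _
  split_p := FibProd.locSplit_fst H.locSplit G.smooth_π
  q := FibProd.snd G.π H.π
  smooth_q := FibProd.dSmooth_snd _ _
  split_q := FibProd.locSplit_snd G.locSplit H.smooth_π
  π_eq w := w.2
  K := α.T
  rank_one := α.rank_one
  m h k := trilinear α h k
  inner_m h k l t f l' t' f' := inner_trilinear α h k l l' t t' f f'
  smooth_m hp₁ hp₂ _ _ _ _ _ hl hs hf := smooth_trilinear α hp₁ hp₂ hl hs hf
  mul_m h k h' k' l t f l' t' f' := mul_trilinear α h k h' k' l t f l' t' f'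

theorem transports_of_rel {E : GerbeModule G} {F : GerbeModule H} (h : (toTwist α).Rel E F) :
    α.Transports E F := by
  obtain ⟨θ⟩ := h
  refine ⟨θ.toBundleIso, fun q₁ q₂ h k t₂ f₁ f₂ l v => ?_⟩
  have h1 := θ.map_act (y₁ := q₁) (y₂ := q₂) k (trilinear α h k l t₂ f₁) (f₂ ⊗ₜ v)
  refine h1.symm.trans ?_
  have h2 := (toTwist α).pushAct_m E (w₁ := q₁) (w₂ := q₂) h k l t₂ f₁ f₂ v
  exact (congrArg (θ.equiv q₁) h2).trans (map_smul _ _ _)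

/-- A stable isomorphism induces an isomorphism of `K`-groups. -/
theorem exists_induces : ∃ φ : G.K ≃+ H.K, α.Induces φ := by
  obtain ⟨φ, hφ⟩ := (toTwist α).exists_addEquiv
  refine ⟨φ, fun E => ?_⟩
  obtain ⟨F, hF, h⟩ := hφ E
  exact ⟨F, transports_of_rel α hF, h⟩

end StableIso

/-! ### The trivial bundle gerbe and trivialisations -/

section Trivial
variable (M : Type u) [DiffeologicalSpace M]

/-- The bundle gerbe `(ℂ, M)`. -/
@[reducible]
def BundleGerbe.trivial : BundleGerbe.{u, u} M where
  Y := M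
  π := id
  smooth_π := fun _ _ hp => hp
  locally_split m := ⟨Set.univ, @isOpen_univ _ dTopology, Set.mem_univ _, Subtype.val, dSmooth_val,
    fun _ => rfl⟩
  L := HermBundle.one _
  rank_one _ := Module.finrank_self ℂ
  mul _ _ := LinearMap.mul ℂ ℂ
  isometric_mul _ _ a b a' b' := by
    simp only [LinearMap.mul_apply', RCLike.inner_apply, map_mul]
    ring
  smooth_mul := by
    rintro _ ⟨_, rfl, rfl⟩ _ ⟨_, rfl, rfl⟩ _ ⟨_, rfl, rfl⟩ i j k
    exact (smoothFunOn_const (1 : ℂ) _).congr fun q _ => by simp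
  mul_assoc _ _ _ a b c := _root_.mul_assoc a b c

variable {M}

/-- The unit element of the trivial gerbe is 1 and acts as the identity. Linearity then leaves no
freedom in the action, so modules for the trivial gerbe amount to bundles on `M`. -/
theorem GerbeModule.trivial_act (A : GerbeModule (BundleGerbe.trivial M)) {x y : M} (h : x = y)
    (c : ℂ) (v : A.E.fiber y) : A.act (y₁ := x) (y₂ := y) h c v = c • A.E.cast h.symm v := by
  subst h
  have h1 : (BundleGerbe.trivial M).one x = (1 : ℂ) := by
    have h2 := (BundleGerbe.trivial M).one_eq (y := x) (u := (1 : ℂ)) (norm_one (α := ℂ))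
    refine h2.trans ?_
    change ⟪(1 : ℂ) * 1, 1⟫_ℂ • (1 : ℂ) = 1
    simp
  have h3 := A.act_one x v
  rw [h1] at h3
  have h4 : c = c • (1 : ℂ) := by simp
  conv_lhs => rw [h4]
  refine (congrArg (fun z => z v) (map_smul (A.act (y₁ := x) (y₂ := x) rfl) c (1 : ℂ))).trans ?_
  exact congrArg (fun z => c • z) h3

/-- A bundle on `M` as a module for the trivial gerbe. -/
@[reducible]
def HermBundle.toModule (F : HermBundle M) : GerbeModule (BundleGerbe.trivial M) where
  E := F
  act h := LinearMap.mk₂ ℂ (fun (c : ℂ) v => c • F.cast (Eq.symm h) v)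
    (fun c c' v => add_smul c c' _) (fun c c' v => by simp [smul_smul])
    (fun c v v' => by simp) (fun c c' v => by simp [smul_comm c])
  isometric_act {x y} h c v c' v' := by
    change ⟪c • F.cast (Eq.symm h) v, c' • F.cast (Eq.symm h) v'⟫_ℂ = _
    rw [inner_smul_left, inner_smul_right, LinearIsometryEquiv.inner_map_map]
    simp
    ring
  smooth_act := by
    refine isSmoothBilin_of_sections fun n p hp s s' hs hs' => isSmoothAlong_pullback.2 ?_
    have h1 : ContDiff ℝ ∞ s := by
      refine contDiff_congr_fun ((isSmoothAlong_vec (E := HermBundle.one (Fib2 (id : M → M))) hp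
        rfl (fun _ => trivial) ()).inner hp hs) fun t => ?_
      simp
    exact (isSmoothAlong_cast (p' := fun t => (p t).1.1) (fun t => (p t).2.symm)
      ((isSmoothAlong_pullback (q := p) (g := FibProd.snd id id)).1 hs')).smul h1
  mul_act {x y z} h k c c' v := by
    obtain rfl : x = y := h
    obtain rfl : x = z := k
    exact mul_smul c c' v

theorem GerbeModule.trivial_iso_iff {A B : GerbeModule (BundleGerbe.trivial M)} :
    Nonempty (ModuleIso A B) ↔ Nonempty (BundleIso A.E B.E) :=
  ⟨fun ⟨φ⟩ => ⟨φ.toBundleIso⟩, fun ⟨φ⟩ => ⟨{ φ with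
    map_act := fun {x y} h c v => by
      have h1 := A.trivial_act h c v
      have h2 := B.trivial_act h c (φ.equiv y v)
      refine ((congrArg (φ.equiv x) h1).trans ?_).trans h2.symm
      rw [map_smul]
      exact congrArg (fun z => c • z) (φ.cast_equiv _ v).symm }⟩⟩

namespace BundleGerbe.Trivialisation
variable {G : BundleGerbe.{u, v} M} (T : G.Trivialisation)

/-- The twist given by a trivialisation. -/
@[reducible]
def toTwist : Twist.{u, u, v, v} (BundleGerbe.trivial M) G where
  W := G.Y
  p := G.π
  smooth_p := G.smooth_π
  split_p := G.locSplit
  q := id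
  smooth_q := fun _ _ hp => hp
  split_q y := ⟨⟨Set.univ, @isOpen_univ _ dTopology, id, fun _ => rfl, fun _ _ hp _ => hp⟩, Set.mem_univ y⟩
  π_eq _ := rfl
  K := T.T
  rank_one := T.rank_one
  m h k := LinearMap.mk₂ ℂ (fun (c : ℂ) t => c • T.τ k t)
    (fun c c' t => add_smul c c' _) (fun c c' t => mul_smul c c' _)
    (fun c t t' => by rw [map_add, smul_add]) (fun c c' t => by rw [map_smul, smul_comm])
  inner_m h k l t f l' t' f' := by
    change ⟪l • T.τ k t f, l' • T.τ k t' f'⟫_ℂ = _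
    rw [inner_smul_left, inner_smul_right, T.isometric_τ, RCLike.inner_apply]
    ring
  smooth_m {n p₁ p₂} hp₁ hp₂ h k l s f hl hs hf := by
    have hP : IsPlot fun t => (pair (h t) : Fib2 (id : M → M)) :=
      ⟨G.smooth_π n _ hp₁, G.smooth_π n _ hp₂⟩
    have hQ : IsPlot fun t => pair (k t) := ⟨hp₁, hp₂⟩
    have h1 : ContDiff ℝ ∞ l := by
      refine contDiff_congr_fun ((isSmoothAlong_vec (E := HermBundle.one (Fib2 (id : M → M))) hP
        rfl (fun _ => Set.mem_univ _) ()).inner hP hl) fun t => ?_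
      simp
    exact (T.smooth_τ.apply hQ (isSmoothAlong_pullback.2 hs) (isSmoothAlong_pullback.2 hf)).smul h1
  mul_m h k h' k' l t f l' t' f' := by
    change G.mul k k' (l • T.τ k t f) (l' • T.τ k' t' f') = f' t • (l * l') • T.τ _ t' f
    rw [map_smul, map_smul, LinearMap.smul_apply, T.mul_τ k k', smul_smul, smul_smul, smul_smul]
    congr 1
    ring

/-- Here `p` is π, so the second form of the relation is the required isomorphism of T ⊗ E with the
pull-back. Equivariance under 1 ∈ ℂ, which acts by transport of fibres, is compatibility with the
descent data. -/
theorem descends_of_rel {E' : GerbeModule (BundleGerbe.trivial M)} {E : GerbeModule G}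
    (h : T.toTwist.Rel E' E) : T.Descends E E'.E := by
  obtain ⟨θ⟩ := h.rel'
  refine ⟨{ equiv := θ.equiv, smooth := ?_, smooth_symm := ?_ }, fun {y₁ y₂} h t₁ f₁ t₂ v => ?_⟩
  · rintro _ ⟨e, he, f, hf, rfl⟩ f' hf' i j
    exact θ.smooth _ ⟨e, he, _, ⟨f, hf, rfl⟩, rfl⟩ f' hf' i j
  · rintro f' hf' _ ⟨e, he, f, hf, rfl⟩ i j
    exact θ.smooth_symm f' hf' _ ⟨e, he, _, ⟨f, hf, rfl⟩, rfl⟩ i j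
  have h1 := θ.map_act (y₁ := y₁) (y₂ := y₂) h (1 : ℂ) (t₂ ⊗ₜ v)
  have h2 := E'.trivial_act (x := G.π y₁) (y := G.π y₂) h 1 (θ.equiv y₂ (t₂ ⊗ₜ v))
  have h3 := T.toTwist.smul_pullAct E (w₁ := y₁) (w₂ := y₂) h h (1 : ℂ) t₂ f₁ t₁ v
  have h4 : T.toTwist.m (w₁ := y₁) (w₂ := y₂) h h (1 : ℂ) t₂ f₁ = T.τ h t₂ f₁ :=
    one_smul ℂ (T.τ h t₂ f₁)
  rw [h4] at h3
  refine (congrArg (θ.equiv y₁) h3.symm).trans ((map_smul _ _ _).trans ?_)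
  refine congrArg (fun z => f₁ t₁ • z) ((h1.trans h2).trans ?_)
  exact one_smul _ _

/-- The `K`-group of a trivialised bundle gerbe is the `K`-group of the base. -/
theorem exists_addEquiv : ∃ e : G.K ≃+ KBun M, ∀ E : GerbeModule G, ∃ F : HermBundle M,
    T.Descends E F ∧ e E.toK = F.toK := by
  obtain ⟨e, he⟩ := exists_grothendieck_addEquiv (A := G.Mod) (B := Bun M)
    (p := fun E : GerbeModule G => (Quotient.mk _ E : G.Mod))
    (q := fun F : HermBundle M => (Quotient.mk _ F : Bun M)) Quotient.mk_surjective
    Quotient.mk_surjective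
    -- The twist runs from the trivial gerbe to `G`, so the arguments appear reversed; a bundle on
    -- `M` enters as the bundle underlying a module for the trivial gerbe.
    (R := fun E F => ∃ E' : GerbeModule (BundleGerbe.trivial M), E'.E = F ∧ T.toTwist.Rel E' E)
    (fun E => by
      obtain ⟨E', h⟩ := T.toTwist.exists_rel' E
      exact ⟨E'.E, E', rfl, h⟩)
    (fun F => by
      obtain ⟨E, h⟩ := T.toTwist.exists_rel F.toModule
      exact ⟨E, _, rfl, h⟩)
    (by
      rintro E _ E' _ ⟨A, rfl, h⟩ ⟨A', rfl, h'⟩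
      exact Quotient.eq.trans ((h.iso_iff h').symm.trans (GerbeModule.trivial_iso_iff.trans
        (Quotient.eq (r := bundleSetoid M)).symm)))
    (by
      rintro E _ E' _ ⟨A, rfl, h⟩ ⟨A', rfl, h'⟩
      exact ⟨E.sum E', A.E.sum A'.E, ⟨A.sum A', rfl, h.add h'⟩, rfl, rfl⟩)
  refine ⟨e, fun E => ?_⟩
  obtain ⟨F, ⟨A, rfl, h⟩, h'⟩ := he E
  exact ⟨A.E, T.descends_of_rel h, h'⟩

end BundleGerbe.Trivialisation
end Trivial

/-! ### Operations on the `K`-groups -/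

/-! ### Biadditive maps on Grothendieck groups. -/

section Grothendieck
open Algebra (GrothendieckAddGroup)
open Algebra.GrothendieckAddGroup (of)
variable {A B C : Type*} [AddCommMonoid A] [AddCommMonoid B] [AddCommGroup C]

/-- The extension of a biadditive map to Grothendieck groups. -/
def grothendieckLift₂ (f : A → B → C) (h : ∀ a a' b, f (a + a') b = f a b + f a' b)
    (h' : ∀ a b b', f a (b + b') = f a b + f a b') :
    GrothendieckAddGroup A →+ GrothendieckAddGroup B →+ C :=
  Algebra.GrothendieckAddGroup.lift (AddMonoidHom.mk'
    (fun a => Algebra.GrothendieckAddGroup.lift (AddMonoidHom.mk' (f a) (h' a)))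
    fun a a' => grothendieck_hom_ext fun b => by
      rw [AddMonoidHom.add_apply, grothendieck_lift_of, grothendieck_lift_of, grothendieck_lift_of]
      exact h a a' b)

theorem grothendieckLift₂_of (f : A → B → C) (h : ∀ a a' b, f (a + a') b = f a b + f a' b)
    (h' : ∀ a b b', f a (b + b') = f a b + f a b') (a : A) (b : B) :
    grothendieckLift₂ f h h' (of a) (of b) = f a b := by
  rw [grothendieckLift₂, grothendieck_lift_of]
  exact grothendieck_lift_of _ b

end Grothendieck

/-! ### Equivariance tested on pure tensors. -/

section Linear
variable {A B U U' U'' V V' V'' Z : Type}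
  [AddCommGroup A] [Module ℂ A] [AddCommGroup B] [Module ℂ B] [AddCommGroup U] [Module ℂ U]
  [AddCommGroup U'] [Module ℂ U'] [AddCommGroup V] [Module ℂ V] [AddCommGroup V'] [Module ℂ V']
  [AddCommGroup Z] [Module ℂ Z]

theorem tensorAct_ext (c : U →ₗ[ℂ] U') (β : A →ₗ[ℂ] V →ₗ[ℂ] V') (P : U' ⊗[ℂ] V' →ₗ[ℂ] Z)
    (R : U ⊗[ℂ] V →ₗ[ℂ] Z) (a : A) (h : ∀ u v, P (c u ⊗ₜ β a v) = R (u ⊗ₜ v)) (x : U ⊗[ℂ] V) :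
    P (tensorAct c β a x) = R x :=
  LinearMap.congr_fun (f := P ∘ₗ tensorAct c β a) (TensorProduct.ext' h) x

theorem map₂_ext (β : A →ₗ[ℂ] U →ₗ[ℂ] U') (γ : B →ₗ[ℂ] V →ₗ[ℂ] V') (P : U' ⊗[ℂ] V' →ₗ[ℂ] Z)
    (R : A ⊗[ℂ] B →ₗ[ℂ] U ⊗[ℂ] V →ₗ[ℂ] Z)
    (h : ∀ a b u v, P (β a u ⊗ₜ γ b v) = R (a ⊗ₜ b) (u ⊗ₜ v)) (y : A ⊗[ℂ] B) (x : U ⊗[ℂ] V) :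
    P (TensorProduct.map₂ β γ y x) = R y x := by
  have h1 : (TensorProduct.map₂ β γ).compr₂ P = R :=
    TensorProduct.ext' fun a b => TensorProduct.ext' fun u v => h a b u v
  exact LinearMap.congr_fun₂ h1 y x

end Linear

/-! ### Distributivity and associativity with a pulled-back factor. -/

section BundleIsos
variable {X Z : Type*} [DiffeologicalSpace X] [DiffeologicalSpace Z]

/-- Distributivity of `⊗` over the hilbertian direct sum, on the left. -/
def sumTensorLin {U V W : Type} [NormedAddCommGroup U] [InnerProductSpace ℂ U]
    [NormedAddCommGroup V] [InnerProductSpace ℂ V] [NormedAddCommGroup W]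
    [InnerProductSpace ℂ W] :
    WithLp 2 (V × W) ⊗[ℂ] U ≃ₗ[ℂ] WithLp 2 ((V ⊗[ℂ] U) × (W ⊗[ℂ] U)) :=
  (TensorProduct.comm ℂ _ _).trans (tensorSumLin.trans ((sumLin _ _).trans
    (((TensorProduct.comm ℂ _ _).prodCongr (TensorProduct.comm ℂ _ _)).trans (sumLin _ _).symm)))

/-- Distributivity of `⊗` over the pull-back of a direct sum, on the left. -/
def BundleIso.pullbackSumTensor (K : HermBundle Z) (E F : HermBundle X) (g : Z → X)
    (hg : DSmooth g) : BundleIso (((E.sum F).pullback g hg).tensor K)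
      (((E.pullback g hg).tensor K).sum ((F.pullback g hg).tensor K)) :=
  (BundleIso.tensorComm _ K).trans ((BundleIso.tensorPullbackSum K E F g hg).trans
    (.sumCongr (.tensorComm K _) (.tensorComm K _)))

/-- Associativity of `⊗`, with a pulled back tensor product. -/
def BundleIso.pullbackTensorAssoc (K : HermBundle Z) (E F : HermBundle X) (g : Z → X)
    (hg : DSmooth g) : BundleIso (((E.tensor F).pullback g hg).tensor K)
      ((E.pullback g hg).tensor ((F.pullback g hg).tensor K)) where
  equiv z := TensorProduct.assoc ℂ _ _ _
  smooth := by
    rintro _ ⟨_, ⟨_, ⟨e, he, f, hf, rfl⟩, rfl⟩, k, hk, rfl⟩ f' hf' i j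
    exact (BundleIso.tensorAssoc (E.pullback g hg) (F.pullback g hg) K).smooth _
      ⟨_, ⟨_, ⟨e, he, rfl⟩, _, ⟨f, hf, rfl⟩, rfl⟩, k, hk, rfl⟩ f' hf' i j
  smooth_symm := by
    rintro f' hf' _ ⟨_, ⟨_, ⟨e, he, f, hf, rfl⟩, rfl⟩, k, hk, rfl⟩ i j
    exact (BundleIso.tensorAssoc (E.pullback g hg) (F.pullback g hg) K).smooth_symm f' hf' _
      ⟨_, ⟨_, ⟨e, he, rfl⟩, _, ⟨f, hf, rfl⟩, rfl⟩, k, hk, rfl⟩ i j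

/-- The pull-back of the trivial line bundle is neutral for `⊗`. -/
def BundleIso.pullbackOneTensor (K : HermBundle Z) (g : Z → X) (hg : DSmooth g) :
    BundleIso (((HermBundle.one X).pullback g hg).tensor K) K where
  equiv z := TensorProduct.lid ℂ _
  smooth := by
    rintro _ ⟨_, ⟨_, rfl, rfl⟩, k, hk, rfl⟩ f' hf' i j
    exact (BundleIso.oneTensor K).smooth _ ⟨_, rfl, k, hk, rfl⟩ f' hf' i j
  smooth_symm := by
    rintro f' hf' _ ⟨_, ⟨_, rfl, rfl⟩, k, hk, rfl⟩ i j
    exact (BundleIso.oneTensor K).smooth_symm f' hf' _ ⟨_, rfl, k, hk, rfl⟩ i j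

theorem HermBundle.cast_sum (E F : HermBundle X) {x y : X} (h : x = y)
    (v : (E.sum F).fiber x) : (E.sum F).cast h v = WithLp.toLp 2 (E.cast h v.fst, F.cast h v.snd) := by
  subst h; rfl

theorem HermBundle.cast_tmul (E F : HermBundle X) {x y : X} (h : x = y) (v : E.fiber x)
    (v' : F.fiber x) : (E.tensor F).cast h (v ⊗ₜ v') = E.cast h v ⊗ₜ F.cast h v' := by
  subst h; rfl

theorem HermBundle.cast_one {x y : X} (h : x = y) (c : ℂ) :
    (HermBundle.one X).cast h c = c := by
  subst h; rfl

end BundleIsos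

/-! ### Module isomorphisms behind the identities in the K-groups. -/

section ModuleIsos
variable {M : Type u} [DiffeologicalSpace M] {G : BundleGerbe.{u, v} M}

/-- A bundle isomorphism from `π⁻¹(F) ⊗ E` that is equivariant on pure tensors. -/
def ModuleIso.ofTensorBundle {F : HermBundle M} {E A : GerbeModule G}
    (φ : BundleIso (E.tensorBundle F).E A.E)
    (h : ∀ {y₁ y₂ : G.Y} (h : G.π y₁ = G.π y₂) (a : G.L.fiber (pair h)) (u : F.fiber (G.π y₂))
      (v : E.E.fiber y₂), φ.equiv y₁ (F.cast h.symm u ⊗ₜ E.act h a v) =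
        A.act h a (φ.equiv y₂ (u ⊗ₜ v))) : ModuleIso (E.tensorBundle F) A :=
  { φ with
    map_act := fun {y₁ y₂} k a x => tensorAct_ext _ (E.act k) (φ.equiv y₁).toLinearMap
      (A.act k a ∘ₗ (φ.equiv y₂).toLinearMap) a (fun u v => h k a u v) x }

def ModuleIso.tensorBundleCongr {F F' : HermBundle M} {E E' : GerbeModule G}
    (φ : BundleIso F F') (ψ : ModuleIso E E') :
    ModuleIso (E.tensorBundle F) (E'.tensorBundle F') :=
  .ofTensorBundle (BundleIso.tensorCongr (φ.pullback G.π G.smooth_π) ψ.toBundleIso)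
    fun {_ _} h a u v => by
      change φ.equiv _ (F.cast _ u) ⊗ₜ ψ.equiv _ (E.act h a v) =
        F'.cast _ (φ.equiv _ u) ⊗ₜ E'.act h a (ψ.equiv _ v)
      rw [φ.cast_equiv, ψ.map_act]

def ModuleIso.tensorBundleSum (F : HermBundle M) (E E' : GerbeModule G) :
    ModuleIso ((E.sum E').tensorBundle F) ((E.tensorBundle F).sum (E'.tensorBundle F)) :=
  .ofTensorBundle (BundleIso.tensorSum (F.pullback G.π G.smooth_π) E.E E'.E)
    fun _ _ _ _ => rfl

def ModuleIso.sumTensorBundle (F F' : HermBundle M) (E : GerbeModule G) :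
    ModuleIso (E.tensorBundle (F.sum F')) ((E.tensorBundle F).sum (E.tensorBundle F')) :=
  .ofTensorBundle (BundleIso.pullbackSumTensor E.E F F' G.π G.smooth_π)
    fun {_ _} h a u v =>
      (congrArg (fun z => sumTensorLin (z ⊗ₜ E.act h a v)) (F.cast_sum F' _ u)).trans rfl

def ModuleIso.tensorBundleAssoc (F F' : HermBundle M) (E : GerbeModule G) :
    ModuleIso (E.tensorBundle (F.tensor F')) ((E.tensorBundle F').tensorBundle F) :=
  .ofTensorBundle (BundleIso.pullbackTensorAssoc E.E F F' G.π G.smooth_π)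
    fun {_ _} h a u v => by
      induction u using TensorProduct.induction_on with
      | zero => simp only [map_zero, TensorProduct.zero_tmul]
      | add u u' hu hu' => simp only [map_add, TensorProduct.add_tmul, hu, hu']
      | tmul u u' => exact (congrArg (fun z => TensorProduct.assoc ℂ _ _ _ (z ⊗ₜ E.act h a v))
          (F.cast_tmul F' _ u u')).trans rfl

def ModuleIso.oneTensorBundle (E : GerbeModule G) :
    ModuleIso (E.tensorBundle (HermBundle.one M)) E :=
  .ofTensorBundle (BundleIso.pullbackOneTensor E.E G.π G.smooth_π)
    fun {_ _} h a u v => (congrArg (fun z => TensorProduct.lid ℂ _ (z ⊗ₜ E.act h a v))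
      (HermBundle.cast_one _ u)).trans (map_smul (E.act h a) u v).symm

variable {H : BundleGerbe.{u, w} M}

/-- A bundle isomorphism from `E ⊗ F` that is equivariant on pure tensors. -/
def ModuleIso.ofTensor {E : GerbeModule G} {F : GerbeModule H} {A : GerbeModule (G.tensor H)}
    (φ : BundleIso (E.tensor F).E A.E)
    (h : ∀ {q₁ q₂ : FibProd G.π H.π} (h : G.π q₁.1.1 = G.π q₂.1.1)
      (k : H.π q₁.1.2 = H.π q₂.1.2) (a : G.L.fiber (pair h)) (b : H.L.fiber (pair k))
      (u : E.E.fiber q₂.1.1) (v : F.E.fiber q₂.1.2),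
      φ.equiv q₁ (E.act h a u ⊗ₜ F.act k b v) =
        A.act (y₁ := q₁) (y₂ := q₂) h (a ⊗ₜ b) (φ.equiv q₂ (u ⊗ₜ v))) :
    ModuleIso (E.tensor F) A :=
  { φ with
    map_act := fun {q₁ q₂} k y x => map₂_ext (E.act k) (F.act (q₁.2.symm.trans (k.trans q₂.2)))
      (φ.equiv q₁).toLinearMap
      ((A.act (y₁ := q₁) (y₂ := q₂) k).compl₂ (φ.equiv q₂).toLinearMap)
      (fun a b u v => h k _ a b u v) y x }

def ModuleIso.tensorCongr {E E' : GerbeModule G} {F F' : GerbeModule H} (φ : ModuleIso E E')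
    (ψ : ModuleIso F F') : ModuleIso (E.tensor F) (E'.tensor F') :=
  .ofTensor (BundleIso.tensorCongr (φ.toBundleIso.pullback _ (FibProd.dSmooth_fst _ _))
      (ψ.toBundleIso.pullback _ (FibProd.dSmooth_snd _ _))) fun {_ _} h k a b u v =>
    congrArg₂ (fun x y => x ⊗ₜ y) (φ.map_act h a u) (ψ.map_act k b v)

def ModuleIso.tensorSum (E : GerbeModule G) (F F' : GerbeModule H) :
    ModuleIso (E.tensor (F.sum F')) ((E.tensor F).sum (E.tensor F')) :=
  .ofTensor (BundleIso.tensorPullbackSum _ F.E F'.E _ (FibProd.dSmooth_snd _ _))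
    fun _ _ _ _ _ _ => rfl

def ModuleIso.sumTensor (E E' : GerbeModule G) (F : GerbeModule H) :
    ModuleIso ((E.sum E').tensor F) ((E.tensor F).sum (E'.tensor F)) :=
  .ofTensor (BundleIso.pullbackSumTensor _ E.E E'.E _ (FibProd.dSmooth_fst _ _))
    fun _ _ _ _ _ _ => rfl

variable {N : Type w} [DiffeologicalSpace N] (f : N → M) (hf : DSmooth f)

def ModuleIso.pullbackCongr {E E' : GerbeModule G} (φ : ModuleIso E E') :
    ModuleIso (E.pullback f hf) (E'.pullback f hf) :=
  { φ.toBundleIso.pullback (FibProd.snd f G.π) (FibProd.dSmooth_snd _ _) with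
    map_act := fun _ _ _ => φ.map_act _ _ _ }

def ModuleIso.pullbackSum (E E' : GerbeModule G) :
    ModuleIso ((E.sum E').pullback f hf) ((E.pullback f hf).sum (E'.pullback f hf)) :=
  { BundleIso.pullbackSum E.E E'.E (FibProd.snd f G.π) (FibProd.dSmooth_snd _ _) with
    map_act := fun _ _ _ => rfl }

end ModuleIsos

/-! ### The action of K(M), the product and the pull-back on K-groups. -/

section KGroups
variable {M : Type u} [DiffeologicalSpace M] {G : BundleGerbe.{u, v} M}

theorem GerbeModule.toK_congr {E E' : GerbeModule G} (φ : ModuleIso E E') : E.toK = E'.toK :=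
  congrArg Algebra.GrothendieckAddGroup.of (Quotient.sound ⟨φ⟩ : (Quotient.mk _ E : G.Mod) = _)

theorem GerbeModule.toK_sum (E E' : GerbeModule G) : (E.sum E').toK = E.toK + E'.toK :=
  have h (a b : G.Mod) : Algebra.GrothendieckAddGroup.of (a + b) =
    Algebra.GrothendieckAddGroup.of a + Algebra.GrothendieckAddGroup.of b := map_add _ a b
  h (Quotient.mk _ E) (Quotient.mk _ E')

variable (G) in
/-- The action of `K(M)` on the `K`-group of a bundle gerbe. -/
def BundleGerbe.smulK : KBun M →+ G.K →+ G.K :=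
  grothendieckLift₂ (A := Bun M) (B := G.Mod) (Quotient.lift₂ (fun F E =>
      (GerbeModule.tensorBundle F E).toK) fun _ _ _ _ ⟨φ⟩ ⟨ψ⟩ =>
        GerbeModule.toK_congr (.tensorBundleCongr φ ψ))
    (by
      rintro ⟨F⟩ ⟨F'⟩ ⟨E⟩
      exact (GerbeModule.toK_congr (.sumTensorBundle F F' E)).trans (GerbeModule.toK_sum _ _))
    (by
      rintro ⟨F⟩ ⟨E⟩ ⟨E'⟩
      exact (GerbeModule.toK_congr (.tensorBundleSum F E E')).trans (GerbeModule.toK_sum _ _))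

theorem BundleGerbe.smulK_toK (F : HermBundle M) (E : GerbeModule G) :
    G.smulK F.toK E.toK = (E.tensorBundle F).toK :=
  grothendieckLift₂_of _ _ _ _ _

theorem GerbeModule.exists_toK (z : G.K) : ∃ E E' : GerbeModule G, z = E.toK - E'.toK := by
  obtain ⟨⟨E⟩, ⟨E'⟩, h⟩ := grothendieck_exists z
  exact ⟨E, E', h⟩

theorem HermBundle.exists_toK (z : KBun M) : ∃ E E' : HermBundle M, z = E.toK - E'.toK := by
  obtain ⟨⟨E⟩, ⟨E'⟩, h⟩ := grothendieck_exists z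
  exact ⟨E, E', h⟩

variable (G) in
/-- `K_bg(L)` is a module over `K(M)`. -/
@[reducible]
def BundleGerbe.moduleK : Module (KBun M) G.K where
  smul z x := G.smulK z x
  one_smul x := by
    obtain ⟨E, E', rfl⟩ := GerbeModule.exists_toK x
    change G.smulK (HermBundle.one M).toK _ = _
    rw [map_sub, smulK_toK, smulK_toK, GerbeModule.toK_congr (.oneTensorBundle E),
      GerbeModule.toK_congr (.oneTensorBundle E')]
  mul_smul a b x := by
    obtain ⟨A, A', rfl⟩ := HermBundle.exists_toK a
    obtain ⟨B, B', rfl⟩ := HermBundle.exists_toK b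
    obtain ⟨E, E', rfl⟩ := GerbeModule.exists_toK x
    have h1 : ∀ A B : HermBundle M, A.toK * B.toK = (A.tensor B).toK := fun A B => of_mul_of _ _
    have h2 : ∀ (A B : HermBundle M) (E : GerbeModule G),
        (E.tensorBundle (A.tensor B)).toK = ((E.tensorBundle B).tensorBundle A).toK :=
      fun A B E => GerbeModule.toK_congr (.tensorBundleAssoc A B E)
    change G.smulK (_ * _) _ = G.smulK _ (G.smulK _ _)
    simp only [sub_mul, mul_sub, map_sub, AddMonoidHom.sub_apply, h1, smulK_toK, h2]
  smul_zero z := map_zero (G.smulK z)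
  smul_add z := map_add (G.smulK z)
  add_smul z z' x := by
    change G.smulK _ _ = _
    rw [map_add]
    rfl
  zero_smul x := by
    change G.smulK _ _ = _
    rw [map_zero]
    rfl

variable (G) in
/-- The product `K_bg(L) ⊗ K_bg(J) → K_bg(L ⊗ J)`. -/
def BundleGerbe.tensorK (H : BundleGerbe.{u, w} M) : G.K ⊗[ℤ] H.K →+ (G.tensor H).K :=
  TensorProduct.liftAddHom (grothendieckLift₂ (A := G.Mod) (B := H.Mod)
    (Quotient.lift₂ (fun E F => (GerbeModule.tensor E F).toK) fun _ _ _ _ ⟨φ⟩ ⟨ψ⟩ =>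
        GerbeModule.toK_congr (.tensorCongr φ ψ))
    (by
      rintro ⟨E⟩ ⟨E'⟩ ⟨F⟩
      exact (GerbeModule.toK_congr (.sumTensor E E' F)).trans (GerbeModule.toK_sum _ _))
    (by
      rintro ⟨E⟩ ⟨F⟩ ⟨F'⟩
      exact (GerbeModule.toK_congr (.tensorSum E F F')).trans (GerbeModule.toK_sum _ _)))
    -- Balancedness over ℤ is automatic for additive maps.
    fun r x y => by rw [map_zsmul, map_zsmul, AddMonoidHom.zsmul_apply]

theorem BundleGerbe.tensorK_tmul {H : BundleGerbe.{u, w} M} (E : GerbeModule G)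
    (F : GerbeModule H) : G.tensorK H (E.toK ⊗ₜ F.toK) = (E.tensor F).toK := by
  rw [tensorK, TensorProduct.liftAddHom_tmul]
  exact grothendieckLift₂_of _ _ _ _ _

variable (G) in
/-- The pull-back `K_bg(L) → K_bg(f⁻¹(L))`. -/
def BundleGerbe.pullbackK {N : Type w} [DiffeologicalSpace N] (f : N → M) (hf : DSmooth f) :
    G.K →+ (G.pullback f hf).K :=
  Algebra.GrothendieckAddGroup.lift (AddMonoidHom.mk'
    (Quotient.lift (fun E => (GerbeModule.pullback E f hf).toK)
      fun _ _ ⟨φ⟩ => GerbeModule.toK_congr (.pullbackCongr f hf φ))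
    (by
      rintro ⟨E⟩ ⟨E'⟩
      exact (GerbeModule.toK_congr (.pullbackSum f hf E E')).trans (GerbeModule.toK_sum _ _)))

theorem BundleGerbe.pullbackK_toK {N : Type w} [DiffeologicalSpace N] (f : N → M)
    (hf : DSmooth f) (E : GerbeModule G) : G.pullbackK f hf E.toK = (E.pullback f hf).toK :=
  grothendieck_lift_of _ _

end KGroups

/-! ### Dixmier–Douady classes -/

section DixmierDouady
variable {M : Type u} [TopologicalSpace M] [DiffeologicalSpace M]

namespace BundleGerbe
variable {G : BundleGerbe.{u, v} M} {H : BundleGerbe.{u, w} M}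

/-- Restriction of local data to a smaller cover. -/
@[reducible]
def LocalData.restrict (D : G.LocalData) (U : PointCover M) (hU : ∀ x, U.set x ⊆ D.U.set x) :
    G.LocalData where
  U := U
  s x m := D.s x ⟨m, hU x m.2⟩
  smooth_s x n p hp := D.smooth_s x n (fun t => ⟨p t, hU x (p t).2⟩) hp
  π_s x m := D.π_s x ⟨m, hU x m.2⟩
  σ x y m hx hy := D.σ x y m (hU x hx) (hU y hy)
  norm_σ x y m _ _ := D.norm_σ x y m _ _
  smooth_σ x y n p hp hx hy := D.smooth_σ x y n p hp (fun t => hU x (hx t)) fun t => hU y (hy t)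
  ζ := D.ζ
  smooth_ζ x := (D.smooth_ζ x).mono fun _ hm => PointCover.mem_overlap.2 fun i =>
    hU _ (PointCover.mem_overlap.1 hm i)
  mul_σ x y z m _ _ _ := D.mul_σ x y z m _ _ _

/-- The product of local data over the same cover. -/
@[reducible]
def LocalData.tensor (D : G.LocalData) (D' : H.LocalData) (h : D.U = D'.U) :
    (G.tensor H).LocalData where
  U := D.U
  s x m := ⟨(D.s x m, D'.s x ⟨m, h ▸ m.2⟩), (D.π_s x m).trans (D'.π_s x ⟨m, h ▸ m.2⟩).symm⟩
  smooth_s x n p hp := ⟨D.smooth_s x n p hp, D'.smooth_s x n (fun t => ⟨p t, h ▸ (p t).2⟩) hp⟩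
  π_s x m := D.π_s x m
  σ x y m hx hy := D.σ x y m hx hy ⊗ₜ D'.σ x y m (h ▸ hx) (h ▸ hy)
  norm_σ x y m hx hy := by
    rw [TensorProduct.norm_tmul, D.norm_σ, D'.norm_σ, _root_.mul_one]
  smooth_σ x y n p hp hx hy := by
    have h1 := D.smooth_σ x y n p hp hx hy
    have h2 := D'.smooth_σ x y n p hp (fun t => h ▸ hx t) (fun t => h ▸ hy t)
    exact (isSmoothAlong_pullback (g := FibProd.fst₂ G.π H.π) (hg := FibProd.dSmooth_fst₂ _ _)).2 h1 |>.tmul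
      ((isSmoothAlong_pullback (g := FibProd.snd₂ G.π H.π) (hg := FibProd.dSmooth_snd₂ _ _)).2 h2)
  ζ := D.ζ + D'.ζ
  smooth_ζ x n p hp := (D.smooth_ζ x n p hp).add (h ▸ D'.smooth_ζ x n p hp)
  mul_σ x y z m hx hy hz := by
    have h1 := D.mul_σ x y z m hx hy hz
    have h2 := D'.mul_σ x y z m (h ▸ hx) (h ▸ hy) (h ▸ hz)
    refine (congrArg₂ (fun a b => a ⊗ₜ b) h1 h2).trans ?_
    rw [TensorProduct.smul_tmul_smul, ← Complex.exp_add]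
    congr 2
    simp
    ring

/-- The dual local data. -/
@[reducible]
def LocalData.dual (D : G.LocalData) : G.dual.LocalData where
  U := D.U
  s := D.s
  smooth_s := D.smooth_s
  π_s := D.π_s
  σ x y m hx hy := InnerProductSpace.toDual ℂ _ (D.σ x y m hx hy)
  norm_σ x y m hx hy := by
    rw [LinearIsometryEquiv.norm_map, D.norm_σ]
  smooth_σ x y n p hp hx hy := (D.smooth_σ x y n p hp hx hy).toDual
  -- The Riesz map is conjugate-linear, and conjugating exp(2πiζ) changes the sign of ζ.
  ζ := -D.ζ
  smooth_ζ x n p hp := (D.smooth_ζ x n p hp).neg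
  mul_σ x y z m hx hy hz := by
    have h1 := D.mul_σ x y z m hx hy hz
    refine (G.dualMul_toDual _ _ _ _).trans ?_
    rw [h1, map_smulₛₗ, ← Complex.exp_conj]
    congr 2
    simp [Complex.conj_ofNat]

/-- The pull-back of local data. -/
@[reducible]
def LocalData.pullback {N : Type w} [TopologicalSpace N] [DiffeologicalSpace N]
    (D : G.LocalData) {f : N → M} (hf : DSmooth f) (hc : Continuous f) :
    (G.pullback f hf).LocalData where
  U := D.U.comap f hc
  s x m := ⟨(m, D.s (f x) ⟨f m, m.2⟩), (D.π_s (f x) ⟨f m, m.2⟩).symm⟩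
  smooth_s x n p hp := ⟨hp, D.smooth_s (f x) n (fun t => ⟨f (p t), (p t).2⟩) (hf n _ hp)⟩
  π_s x m := rfl
  σ x y m hx hy := D.σ (f x) (f y) (f m) hx hy
  norm_σ x y m hx hy := D.norm_σ _ _ _ _ _
  smooth_σ x y n p hp hx hy := isSmoothAlong_pullback.2
    (D.smooth_σ (f x) (f y) n (fun t => f (p t)) (hf n _ hp) hx hy)
  ζ y m := D.ζ (f ∘ y) (f m)
  smooth_ζ y := ((D.smooth_ζ (f ∘ y)).comp hf).mono fun m hm => PointCover.mem_overlap_comap hm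
  mul_σ x y z m hx hy hz := by
    have h1 := D.mul_σ (f x) (f y) (f z) (f m) hx hy hz
    have h2 : f ∘ ![x, y, z] = ![f x, f y, f z] := by
      funext i
      fin_cases i <;> rfl
    rw [h2]
    exact h1

theorem HasDDClass.tensor {h h' : CechH3 M} (hG : G.HasDDClass h) (hH : H.HasDDClass h') :
    (G.tensor H).HasDDClass (h + h') := by
  obtain ⟨D, c, hc, rfl⟩ := hG
  obtain ⟨D', c', hc', rfl⟩ := hH
  refine ⟨(D.restrict (D.U.inf D'.U) fun x m hm => hm.1).tensor
    (D'.restrict (D.U.inf D'.U) fun x m hm => hm.2) rfl, c + c', fun x m hm => ?_, rfl⟩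
  have h1 := hc x m (PointCover.overlap_inf_left D.U D'.U x hm)
  have h2 := hc' x m (PointCover.overlap_inf_right D.U D'.U x hm)
  change ((c.1 x m + c'.1 x m : ℤ) : ℝ) = cechδ (D.ζ + D'.ζ) x m
  rw [cechδ_add, Int.cast_add, h1, h2]

theorem HasDDClass.dual {h : CechH3 M} (hG : G.HasDDClass h) : G.dual.HasDDClass (-h) := by
  obtain ⟨D, c, hc, rfl⟩ := hG
  refine ⟨D.dual, -c, fun x m hm => ?_, rfl⟩
  change ((-c.1 x m : ℤ) : ℝ) = cechδ (-D.ζ) x m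
  rw [cechδ_neg, Int.cast_neg, hc x m hm]

theorem HasDDClass.pullback {N : Type w} [TopologicalSpace N] [DiffeologicalSpace N]
    {h : CechH3 M} (hG : G.HasDDClass h) {f : N → M} (hf : DSmooth f) (hc : Continuous f) :
    (G.pullback f hf).HasDDClass (CechH3.pullback f hc h) := by
  obtain ⟨D, c, h, rfl⟩ := hG
  refine ⟨D.pullback hf hc, cechCocycles.pullback f hc 4 c, fun x m hm => ?_, rfl⟩
  exact h (f ∘ x) (f m) (PointCover.mem_overlap_comap (hf := hc) hm)

end BundleGerbe
end DixmierDouady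

/-! ### Trivialisations from modules of rank one -/

section Lines
variable {X : Type*} [DiffeologicalSpace X]

theorem inner_dual_unit (K : HermBundle X) {y : X} (h : Module.finrank ℂ (K.fiber y) = 1)
    {t : K.fiber y} (ht : ‖t‖ = 1) (g g' : StrongDual ℂ (K.fiber y)) :
    ⟪g, g'⟫_ℂ = (starRingEnd ℂ) (g t) * g' t := by
  rw [dual_inner, Twist.inner_dual_line h ht, mul_comm, ← inner_conj_symm t,
    InnerProductSpace.toDual_symm_apply, InnerProductSpace.toDual_symm_apply]

theorem dual_eq_smul_toDual (K : HermBundle X) {y : X} (h : Module.finrank ℂ (K.fiber y) = 1)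
    {t : K.fiber y} (ht : ‖t‖ = 1) (g : StrongDual ℂ (K.fiber y)) :
    g = g t • InnerProductSpace.toDual ℂ _ t := by
  ext s
  conv_lhs => rw [← line_eq h ht s]
  simp [mul_comm]

end Lines

namespace GerbeModule
variable {M : Type u} [DiffeologicalSpace M] {G : BundleGerbe.{u, v} M} (S : GerbeModule G)

/-- The map `S_{y₂}^* ⊗ S_{y₁}^{**} → L_{(y₁,y₂)}` given by the action `L ⊗ S → S` and vectors `l`,
`s`. -/
def trivMap {y₁ y₂ : G.Y} (h : G.π y₁ = G.π y₂) (l : G.L.fiber (pair h)) (s : S.E.fiber y₂) :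
    S.E.dual.fiber y₂ →ₗ[ℂ] StrongDual ℂ (S.E.dual.fiber y₁) →ₗ[ℂ] G.L.fiber (pair h) :=
  LinearMap.mk₂ ℂ (fun t F => (t s * F (InnerProductSpace.toDual ℂ _ (S.act h l s))) • l)
    (fun t t' F => by rw [← add_smul, ← add_mul]; rfl)
    (fun c t F => by rw [smul_smul, ← mul_assoc]; rfl)
    (fun t F F' => by rw [← add_smul, ← mul_add]; rfl)
    (fun c t F => by rw [smul_smul, mul_left_comm]; rfl)

theorem trivMap_apply {y₁ y₂ : G.Y} (h : G.π y₁ = G.π y₂) (l : G.L.fiber (pair h))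
    (s : S.E.fiber y₂) (t : S.E.dual.fiber y₂) (F : StrongDual ℂ (S.E.dual.fiber y₁)) :
    S.trivMap h l s t F = (t s * F (InnerProductSpace.toDual ℂ _ (S.act h l s))) • l := rfl


/-- Replacing `l` by cl and `s` by ds with |c| = |d| = 1 produces the factors d, the conjugate of
cd, and c, with product 1. The map is thus canonical, and any local smooth unit sections exhibit it
as smooth. -/
theorem trivMap_congr {y₁ y₂ : G.Y} (hS : Module.finrank ℂ (S.E.fiber y₂) = 1)
    (h : G.π y₁ = G.π y₂) {l l' : G.L.fiber (pair h)} {s s' : S.E.fiber y₂} (hl : ‖l‖ = 1)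
    (hl' : ‖l'‖ = 1) (hs : ‖s‖ = 1) (hs' : ‖s'‖ = 1) : S.trivMap h l s = S.trivMap h l' s' := by
  refine LinearMap.ext₂ fun t F => ?_
  have h1 := line_eq (G.rank_one _) hl l'
  have h2 := line_eq hS hs s'
  set c := ⟪l, l'⟫_ℂ
  set d := ⟪s, s'⟫_ℂ
  have hc : (starRingEnd ℂ) c * c = 1 := by
    rw [← inner_self_unit hl', ← h1, inner_smul_left, inner_smul_right, inner_self_unit hl, mul_one]
  have hd : (starRingEnd ℂ) d * d = 1 := by
    rw [← inner_self_unit hs', ← h2, inner_smul_left, inner_smul_right, inner_self_unit hs, mul_one]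
  rw [trivMap_apply, trivMap_apply, ← h1, ← h2]
  simp only [map_smul, LinearMap.smul_apply, map_smulₛₗ, smul_smul, smul_eq_mul]
  congr 1
  rw [map_mul]
  linear_combination (-(t s * F (InnerProductSpace.toDual ℂ _ (S.act h l s)))) *
    ((starRingEnd ℂ) d * d * hc + hd)

/-- The isomorphism `S_{y₂}^* ⊗ S_{y₁}^{**} ≃ L_{(y₁,y₂)}`. -/
def triv {y₁ y₂ : G.Y} (hS : Module.finrank ℂ (S.E.fiber y₂) = 1) (h : G.π y₁ = G.π y₂) :
    S.E.dual.fiber y₂ →ₗ[ℂ] StrongDual ℂ (S.E.dual.fiber y₁) →ₗ[ℂ] G.L.fiber (pair h) :=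
  S.trivMap h (exists_unit (G.rank_one (pair h))).choose (exists_unit hS).choose

theorem triv_apply {y₁ y₂ : G.Y} (hS : Module.finrank ℂ (S.E.fiber y₂) = 1)
    (h : G.π y₁ = G.π y₂) {l : G.L.fiber (pair h)} {s : S.E.fiber y₂} (hl : ‖l‖ = 1)
    (hs : ‖s‖ = 1) (t : S.E.dual.fiber y₂) (F : StrongDual ℂ (S.E.dual.fiber y₁)) :
    S.triv hS h t F = (t s * F (InnerProductSpace.toDual ℂ _ (S.act h l s))) • l := by
  rw [triv, S.trivMap_congr hS h (exists_unit (G.rank_one (pair h))).choose_spec hl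
    (exists_unit hS).choose_spec hs, trivMap_apply]

theorem smooth_triv (hS : ∀ y, Module.finrank ℂ (S.E.fiber y) = 1) {n : ℕ} {p₁ p₂ : Euc n → G.Y}
    (hp₁ : IsPlot p₁) (hp₂ : IsPlot p₂) {h : ∀ t, G.π (p₁ t) = G.π (p₂ t)}
    {s : ∀ t, S.E.dual.fiber (p₂ t)} {f : ∀ t, S.E.dual.dual.fiber (p₁ t)}
    (hs : IsSmoothAlong S.E.dual p₂ s) (hf : IsSmoothAlong S.E.dual.dual p₁ f) :
    IsSmoothAlong G.L (fun t => pair (h t)) fun t => S.triv (hS _) (h t) (s t) (f t) := by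
  have hP : IsPlot fun t => pair (h t) := ⟨hp₁, hp₂⟩
  refine IsSmoothAlong.of_local hP fun t => ?_
  obtain ⟨O, hO, ht, l, hl, hl'⟩ := exists_unit_nhds G.rank_one hP t
  obtain ⟨O', hO', ht', r, hr, hr'⟩ := exists_unit_nhds hS hp₂ t
  refine ⟨_, hO.inter hO', ⟨ht, ht'⟩, fun g hg hgO => ?_⟩
  have h₁ : IsPlot fun x => p₁ (g x) := isPlot_reparam hp₁ hg
  have h₂ : IsPlot fun x => p₂ (g x) := isPlot_reparam hp₂ hg
  have hlg := hl' g hg fun x => (hgO x).1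
  have hrg := hr' g hg fun x => (hgO x).2
  have h1 := (hs.reparam hg).dual_apply h₂ hrg
  have h2 := (hf.reparam hg).dual_apply h₁
    (S.act_smooth h₁ h₂ (h := fun x => h (g x)) hlg hrg).toDual
  exact (hlg.smul (h1.mul h2)).congr fun x =>
    S.triv_apply (hS _) _ (hl _ (hgO x).1) (hr _ (hgO x).2) _ _

/-- A module of rank one trivialises a bundle gerbe. -/
def trivialisation (hS : ∀ y, Module.finrank ℂ (S.E.fiber y) = 1) : G.Trivialisation where
  T := S.E.dual
  rank_one y := finrank_dual_line (hS y)
  τ h := S.triv (hS _) h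
  isometric_τ {y₁ y₂} h t F t' F' := by
    obtain ⟨l, hl⟩ := exists_unit (G.rank_one (pair h))
    obtain ⟨s, hs⟩ := exists_unit (hS y₂)
    have hu : ‖InnerProductSpace.toDual ℂ _ (S.act h l s)‖ = 1 := by
      rw [LinearIsometryEquiv.norm_map]
      exact (S.isometric_act h).norm hl hs
    rw [S.triv_apply (hS _) h hl hs, S.triv_apply (hS _) h hl hs, inner_smul_left,
      inner_smul_right, inner_self_unit hl, inner_dual_unit S.E (hS _) hs,
      inner_dual_unit S.E.dual (finrank_dual_line (hS _)) hu, map_mul]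
    ring
  smooth_τ := isSmoothBilin_of_sections fun n p hp s s' hs hs' =>
    S.smooth_triv hS (p₁ := fun t => (p t).1.1) (p₂ := fun t => (p t).1.2) hp.1 hp.2
      ((isSmoothAlong_pullback (g := FibProd.snd G.π G.π) (q := p)).1 hs)
      ((isSmoothAlong_pullback (g := FibProd.fst G.π G.π) (q := p)).1 hs')
  mul_τ {y₁ y₂ y₃} h k t₂ F₁ t₃ F₂ := by
    obtain ⟨l, hl⟩ := exists_unit (G.rank_one (pair h))
    obtain ⟨l', hl'⟩ := exists_unit (G.rank_one (pair k))
    obtain ⟨s, hs⟩ := exists_unit (hS y₃)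
    -- The unit vector l's of S_{y₂} is used for the first factor, so that all three maps are
    -- written with the same `l`, `l'`, `s`.
    have hs' : ‖S.act k l' s‖ = 1 := (S.isometric_act k).norm hl' hs
    have hll : ‖G.mul h k l l'‖ = 1 := (G.isometric_mul h k).norm hl hl'
    rw [S.triv_apply (hS _) h hl hs', S.triv_apply (hS _) k hl' hs,
      S.triv_apply (hS _) _ hll hs, S.mul_act, map_smul, map_smul, LinearMap.smul_apply, smul_smul,
      smul_smul]
    congr 1
    -- In the line S_{y₂}* one has t₂ = t₂(l's)(l's)*, which splits F₂(t₂) into the two scalars on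
    -- the left.
    conv_rhs => rw [dual_eq_smul_toDual S.E (hS _) hs' t₂, map_smul, smul_eq_mul]
    ring

end GerbeModule

/-! ### Trivialisations from local data -/

/-- A set with the discrete diffeology, whose plots are the constant maps. -/
def DiscreteSpace (X : Type u) := X

instance (X : Type u) : DiffeologicalSpace (DiscreteSpace X) where
  plots n := {p | ∀ s t, p s = p t}
  constant_plots x := fun _ _ => rfl
  plot_reparam hp _ := fun _ _ => hp _ _
  locality {n p} hp := by
    -- A locally constant map on the connected space ℝⁿ is constant.
    have hc : IsLocallyConstant p := by
      rw [IsLocallyConstant.iff_exists_open]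
      intro x
      obtain ⟨O, hO, hx, h⟩ := hp x
      obtain ⟨r, hr, hrO⟩ := Metric.isOpen_iff.1 hO x hx
      set b := OpenPartialHomeomorph.univBall x r with hb
      have hbt : b.target = Metric.ball x r := OpenPartialHomeomorph.univBall_target x hr
      have h1 := h (f := b) (fun y => hrO (by
        rw [← hbt]; exact b.map_source (by simp [hb]))) OpenPartialHomeomorph.contDiff_univBall
      have h2 : ∀ y ∈ Metric.ball x r, b (b.symm y) = y := fun y hy =>
        b.right_inv (by rwa [hbt])
      refine ⟨_, Metric.isOpen_ball, Metric.mem_ball_self hr, fun y hy => ?_⟩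
      rw [← h2 y hy, ← h2 x (Metric.mem_ball_self hr)]
      exact h1 _ _
    exact fun s t => hc.apply_eq_of_preconnectedSpace s t

/-! ### The rank one module glued from multiplicative sections. -/

section Glue
variable {M : Type u} [DiffeologicalSpace M] {G : BundleGerbe.{u, v} M}

theorem BundleGerbe.mul_smooth {n : ℕ} {p₁ p₂ p₃ : Euc n → G.Y} (hp₁ : IsPlot p₁)
    (hp₂ : IsPlot p₂) (hp₃ : IsPlot p₃) {h : ∀ t, G.π (p₁ t) = G.π (p₂ t)}
    {k : ∀ t, G.π (p₂ t) = G.π (p₃ t)} {a : ∀ t, G.L.fiber (pair (h t))}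
    {b : ∀ t, G.L.fiber (pair (k t))} (ha : IsSmoothAlong G.L (fun t => pair (h t)) a)
    (hb : IsSmoothAlong G.L (fun t => pair (k t)) b) :
    IsSmoothAlong G.L (fun t => pair ((h t).trans (k t))) fun t => G.mul (h t) (k t) (a t) (b t) :=
  (isSmoothAlong_pullback (g := Fib3.p₁₃ G.π)
    (q := fun t => ⟨(p₁ t, p₂ t, p₃ t), h t, k t⟩)).1
    (G.smooth_mul.apply (p := fun t => ⟨(p₁ t, p₂ t, p₃ t), h t, k t⟩) ⟨hp₁, hp₂, hp₃⟩
      (isSmoothAlong_pullback.2 ha) (isSmoothAlong_pullback.2 hb))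

variable [TopologicalSpace M]

namespace BundleGerbe.LocalData
variable (D : G.LocalData)

/-- The sections `σ`, at points that are only propositionally equal. -/
def glue (a b : M) {m m' : M} (e : m = m') (hm : m ∈ D.U.set a) (hm' : m' ∈ D.U.set b) :
    G.L.fiber (pair ((D.π_s a ⟨m, hm⟩).trans (e.trans (D.π_s b ⟨m', hm'⟩).symm))) :=
  G.castL (h := (D.π_s a ⟨m', e ▸ hm⟩).trans (D.π_s b ⟨m', hm'⟩).symm)
    (congrArg (D.s a) (Subtype.ext e.symm)) rfl (D.σ a b m' (e ▸ hm) hm')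

theorem norm_glue (a b : M) {m m' : M} (e : m = m') (hm : m ∈ D.U.set a) (hm' : m' ∈ D.U.set b) :
    ‖D.glue a b e hm hm'‖ = 1 := by
  subst e
  exact D.norm_σ _ _ _ _ _

theorem smooth_glue (a b : M) {n : ℕ} {p p' : Euc n → M} (hp : IsPlot p) (e : ∀ t, p t = p' t)
    (hm : ∀ t, p t ∈ D.U.set a) (hm' : ∀ t, p' t ∈ D.U.set b) :
    IsSmoothAlong G.L
      (fun t => pair ((D.π_s a ⟨p t, hm t⟩).trans ((e t).trans (D.π_s b ⟨p' t, hm' t⟩).symm)))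
      fun t => D.glue a b (e t) (hm t) (hm' t) := by
  obtain rfl : p = p' := funext e
  exact D.smooth_σ a b n p hp hm hm'

variable {D}

theorem mul_glue (hσ : ∀ x y z m hx hy hz, G.mul _ _ (D.σ x y m hx hy) (D.σ y z m hy hz) =
    D.σ x z m hx hz) (a b c : M) {m m' m'' : M} (e : m = m') (e' : m' = m'')
    (hm : m ∈ D.U.set a) (hm' : m' ∈ D.U.set b) (hm'' : m'' ∈ D.U.set c) :
    G.mul _ _ (D.glue a b e hm hm') (D.glue b c e' hm' hm'') =
      D.glue a c (e.trans e') hm hm'' := by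
  subst e e'
  exact hσ _ _ _ _ _ _ _

variable (D)

/-- The disjoint union of the sets `π⁻¹(U_a)`. -/
abbrev Cover := {q : DiscreteSpace M × G.Y // G.π q.2 ∈ D.U.set q.1}

/-- The projection to `Y`. -/
def Cover.proj : D.Cover → G.Y := fun w => w.1.2

theorem Cover.dSmooth_proj : DSmooth (Cover.proj D) := fun _ _ hp => hp.2

/-- Plots of the discrete index set are constant, so a plot stays in a single π⁻¹(U_a). -/
theorem Cover.exists_eq {n : ℕ} {w : Euc n → D.Cover} (hw : IsPlot w) :
    ∃ (a : M) (y : Euc n → G.Y) (h : ∀ t, G.π (y t) ∈ D.U.set a), IsPlot y ∧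
      w = fun t => ⟨(a, y t), h t⟩ := by
  have h1 : ∀ t, (w t).1.1 = (w 0).1.1 := fun t => hw.1 t 0
  refine ⟨(w 0).1.1, fun t => (w t).1.2, fun t => h1 t ▸ (w t).2, hw.2, funext fun t => ?_⟩
  exact Subtype.ext (Prod.ext (h1 t) rfl)

/-- The section `s_a(π(y))`. -/
def Cover.sec (w : D.Cover) : G.Y := D.s w.1.1 ⟨G.π w.1.2, w.2⟩

theorem Cover.π_sec (w : D.Cover) : G.π (Cover.proj D w) = G.π (Cover.sec D w) :=
  (D.π_s w.1.1 ⟨G.π w.1.2, w.2⟩).symm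

theorem Cover.dSmooth_sec : DSmooth (Cover.sec D) := by
  intro n w hw
  obtain ⟨a, y, h, hy, rfl⟩ := Cover.exists_eq D hw
  exact D.smooth_s a n (fun t => ⟨G.π (y t), h t⟩) (G.smooth_π n y hy)

/-- Near `y` the section keeps the constant index π(y), which makes it smooth into the discrete
factor. -/
theorem Cover.locSplit (hU : ∀ a, IsOpen[dTopology] (D.U.set a)) : LocSplit (Cover.proj D) :=
  locSplit_of_sections fun y => ⟨G.π ⁻¹' D.U.set (G.π y), isOpen_preimage G.smooth_π (hU _),
    D.U.mem _, fun z => ⟨(G.π y, z), z.2⟩, fun _ _ hp => ⟨fun _ _ => rfl, hp⟩, fun _ => rfl⟩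

theorem Cover.π_sec_eq {w₁ w₂ : D.Cover} (h : G.π (Cover.proj D w₁) = G.π (Cover.proj D w₂)) :
    G.π (Cover.sec D w₂) = G.π (Cover.sec D w₁) :=
  (Cover.π_sec D w₂).symm.trans (h.symm.trans (Cover.π_sec D w₁))

/-- The sections `σ` on the disjoint union of the sets `π⁻¹(U_a)`. -/
def Cover.glue {w₁ w₂ : D.Cover} (h : G.π (Cover.proj D w₁) = G.π (Cover.proj D w₂)) :
    G.L.fiber (pair (Cover.π_sec_eq D h)) :=
  D.glue w₂.1.1 w₁.1.1 h.symm w₂.2 w₁.2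

theorem Cover.smooth_glue {n : ℕ} {w₁ w₂ : Euc n → D.Cover} (hw₁ : IsPlot w₁) (hw₂ : IsPlot w₂)
    (h : ∀ t, G.π (Cover.proj D (w₁ t)) = G.π (Cover.proj D (w₂ t))) :
    IsSmoothAlong G.L (fun t => pair (Cover.π_sec_eq D (h t))) fun t => Cover.glue D (h t) := by
  obtain ⟨a, y, hy, hp, rfl⟩ := Cover.exists_eq D hw₁
  obtain ⟨b, z, hz, hq, rfl⟩ := Cover.exists_eq D hw₂
  exact D.smooth_glue b a (G.smooth_π n z hq) (fun t => (h t).symm) hz hy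

/-- The action of `L` on the lines `L_{(y,s_a(π(y)))}`. -/
def glueAct {w₁ w₂ : D.Cover} (h : G.π (Cover.proj D w₁) = G.π (Cover.proj D w₂)) :
    G.L.fiber (pair h) →ₗ[ℂ] G.L.fiber (pair (Cover.π_sec D w₂)) →ₗ[ℂ]
      G.L.fiber (pair (Cover.π_sec D w₁)) :=
  -- If w₁ and w₂ have indices a and b, left multiplication by `l` ends at s_b, and right
  -- multiplication by σ_ba moves the end point to s_a.
  (G.mul h (Cover.π_sec D w₂)).compr₂
    ((G.mul (h.trans (Cover.π_sec D w₂)) (Cover.π_sec_eq D h)).flip (Cover.glue D h))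

theorem glueAct_apply {w₁ w₂ : D.Cover} (h : G.π (Cover.proj D w₁) = G.π (Cover.proj D w₂))
    (l : G.L.fiber (pair h)) (s : G.L.fiber (pair (Cover.π_sec D w₂))) :
    D.glueAct h l s = G.mul (h.trans (Cover.π_sec D w₂)) (Cover.π_sec_eq D h)
      (G.mul h (Cover.π_sec D w₂) l s) (Cover.glue D h) := rfl

theorem smooth_glueAct {n : ℕ} {w₁ w₂ : Euc n → D.Cover} (hw₁ : IsPlot w₁) (hw₂ : IsPlot w₂)
    {h : ∀ t, G.π (Cover.proj D (w₁ t)) = G.π (Cover.proj D (w₂ t))}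
    {l : ∀ t, G.L.fiber (pair (h t))} {s : ∀ t, G.L.fiber (pair (Cover.π_sec D (w₂ t)))}
    (hl : IsSmoothAlong G.L (fun t => pair (h t)) l)
    (hs : IsSmoothAlong G.L (fun t => pair (Cover.π_sec D (w₂ t))) s) :
    IsSmoothAlong G.L (fun t => pair (Cover.π_sec D (w₁ t)))
      fun t => D.glueAct (h t) (l t) (s t) := by
  have h1 : IsPlot fun t => Cover.proj D (w₁ t) := Cover.dSmooth_proj D n _ hw₁
  have h2 : IsPlot fun t => Cover.proj D (w₂ t) := Cover.dSmooth_proj D n _ hw₂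
  have h1' : IsPlot fun t => Cover.sec D (w₁ t) := Cover.dSmooth_sec D n _ hw₁
  have h2' : IsPlot fun t => Cover.sec D (w₂ t) := Cover.dSmooth_sec D n _ hw₂
  exact BundleGerbe.mul_smooth h1 h2' h1' (BundleGerbe.mul_smooth h1 h2 h2' hl hs)
    (Cover.smooth_glue D hw₁ hw₂ h)

variable {D}

/-- The sections on the right combine by σ_cb σ_ba = σ_ca, which is where multiplicativity enters;
the rest is associativity. -/
theorem glueAct_mul (hσ : ∀ x y z m hx hy hz, G.mul _ _ (D.σ x y m hx hy) (D.σ y z m hy hz) =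
      D.σ x z m hx hz) {w₁ w₂ w₃ : D.Cover}
    (h : G.π (Cover.proj D w₁) = G.π (Cover.proj D w₂))
    (k : G.π (Cover.proj D w₂) = G.π (Cover.proj D w₃)) (a : G.L.fiber (pair h))
    (b : G.L.fiber (pair k)) (s : G.L.fiber (pair (Cover.π_sec D w₃))) :
    D.glueAct (h.trans k) (G.mul h k a b) s = D.glueAct h a (D.glueAct k b s) := by
  have h1 : G.mul _ _ (Cover.glue D k) (Cover.glue D h) = Cover.glue D (h.trans k) :=
    mul_glue hσ _ _ _ _ _ _ _ _
  rw [glueAct_apply, glueAct_apply, glueAct_apply, ← h1]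
  simp only [G.mul_assoc]

/-- The rank one module `L_{(y,s_a(π(y)))}` on the disjoint union of the `π⁻¹(U_a)`. -/
@[reducible]
def module (hU : ∀ a, IsOpen[dTopology] (D.U.set a))
    (hσ : ∀ x y z m hx hy hz, G.mul _ _ (D.σ x y m hx hy) (D.σ y z m hy hz) =
      D.σ x z m hx hz) :
    GerbeModule (G.refine (Cover.proj D) (Cover.dSmooth_proj D) (Cover.locSplit D hU)) where
  E := G.L.pullback (fun w => pair (Cover.π_sec D w))
    fun n p hp => ⟨hp.2, Cover.dSmooth_sec D n p hp⟩
  act h := D.glueAct h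
  isometric_act {w₁ w₂} h l s l' s' := by
    have h1 := G.isometric_mul (h.trans (Cover.π_sec D w₂)) (Cover.π_sec_eq D h)
      (G.mul h (Cover.π_sec D w₂) l s) (Cover.glue D h) (G.mul h (Cover.π_sec D w₂) l' s')
      (Cover.glue D h)
    have h2 : ‖Cover.glue D h‖ = 1 := D.norm_glue _ _ _ _ _
    rw [inner_self_unit h2, _root_.mul_one] at h1
    exact h1.trans (G.isometric_mul _ _ _ _ _ _)
  smooth_act := isSmoothBilin_of_sections fun n p hp l s hl hs => isSmoothAlong_pullback.2
    (isSmoothAlong_pullback.2 (D.smooth_glueAct (w₁ := fun t => (p t).1.1)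
      (w₂ := fun t => (p t).1.2) (h := fun t => (p t).2) hp.1 hp.2 (isSmoothAlong_pullback.1 hl)
      (isSmoothAlong_pullback.1 (isSmoothAlong_pullback.1 hs))))
  mul_act h k a b s := glueAct_mul hσ h k a b s

/-- A bundle gerbe with multiplicative local sections is trivial. -/
theorem isTrivial (D : G.LocalData) (hU : ∀ a, IsOpen[dTopology] (D.U.set a))
    (hσ : ∀ x y z m hx hy hz, G.mul _ _ (D.σ x y m hx hy) (D.σ y z m hy hz) =
      D.σ x z m hx hz) : G.IsTrivial := by
  -- Between two points over the same `y`, the unit of `L` acts as right multiplication by some σ,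
  -- so this descent glues the lines along σ.
  obtain ⟨S, ⟨φ⟩⟩ := (module hU hσ).exists_descent
  refine ⟨S.trivialisation fun y => ?_⟩
  obtain ⟨w, rfl⟩ := (Cover.locSplit D hU).surjective y
  rw [← G.rank_one (pair (Cover.π_sec D w))]
  exact (φ.equiv w).finrank_eq.symm

end BundleGerbe.LocalData
end Glue

/-! ### Bundle gerbes with vanishing Dixmier–Douady class -/

section Manifold
variable {m : ℕ} {M : Type u} [TopologicalSpace M] [ChartedSpace (EuclideanSpace ℝ (Fin m)) M]

theorem PointCover.isOpen_overlap (U : PointCover M) {k : ℕ} (x : Fin k → M) :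
    IsOpen (U.overlap x) :=
  isOpen_iInter_of_finite fun i => U.isOpen (x i)

/-- A function that is smooth along plots is smooth. -/
theorem SmoothFunOn.contMDiffAt [IsManifold (𝓡 m) ∞ M] [DiffeologicalSpace M]
    [hM : IsManifoldDiffeology m M] {f : M → ℝ} {U : Set M} (hf : SmoothFunOn f U)
    (hU : IsOpen U) {x : M} (hx : x ∈ U) : ContMDiffAt (𝓡 m) 𝓘(ℝ, ℝ) ∞ f x := by
  set φ := chartAt (EuclideanSpace ℝ (Fin m)) x with hφ
  obtain ⟨r, hr, hrt⟩ := Metric.isOpen_iff.1 φ.open_target (φ x) (mem_chart_target _ x)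
  set b := OpenPartialHomeomorph.univBall (φ x) r with hb
  have hbt : b.target = Metric.ball (φ x) r := OpenPartialHomeomorph.univBall_target _ hr
  have hbs : ∀ y, b y ∈ φ.target := fun y => hrt (by
    rw [← hbt]; exact b.map_source (by simp [hb]))
  -- The inverse chart composed with a diffeomorphism of ℝᵐ onto a ball is a plot, and near `x` it
  -- is invertible, so smoothness along it is smoothness of `f`.
  have hp : ContMDiff (𝓡 m) (𝓡 m) ∞ (φ.symm ∘ b) := by
    have h1 : ContMDiffOn (𝓡 m) (𝓡 m) ∞ φ.symm φ.target := contMDiffOn_chart_symm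
    have h2 : ContMDiff (𝓡 m) (𝓡 m) ∞ b :=
      (OpenPartialHomeomorph.contDiff_univBall (n := (⊤ : ℕ∞)) (c := φ x) (r := r)).contMDiff
    exact h1.comp_contMDiff h2 hbs
  have hinv : ∀ y ∈ φ.source, φ y ∈ Metric.ball (φ x) r → φ.symm (b (b.symm (φ y))) = y :=
    fun y hy h => by rw [b.right_inv (by rwa [hbt]), φ.left_inv hy]
  have hxs := mem_chart_source (EuclideanSpace ℝ (Fin m)) x
  have hq : ContMDiffAt (𝓡 m) (𝓡 m) ∞ (b.symm ∘ φ) x := by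
    have h1 : ContMDiffAt (𝓡 m) (𝓡 m) ∞ φ x :=
      (contMDiffOn_chart (I := 𝓡 m) (n := ∞)).contMDiffAt (φ.open_source.mem_nhds hxs)
    have h2 : ContMDiffAt (𝓡 m) (𝓡 m) ∞ b.symm (φ x) :=
      ((OpenPartialHomeomorph.contDiffOn_univBall_symm (c := φ x) (r := r)).contDiffAt
        (Metric.ball_mem_nhds _ hr)).contMDiffAt
    exact h2.comp x h1
  have hfp : ContMDiffAt (𝓡 m) 𝓘(ℝ, ℝ) ∞ (f ∘ (φ.symm ∘ b)) ((b.symm ∘ φ) x) := by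
    refine ((hf m _ (hM.isPlot_iff.2 hp)).contDiffAt ?_).contMDiffAt
    refine (hU.preimage hp.continuous).mem_nhds ?_
    change φ.symm (b (b.symm (φ x))) ∈ U
    rwa [hinv x hxs (Metric.mem_ball_self hr)]
  refine (hfp.comp x hq).congr_of_eventuallyEq ?_
  filter_upwards [φ.open_source.mem_nhds hxs,
    (φ.continuousAt hxs).preimage_mem_nhds (Metric.ball_mem_nhds _ hr)] with y h1 h2
  exact congrArg f (hinv y h1 h2).symm

/-- A continuous integer-valued function is locally constant. -/
theorem contMDiffAt_intCast {c : M → ℤ} {U : Set M} (hc : ContinuousOn c U) (hU : IsOpen U)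
    {x : M} (hx : x ∈ U) : ContMDiffAt (𝓡 m) 𝓘(ℝ, ℝ) ∞ (fun y => (c y : ℝ)) x := by
  refine (contMDiffAt_const (c := (c x : ℝ))).congr_of_eventuallyEq ?_
  filter_upwards [(hc.continuousAt (hU.mem_nhds hx)).preimage_mem_nhds
    ((isOpen_discrete {c x}).mem_nhds rfl)] with y hy
  exact congrArg _ hy

variable (m) in
/-- Smooth Čech cocycles of degree two are coboundaries. -/
theorem exists_cech_primitive [IsManifold (𝓡 m) ∞ M] [T2Space M] [SecondCountableTopology M]
    (U : PointCover M) {ξ : (Fin 3 → M) → M → ℝ}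
    (hξ : ∀ x, ∀ y ∈ U.overlap x, ContMDiffAt (𝓡 m) 𝓘(ℝ, ℝ) ∞ (ξ x) y)
    (h0 : ∀ x, ∀ y ∈ U.overlap x, cechδ ξ x y = 0) :
    ∃ η : M → M → M → ℝ,
      (∀ a b, ContMDiffOn (𝓡 m) 𝓘(ℝ, ℝ) ∞ (η a b) (U.set a ∩ U.set b)) ∧
      ∀ a b c, ∀ y ∈ U.set a, y ∈ U.set b → y ∈ U.set c →
        ξ ![a, b, c] y = η b c y - η a c y + η a b y := by
  have : LocallyCompactSpace M := ChartedSpace.locallyCompactSpace (EuclideanSpace ℝ (Fin m)) M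
  obtain ⟨ρ, hρ⟩ := SmoothPartitionOfUnity.exists_isSubordinate (𝓡 m) (s := Set.univ)
    isClosed_univ U.set U.isOpen fun x _ => Set.mem_iUnion.2 ⟨x, U.mem x⟩
  -- The usual contracting homotopy η_ab = Σ ρ_z ξ_zab. Each term extends by zero because the
  -- support of ρ_z lies in U_z.
  refine ⟨fun a b y => ∑ᶠ z, ρ z y • ξ ![z, a, b] y, fun a b y hy =>
    ContMDiffAt.contMDiffWithinAt (ρ.contMDiffAt_finsum fun z hz => hξ _ y ?_),
    fun a b c y ha hb hc => ?_⟩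
  · refine PointCover.mem_overlap.2 fun i => ?_
    fin_cases i
    exacts [hρ z hz, hy.1, hy.2]
  · dsimp only
    rw [← ρ.sum_finsupport_smul_eq_finsum y fun z => ξ ![z, b, c],
      ← ρ.sum_finsupport_smul_eq_finsum y fun z => ξ ![z, a, c],
      ← ρ.sum_finsupport_smul_eq_finsum y fun z => ξ ![z, a, b],
      ← Finset.sum_sub_distrib, ← Finset.sum_add_distrib]
    have h1 : ∀ z ∈ ρ.finsupport y,
        ρ z y • ξ ![z, b, c] y - ρ z y • ξ ![z, a, c] y + ρ z y • ξ ![z, a, b] y =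
          ρ z y * ξ ![a, b, c] y := by
      intro z hz
      have hzU : y ∈ U.set z := hρ z (subset_closure ((ρ.mem_finsupport y).1 hz))
      -- The cocycle identity at (z, a, b, c) expresses ξ_abc by the terms with first index z;
      -- weighting with ρ_z and summing gives the claim, since Σ ρ_z = 1.
      have h2 := h0 ![z, a, b, c] y (PointCover.mem_overlap.2 fun i => by
        fin_cases i
        exacts [hzU, ha, hb, hc])
      have e0 : ![z, a, b, c] ∘ (0 : Fin 4).succAbove = ![a, b, c] := by
        funext i; fin_cases i <;> rfl
      have e1 : ![z, a, b, c] ∘ (1 : Fin 4).succAbove = ![z, b, c] := by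
        funext i; fin_cases i <;> rfl
      have e2 : ![z, a, b, c] ∘ (2 : Fin 4).succAbove = ![z, a, c] := by
        funext i; fin_cases i <;> rfl
      have e3 : ![z, a, b, c] ∘ (3 : Fin 4).succAbove = ![z, a, b] := by
        funext i; fin_cases i <;> rfl
      rw [cechδ, Fin.sum_univ_four, e0, e1, e2, e3] at h2
      have h3 : ξ ![a, b, c] y = ξ ![z, b, c] y - ξ ![z, a, c] y + ξ ![z, a, b] y := by
        norm_num [Fin.val_two, pow_succ] at h2
        linarith
      rw [h3]
      simp only [smul_eq_mul]
      ring
    rw [Finset.sum_congr rfl h1, ← Finset.sum_mul, ρ.sum_finsupport y (Set.mem_univ y),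
      one_mul]

variable [IsManifold (𝓡 m) ∞ M] [DiffeologicalSpace M] [hM : IsManifoldDiffeology m M]

namespace BundleGerbe
variable {G : BundleGerbe.{u, v} M} {H : BundleGerbe.{u, w} M}

/-- The sections `σ` of local data, corrected by the functions `exp(-2πi η)`. -/
@[reducible]
def LocalData.correct (D : G.LocalData) (η : M → M → M → ℝ)
    (hη : ∀ a b, ContMDiffOn (𝓡 m) 𝓘(ℝ, ℝ) ∞ (η a b) (D.U.set a ∩ D.U.set b))
    (h : ∀ a b c y (ha : y ∈ D.U.set a) (hb : y ∈ D.U.set b) (hc : y ∈ D.U.set c),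
      G.mul _ _ (D.σ a b y ha hb) (D.σ b c y hb hc) =
        Complex.exp (2 * Real.pi * Complex.I * ↑(η b c y - η a c y + η a b y)) •
          D.σ a c y ha hc) : G.LocalData where
  U := D.U
  s := D.s
  smooth_s := D.smooth_s
  π_s := D.π_s
  σ a b y ha hb := Complex.exp (-(2 * Real.pi * Complex.I * η a b y)) • D.σ a b y ha hb
  norm_σ a b y ha hb := by
    rw [norm_smul, D.norm_σ, _root_.mul_one, Complex.norm_exp]
    simp
  smooth_σ a b n p hp ha hb := by
    refine (D.smooth_σ a b n p hp ha hb).smul ?_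
    have h1 : ContDiff ℝ ∞ fun t => η a b (p t) :=
      ((hη a b).comp_contMDiff (hM.isPlot_iff.1 hp) fun t => ⟨ha t, hb t⟩).contDiff
    exact (contDiff_const.mul (Complex.ofRealCLM.contDiff.comp h1)).neg.cexp
  -- The corrected sections are exactly multiplicative: the exponents -η_ab - η_bc and η_bc - η_ac +
  -- η_ab add up to -η_ac.
  ζ := 0
  smooth_ζ x := smoothFunOn_const 0 _
  mul_σ a b c y ha hb hc := by
    rw [map_smul, LinearMap.map_smul₂, h, smul_smul, smul_smul, smul_smul, ← Complex.exp_add,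
      ← Complex.exp_add, ← Complex.exp_add]
    congr 2
    simp only [Pi.zero_apply]
    push_cast
    ring

end BundleGerbe
end Manifold

namespace BundleGerbe
variable {M : Type u} [TopologicalSpace M] [DiffeologicalSpace M] [T2Space M]
  [SecondCountableTopology M] {G : BundleGerbe.{u, v} M} {H : BundleGerbe.{u, w} M}

/-- A bundle gerbe whose Dixmier–Douady class vanishes is trivial. -/
theorem HasDDClass.isTrivial (m : ℕ) [ChartedSpace (EuclideanSpace ℝ (Fin m)) M]
    [IsManifold (𝓡 m) ∞ M] [IsManifoldDiffeology m M] (hG : G.HasDDClass 0) : G.IsTrivial := by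
  obtain ⟨D₀, c, hc, h0⟩ := hG
  obtain ⟨V, b, hb, hcb⟩ : (c : (Fin 4 → M) → M → ℤ) ∈ cechCoboundaries M 3 :=
    AddSubgroup.mem_addSubgroupOf.1 ((QuotientAddGroup.eq_zero_iff c).1 h0.symm)
  set D := D₀.restrict (D₀.U.inf V) fun x y hy => hy.1 with hD
  have hl : ∀ {k : ℕ} (x : Fin k → M), D.U.overlap x ⊆ D₀.U.overlap x :=
    PointCover.overlap_inf_left D₀.U V
  have hr : ∀ {k : ℕ} (x : Fin k → M), D.U.overlap x ⊆ V.overlap x :=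
    PointCover.overlap_inf_right D₀.U V
  -- With c = δζ = δb and `b` integral, ζ - b is a real cocycle. It is smooth because `b` is locally
  -- constant.
  obtain ⟨η, hη, h1⟩ := exists_cech_primitive m D.U (ξ := fun x y => D.ζ x y - b x y)
    (fun x y hy => ((D.smooth_ζ x).contMDiffAt (D.U.isOpen_overlap x) hy).sub
      (contMDiffAt_intCast (hb x) (V.isOpen_overlap x) (hr x hy)))
    (fun x y hy => by
      have h2 := hc x y (hl x hy)
      rw [hcb x y (hr x hy)] at h2
      have h3 : cechδ D.ζ x y = ((cechδ b x y : ℤ) : ℝ) := h2.symm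
      simp only [cechδ, smul_sub, Finset.sum_sub_distrib] at h3 ⊢
      rw [h3]
      push_cast
      simp)
  have h2 : ∀ a b c y (ha : y ∈ D.U.set a) (hb : y ∈ D.U.set b) (hc : y ∈ D.U.set c),
      G.mul _ _ (D.σ a b y ha hb) (D.σ b c y hb hc) =
        Complex.exp (2 * Real.pi * Complex.I * ↑(η b c y - η a c y + η a b y)) •
          D.σ a c y ha hc := fun a b' c y ha hb hc => by
    rw [D.mul_σ, ← h1 a b' c y ha hb hc]
    congr 1
    -- The exponents for ζ and ζ - b differ by 2πi times the integer `b`.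
    rw [Complex.exp_eq_exp_iff_exists_int]
    exact ⟨b ![a, b', c] y, by push_cast; ring⟩
  refine (D.correct η hη h2).isTrivial (fun a => ?_) fun a b c y ha hb hc => ?_
  · rw [dTopology_eq m M]
    exact D.U.isOpen a
  · rw [(D.correct η hη h2).mul_σ]
    simp

/-- Bundle gerbes with the same Dixmier–Douady class are stably isomorphic. -/
theorem HasDDClass.exists_stableIso (m : ℕ) [ChartedSpace (EuclideanSpace ℝ (Fin m)) M]
    [IsManifold (𝓡 m) ∞ M] [IsManifoldDiffeology m M]
    {h : CechH3 M} (hG : G.HasDDClass h) (hH : H.HasDDClass h) :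
    Nonempty (StableIso G H) := by
  -- A stable isomorphism is a trivialisation of G* ⊗ H, and this gerbe has class -h + h = 0.
  have h1 := hG.dual.tensor hH
  rw [neg_add_cancel] at h1
  exact HasDDClass.isTrivial m h1

end BundleGerbe

end BundleGerbeK
end

/-! ### The proposition. -/

theorem mainTheorem10
    {m : ℕ} {M : Type u} [TopologicalSpace M] [ChartedSpace (EuclideanSpace ℝ (Fin m)) M]
    [IsManifold (𝓡 m) ∞ M] [T2Space M] [SecondCountableTopology M]
    [DiffeologicalSpace M] [IsManifoldDiffeology m M] :
    -- the K-theory of a trivial bundle gerbe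
    (∀ (L : BundleGerbe.{u, v} M) (T : L.Trivialisation),
      ∃ e : L.K ≃+ KBun M,
        ∀ E : GerbeModule L, ∃ F : HermBundle M, T.Descends E F ∧ e E.toK = F.toK) ∧
    -- the module structure over K(M)
    (∀ L : BundleGerbe.{u, v} M,
      ∃ _ : Module (KBun M) L.K,
        ∀ (F : HermBundle M) (E : GerbeModule L), F.toK • E.toK = (E.tensorBundle F).toK) ∧
    -- products
    (∀ (h h' : CechH3 M) (L : BundleGerbe.{u, v} M) (J : BundleGerbe.{u, w} M),
      L.HasDDClass h → J.HasDDClass h' →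
        (L.tensor J).HasDDClass (h + h') ∧
        ∀ P : BundleGerbe.{u, v'} M, P.HasDDClass (h + h') →
          Nonempty (StableIso (L.tensor J) P) ∧
          ∀ α : StableIso (L.tensor J) P,
            ∃ φ : (L.tensor J).K ≃+ P.K, α.Induces φ ∧
              ∃ μ : L.K ⊗[ℤ] J.K →+ P.K,
                ∀ (E : GerbeModule L) (F : GerbeModule J),
                  μ (E.toK ⊗ₜ F.toK) = φ (E.tensor F).toK) ∧
    -- pull-backs
    (∀ {n : ℕ} {N : Type u'} [TopologicalSpace N] [ChartedSpace (EuclideanSpace ℝ (Fin n)) N]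
      [IsManifold (𝓡 n) ∞ N] [T2Space N] [SecondCountableTopology N]
      [DiffeologicalSpace N] [IsManifoldDiffeology n N]
      (f : N → M) (hf : ContMDiff (𝓡 n) (𝓡 m) ∞ f)
      (h : CechH3 M) (L : BundleGerbe.{u, v} M), L.HasDDClass h →
        (L.pullback f (dSmooth_of_contMDiff hf)).HasDDClass (CechH3.pullback f hf.continuous h) ∧
        ∀ J : BundleGerbe.{u', v'} N, J.HasDDClass (CechH3.pullback f hf.continuous h) →
          Nonempty (StableIso (L.pullback f (dSmooth_of_contMDiff hf)) J) ∧
          ∀ α : StableIso (L.pullback f (dSmooth_of_contMDiff hf)) J,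
            ∃ φ : (L.pullback f (dSmooth_of_contMDiff hf)).K ≃+ J.K, α.Induces φ ∧
              ∃ ψ : L.K →+ J.K,
                ∀ E : GerbeModule L,
                  ψ E.toK = φ (E.pullback f (dSmooth_of_contMDiff hf)).toK) := by
  refine ⟨fun L T => T.exists_addEquiv, fun L => ⟨L.moduleK, fun F E => L.smulK_toK F E⟩,
    fun h h' L J hL hJ => ⟨hL.tensor hJ, fun P hP => ⟨BundleGerbe.HasDDClass.exists_stableIso m (hL.tensor hJ) hP, fun α => ?_⟩⟩,
    fun {n N} _ _ _ _ _ _ _ f hf h L hL => ⟨hL.pullback (dSmooth_of_contMDiff hf) hf.continuous, fun J hJ =>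
      ⟨BundleGerbe.HasDDClass.exists_stableIso n
        (hL.pullback (dSmooth_of_contMDiff hf) hf.continuous) hJ, fun α => ?_⟩⟩⟩
  · obtain ⟨φ, hφ⟩ := StableIso.exists_induces α
    exact ⟨φ, hφ, φ.toAddMonoidHom.comp (L.tensorK J), fun E F =>
      congrArg φ (BundleGerbe.tensorK_tmul E F)⟩
  · obtain ⟨φ, hφ⟩ := StableIso.exists_induces α
    exact ⟨φ, hφ, φ.toAddMonoidHom.comp (L.pullbackK f (dSmooth_of_contMDiff hf)), fun E =>
      congrArg φ (BundleGerbe.pullbackK_toK f _ E)⟩
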